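/- Let $n\ge 1$ and $k\ge 1$ be integers, where $k\ge 2$ or $n=1$, and let $$0=x_{-k}=\dots=x_0<x_1<\dots<x_{n-1}<x_n=\dots=x_{n+k}=1 .$$ For $-k\le j\le n-1$ let $\xi_{j,k}=\frac{x_{j+1}+\dots+x_{j+k}}{k}$, and let $N_{j,k}\in C([0,1])$ be the normalized B-spline $$N_{j,k}(x)=(x_{j+k+1}-x_j)\,[x_j,\dots,x_{j+k+1}](\cdot-x)_+^k\qquad(0<x<1),$$ continuously extended to $[0,1]$; here $[x_j,\dots,x_{j+k+1}]$ is the divided difference. On the space $C([0,1])$ of real- or complex-valued continuous functions consider the Schoenberg variation diminishing spline operator $$S_{\Delta_n,k}f=\sum_{j=-k}^{n-1}f(\xi_{j,k})\,N_{j,k}.$$ Then there are real numbers $$1=\lambda_0=\lambda_1>\lambda_2>\dots>\lambda_{n+k-1}>\lambda_{n+k}=0$$ such that the set of eigenvalues of $S_{\Delta_n,k}$ is exactly $\{\lambda_0,\dots,\lambda_{n+k}\}$. The eigenvalue $1$ has geometric and algebraic multiplicity two, and each of $\lambda_2,\dots,\lambda_{n+k-1}$ has geometric and algebraic multiplicity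 one. Thus all nonzero eigenvalues of $S_{\Delta_n,k}$ are positive real numbers; there are exactly $n+k-1$ distinct ones (the double eigenvalue $1$ being counted once), and $n+k-2$ of them are different from $1$. -/

import Mathlib

open Set Filter Topology

/-- `x` is an extended knot sequence `x_{-k}, …, x_{n+k}` on `[0, 1]`:
`0 = x_{-k} = … = x_0 < x_1 < … < x_n = … = x_{n+k} = 1`.
Values of `x` at other indices are irrelevant. -/
structure IsExtendedKnotSequence (n k : ℕ) (x : ℤ → ℝ) : Prop where
  left : ∀ j : ℤ, -(k : ℤ) ≤ j → j ≤ 0 → x j = 0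
  lt : ∀ i j : ℤ, 0 ≤ i → i < j → j ≤ (n : ℤ) → x i < x j
  right : ∀ j : ℤ, (n : ℤ) ≤ j → j ≤ (n : ℤ) + k → x j = 1

/-- The divided difference `[x_j, …, x_{j+m}] f` at (possibly repeated) nondecreasing nodes. -/
noncomputable def dividedDifference (f : ℝ → ℝ) (x : ℤ → ℝ) : ℕ → ℤ → ℝ
  | 0, j => f (x j)
  | m + 1, j =>
    if x j = x (j + (m + 1)) then
      iteratedDeriv (m + 1) f (x j) / ((m + 1).factorial : ℝ)
    else
      (dividedDifference f x m (j + 1) - dividedDifference f x m j) / (x (j + (m + 1)) - x j)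

/-- The truncated power `u_+^k`. -/
noncomputable def truncatedPower (k : ℕ) (u : ℝ) : ℝ :=
  if 0 ≤ u then u ^ k else 0

/-- The formula `(x_{j+k+1} - x_j) [x_j, …, x_{j+k+1}] (· - t)_+^k` of the normalized B-spline of
degree `k`. If `0 < t < 1`, all derivatives that enter at the multiple knots `0` and `1` exist. -/
noncomputable def bsplineFormula (x : ℤ → ℝ) (k : ℕ) (j : ℤ) (t : ℝ) : ℝ :=
  (x (j + k + 1) - x j) *
    dividedDifference (fun s => truncatedPower k (s - t)) x (k + 1) j

/-- The normalized B-spline `N_{j,k}` on `[0, 1]`. At the end points, where the derivative of order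
`k` of the truncated power does not exist at the knot, it is the continuous extension of its values
in `(0, 1)`. -/
noncomputable def bspline (x : ℤ → ℝ) (k : ℕ) (j : ℤ) : ℝ → ℝ :=
  extendFrom (Ioo (0 : ℝ) 1) (bsplineFormula x k j)

/-- The Greville node `ξ_{j,k} = (x_{j+1} + ⋯ + x_{j+k}) / k`. -/
noncomputable def grevilleNode (x : ℤ → ℝ) (k : ℕ) (j : ℤ) : ℝ :=
  (∑ i ∈ Finset.Icc 1 k, x (j + (i : ℤ))) / k

theorem IsExtendedKnotSequence.mem_Icc {n k : ℕ} {x : ℤ → ℝ} (hx : IsExtendedKnotSequence n k x)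
    {j : ℤ} (h1 : -(k : ℤ) ≤ j) (h2 : j ≤ (n : ℤ) + k) : x j ∈ Icc (0 : ℝ) 1 := by
  have h0 : x 0 = 0 := hx.left 0 (by omega) le_rfl
  have hn : x n = 1 := hx.right n le_rfl (by omega)
  rcases le_or_gt j 0 with h | h
  · rw [hx.left j h1 h]; simp
  rcases le_or_gt (n : ℤ) j with h' | h'
  · rw [hx.right j h' h2]; simp
  · constructor
    · rw [← h0]; exact (hx.lt 0 j le_rfl h h'.le).le
    · rw [← hn]; exact (hx.lt j n h.le h' le_rfl).le

theorem IsExtendedKnotSequence.grevilleNode_mem {n k : ℕ} {x : ℤ → ℝ}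
    (hx : IsExtendedKnotSequence n k x) (hk : 1 ≤ k) {j : ℤ} (h1 : -(k : ℤ) ≤ j)
    (h2 : j < n) : grevilleNode x k j ∈ Icc (0 : ℝ) 1 := by
  have hk' : (0 : ℝ) < k := by exact_mod_cast hk
  have hm : ∀ i ∈ Finset.Icc 1 k, x (j + (i : ℤ)) ∈ Icc (0 : ℝ) 1 := by
    intro i hi
    rw [Finset.mem_Icc] at hi
    exact hx.mem_Icc (by omega) (by omega)
  constructor
  · exact div_nonneg (Finset.sum_nonneg fun i hi => (hm i hi).1) hk'.le
  · rw [grevilleNode, div_le_one hk']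
    simpa using Finset.sum_le_sum fun i hi => (hm i hi).2

theorem continuous_truncatedPower {k : ℕ} (hk : 1 ≤ k) : Continuous (truncatedPower k) := by
  have : truncatedPower k = fun u : ℝ => max u 0 ^ k := by
    funext u
    unfold truncatedPower
    split_ifs with h
    · rw [max_eq_left h]
    · rw [max_eq_right (not_le.mp h).le, zero_pow (by omega)]
  rw [this]
  fun_prop

theorem IsExtendedKnotSequence.exists_continuous_dividedDifference {n k : ℕ} {x : ℤ → ℝ}
    (hx : IsExtendedKnotSequence n k x) (hk : 1 ≤ k) (m : ℕ) :
    ∀ j : ℤ, -(k : ℤ) ≤ j → j + m ≤ (n : ℤ) + k →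
      ∃ G : ℝ → ℝ, Continuous G ∧ ∀ t ∈ Ioo (0 : ℝ) 1,
        dividedDifference (fun s => truncatedPower k (s - t)) x m j = G t := by
  induction m with
  | zero =>
    intro j _ _
    refine ⟨fun t => truncatedPower k (x j - t), ?_, fun t _ => rfl⟩
    exact (continuous_truncatedPower hk).comp (by fun_prop)
  | succ m ih =>
    intro j h1 h2
    push_cast at h2
    by_cases he : x j = x (j + (m + 1))
    · have hends : x j = 0 ∨ x j = 1 := by
        by_cases hj : j + (m + 1) ≤ 0
        · exact Or.inl (hx.left j h1 (by omega))
        by_cases hj' : (n : ℤ) ≤ j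
        · exact Or.inr (hx.right j hj' (by omega))
        by_cases hj0 : j ≤ 0
        · exact Or.inl (hx.left j h1 hj0)
        by_cases hjn : (n : ℤ) ≤ j + (m + 1)
        · exact Or.inr (by rw [he]; exact hx.right _ hjn (by omega))
        · exact absurd he (hx.lt _ _ (by omega) (by omega) (by omega)).ne
      rcases hends with h0 | h0
      · refine ⟨fun _ => 0, continuous_const, fun t ht => ?_⟩
        rw [dividedDifference, if_pos he, h0]
        have hev : (fun s => truncatedPower k (s - t)) =ᶠ[𝓝 (0 : ℝ)] fun _ => (0 : ℝ) := by
          filter_upwards [Iio_mem_nhds ht.1] with s hs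
          exact if_neg (by rw [mem_Iio] at hs; linarith)
        rw [hev.iteratedDeriv_eq]
        simp
      · refine ⟨fun t => (k.descFactorial (m + 1) : ℝ) * (1 - t) ^ (k - (m + 1)) /
          ((m + 1).factorial : ℝ), by fun_prop, fun t ht => ?_⟩
        rw [dividedDifference, if_pos he, h0]
        have hev : (fun s => truncatedPower k (s - t)) =ᶠ[𝓝 (1 : ℝ)] fun s => (s - t) ^ k := by
          filter_upwards [Ioi_mem_nhds ht.2] with s hs
          exact if_pos (by rw [mem_Ioi] at hs; linarith)
        rw [hev.iteratedDeriv_eq, iteratedDeriv_comp_sub_const (m + 1) (fun s : ℝ => s ^ k) t]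
        simp [Nat.cast_descFactorial]
    · obtain ⟨G₁, hG₁, e₁⟩ := ih (j + 1) (by omega) (by omega)
      obtain ⟨G₂, hG₂, e₂⟩ := ih j h1 (by omega)
      refine ⟨fun t => (G₁ t - G₂ t) / (x (j + (m + 1)) - x j), by fun_prop, fun t ht => ?_⟩
      rw [dividedDifference, if_neg he, e₁ t ht, e₂ t ht]

theorem IsExtendedKnotSequence.continuousOn_bspline {n k : ℕ} {x : ℤ → ℝ}
    (hx : IsExtendedKnotSequence n k x) (hk : 1 ≤ k) {j : ℤ} (h1 : -(k : ℤ) ≤ j)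
    (h2 : j < n) : ContinuousOn (bspline x k j) (Icc (0 : ℝ) 1) := by
  obtain ⟨G, hG, e⟩ := hx.exists_continuous_dividedDifference hk (k + 1) j h1
    (by push_cast; omega)
  apply continuousOn_extendFrom
  · rw [closure_Ioo zero_ne_one]
  · intro t _
    refine ⟨(x (j + k + 1) - x j) * G t, ?_⟩
    have hc : Tendsto (fun t => (x (j + k + 1) - x j) * G t) (𝓝[Ioo (0 : ℝ) 1] t)
        (𝓝 ((x (j + k + 1) - x j) * G t)) :=
      (Continuous.tendsto (by fun_prop) t).mono_left nhdsWithin_le_nhds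
    refine hc.congr' ?_
    filter_upwards [self_mem_nhdsWithin] with s hs
    rw [bsplineFormula, e s hs]

/-- Schoenberg's variation diminishing spline operator of degree `k` on `C([0, 1])`,
`S f = ∑_{j=-k}^{n-1} f(ξ_{j,k}) N_{j,k}`; the summation index is `j = i - k`, `0 ≤ i < n + k`. -/
noncomputable def schoenbergOperator (𝕜 : Type*) [RCLike 𝕜] {n k : ℕ} (hk : 1 ≤ k) {x : ℤ → ℝ}
    (hx : IsExtendedKnotSequence n k x) : Module.End 𝕜 C(Icc (0 : ℝ) 1, 𝕜) where
  toFun f :=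
    { toFun := fun t => ∑ i : Fin (n + k),
        f ⟨grevilleNode x k ((i : ℤ) - k), hx.grevilleNode_mem hk (by omega) (by omega)⟩ *
          ((bspline x k ((i : ℤ) - k) (t : ℝ) : ℝ) : 𝕜)
      continuous_toFun := by
        refine continuous_finsetSum _ fun i _ => continuous_const.mul ?_
        exact RCLike.continuous_ofReal.comp
          (hx.continuousOn_bspline hk (by omega) (by omega)).domRestrict }
  map_add' f g := by
    ext t
    simp [add_mul, Finset.sum_add_distrib]
  map_smul' c f := by
    ext t
    simp [mul_assoc, Finset.mul_sum]

/-! The operator is the composition of evaluation at the Greville nodes with the map from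
coefficients to splines. Composing the two in the other order gives the collocation map `a ↦ (∑ⱼ aⱼ
Nⱼ(ξᵢ))ᵢ` on `n + k` coefficients, and the generalized eigenspaces of the two compositions have
equal dimension away from `0` (`finrank_genEigenspace_comp`). For the collocation map, partition of
unity and linear precision give two independent eigenvectors with eigenvalue `1`. At `0` and `1`
only the first and the last B-spline survive, so eigenvectors of the interior matrix `M = (Nⱼ(ξᵢ))`
of size `n + k - 2` extend by zero. Once `M` has `n + k - 2` distinct eigenvalues in `(0, 1)`, the
dimension is exhausted and all multiplicities are forced. The eigenvalue `0` comes from a function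
that vanishes at all nodes.

Classically `M` is an oscillation matrix and the theorem of Gantmacher and Krein applies. Here
minors are avoided: the positivity used is that `M` and its transpose diminish sign variations
(`SignDim`), that `M` is nonsingular, and that the entries next to the diagonal are positive. Sign
diminution comes from knot insertion, where coefficients become convex combinations of neighbours;
after enough insertions the B-splines alive at different points are separated and the claim is
evident. Nonsingularity is `schoenberg_whitney`, proved from sign diminution and local linear
independence.

Eigenvalues are real and positive because the real parts of the orbit `μ ^ m • z` form an orbit of
`M`, whose number of sign changes is eventually constant; from then on the first sign is frozen, so
`Re μ ^ m` never changes sign, which forces `μ > 0`. They are simple because scaling one column by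
`1 + τ` keeps all zeros of the characteristic polynomial real, and near a multiple zero this is
possible only if the derivative in `τ` vanishes there; that would produce an eigenvector with first
entry `0`, which sign diminution forbids. They are less than `1` by a maximum principle. -/

/-- The divided difference `[x_j, …, x_{j+m}] (· - t)_+^l`. -/
noncomputable def truncDD (x : ℤ → ℝ) (l m : ℕ) (j : ℤ) (t : ℝ) : ℝ :=
  dividedDifference (fun s => truncatedPower l (s - t)) x m j

/-! ### Divided differences of truncated powers: recursions, positivity, support -/

namespace IsExtendedKnotSequence

variable {n k : ℕ} {x : ℤ → ℝ}

theorem mono (hx : IsExtendedKnotSequence n k x) {i j : ℤ} (hi : -(k : ℤ) ≤ i) (hij : i ≤ j)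
    (hj : j ≤ (n : ℤ) + k) : x i ≤ x j := by
  rcases le_or_gt j 0 with h | h
  · rw [hx.left i hi (by omega), hx.left j (by omega) h]
  rcases le_or_gt (n : ℤ) i with h' | h'
  · rw [hx.right i h' (by omega), hx.right j (by omega) hj]
  rcases le_or_gt i 0 with h0 | h0
  · rw [hx.left i hi h0]; exact (hx.mem_Icc (by omega) hj).1
  rcases le_or_gt (n : ℤ) j with hn | hn
  · rw [hx.right j hn hj]; exact (hx.mem_Icc hi (by omega)).2
  rcases hij.eq_or_lt with rfl | hlt
  · exact le_rfl
  · exact (hx.lt i j h0.le hlt hn.le).le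

theorem eq_iff (hx : IsExtendedKnotSequence n k x) {i j : ℤ} (hi : -(k : ℤ) ≤ i) (hij : i < j)
    (hj : j ≤ (n : ℤ) + k) : x i = x j ↔ j ≤ 0 ∨ (n : ℤ) ≤ i := by
  constructor
  · intro h
    by_contra! hcon
    rcases le_or_gt (n : ℤ) 0 with hn | hn
    · have h0 := hx.left 0 (by omega) le_rfl
      have h1 := hx.right 0 hn (by omega)
      linarith
    have h1 : x i ≤ x (max i 0) := hx.mono hi (by omega) (by omega)
    have h2 : x (max i 0) < x (min j n) := hx.lt _ _ (by omega) (by omega) (by omega)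
    have h3 : x (min j n) ≤ x j := hx.mono (by omega) (by omega) hj
    linarith
  · rintro (h | h)
    · rw [hx.left i hi (by omega), hx.left j (by omega) h]
    · rw [hx.right i h (by omega), hx.right j (by omega) hj]

theorem lt_of (hx : IsExtendedKnotSequence n k x) {i j : ℤ} (hi : -(k : ℤ) ≤ i) (hij : i < j)
    (hj : j ≤ (n : ℤ) + k) (h0 : 0 < j) (hn : i < n) : x i < x j :=
  lt_of_le_of_ne (hx.mono hi hij.le hj) fun h => by
    rcases (hx.eq_iff hi hij hj).1 h with h | h <;> omega

theorem pos_n (hx : IsExtendedKnotSequence n k x) : 0 < n := by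
  rcases Nat.eq_zero_or_pos n with h | h
  · have h0 := hx.left 0 (by omega) le_rfl
    have h1 := hx.right 0 (by omega) (by omega)
    linarith
  · exact h

theorem truncDD_left (hx : IsExtendedKnotSequence n k x) (l m : ℕ) {j : ℤ} (h1 : -(k : ℤ) ≤ j)
    (h2 : j + m ≤ 0) {t : ℝ} (ht : t ∈ Ioo (0 : ℝ) 1) : truncDD x l m j t = 0 := by
  have hj := hx.left j h1 (by omega)
  cases m with
  | zero =>
    show truncatedPower l (x j - t) = 0
    rw [hj]; exact if_neg (by linarith [ht.1])
  | succ m =>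
    push_cast at h2
    have he : x j = x (j + (m + 1)) := by rw [hj, hx.left _ (by omega) h2]
    rw [truncDD, dividedDifference, if_pos he, hj]
    have hev : (fun s => truncatedPower l (s - t)) =ᶠ[𝓝 (0 : ℝ)] fun _ => (0 : ℝ) := by
      filter_upwards [Iio_mem_nhds ht.1] with s hs
      exact if_neg (by rw [mem_Iio] at hs; linarith)
    rw [hev.iteratedDeriv_eq]
    simp

/-- Near `s = 1` the truncated power is the polynomial `(s - t) ^ l`, so the confluent divided
difference is its Taylor coefficient. For `m > l` the binomial coefficient makes it `0`. -/
theorem truncDD_right (hx : IsExtendedKnotSequence n k x) (l m : ℕ) {j : ℤ} (h1 : (n : ℤ) ≤ j)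
    (h2 : j + m ≤ (n : ℤ) + k) {t : ℝ} (ht : t ∈ Ioo (0 : ℝ) 1) :
    truncDD x l m j t = (l.choose m : ℝ) * (1 - t) ^ (l - m) := by
  have hj := hx.right j h1 (by omega)
  cases m with
  | zero =>
    show truncatedPower l (x j - t) = _
    rw [hj, truncatedPower, if_pos (by linarith [ht.2])]; simp
  | succ m =>
    push_cast at h2
    have he : x j = x (j + (m + 1)) := by rw [hj, hx.right _ (by omega) h2]
    rw [truncDD, dividedDifference, if_pos he, hj]
    have hev : (fun s => truncatedPower l (s - t)) =ᶠ[𝓝 (1 : ℝ)] fun s => (s - t) ^ l := by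
      filter_upwards [Ioi_mem_nhds ht.2] with s hs
      exact if_pos (by rw [mem_Ioi] at hs; linarith)
    have hd : iteratedDeriv (m + 1) (fun s : ℝ => s ^ l) (1 - t) =
        (l.descFactorial (m + 1) : ℝ) * (1 - t) ^ (l - (m + 1)) := by
      simp [Nat.cast_descFactorial]
    rw [hev.iteratedDeriv_eq, iteratedDeriv_comp_sub_const (m + 1) (fun s : ℝ => s ^ l) t]
    have : ((m + 1).factorial : ℝ) ≠ 0 := by exact_mod_cast (m + 1).factorial_ne_zero
    rw [div_eq_iff this]
    simp only [hd]
    rw [Nat.descFactorial_eq_factorial_mul_choose]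
    push_cast; ring

/-- Cleared of its denominator, the recursion survives coincident knots: interior knots are simple,
so both shorter windows then lie in the same end cluster, where their divided differences are equal.
-/
theorem truncDD_succ (hx : IsExtendedKnotSequence n k x) (l m : ℕ) {j : ℤ} (h1 : -(k : ℤ) ≤ j)
    (h2 : j + m + 1 ≤ (n : ℤ) + k) {t : ℝ} (ht : t ∈ Ioo (0 : ℝ) 1) :
    (x (j + m + 1) - x j) * truncDD x l (m + 1) j t =
      truncDD x l m (j + 1) t - truncDD x l m j t := by
  by_cases he : x j = x (j + m + 1)
  · rcases (hx.eq_iff h1 (by omega) h2).1 he with h | h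
    · rw [hx.truncDD_left l m h1 (by omega) ht, hx.truncDD_left l m (by omega) (by omega) ht, he]
      ring
    · rw [hx.truncDD_right l m h (by omega) ht, hx.truncDD_right l m (by omega) (by omega) ht, he]
      ring
  · have he' : ¬ x j = x (j + (m + 1)) := by rwa [← add_assoc]
    rw [truncDD, dividedDifference, if_neg he', ← add_assoc]
    have : x (j + m + 1) - x j ≠ 0 := sub_ne_zero.2 (Ne.symm he)
    rw [mul_div_cancel₀ _ this]; rfl

theorem truncatedPower_succ (l : ℕ) (u : ℝ) : truncatedPower (l + 1) u = u * truncatedPower l u := by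
  unfold truncatedPower
  split_ifs
  · ring
  · simp

/-- This is the Leibniz rule for `(s - t)₊ ^ (l + 1) = (s - t) (s - t)₊ ^ l`; the first factor is
linear, so only two terms remain. In the confluent case it is Pascal's rule. -/
theorem truncDD_leibniz (hx : IsExtendedKnotSequence n k x) (l m : ℕ) {j : ℤ}
    (h1 : -(k : ℤ) ≤ j) (h2 : j + m + 1 ≤ (n : ℤ) + k) {t : ℝ} (ht : t ∈ Ioo (0 : ℝ) 1) :
    truncDD x (l + 1) (m + 1) j t =
      (x j - t) * truncDD x l (m + 1) j t + truncDD x l m (j + 1) t := by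
  induction m generalizing j with
  | zero =>
    by_cases he : x j = x (j + (0 : ℕ) + 1)
    · rcases (hx.eq_iff h1 (by omega) h2).1 he with h | h
      · rw [hx.truncDD_left _ _ h1 (by push_cast at *; omega) ht,
          hx.truncDD_left _ _ h1 (by push_cast at *; omega) ht,
          hx.truncDD_left _ _ (by omega) (by push_cast at *; omega) ht]
        ring
      · rw [hx.truncDD_right _ _ h (by push_cast at *; omega) ht,
          hx.truncDD_right _ _ h (by push_cast at *; omega) ht,
          hx.truncDD_right _ _ (by omega) (by push_cast at *; omega) ht, hx.right j h (by omega)]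
        rcases l with _ | l
        · simp
        · simp; ring
    · have hne : x (j + (0 : ℕ) + 1) - x j ≠ 0 := sub_ne_zero.2 (Ne.symm he)
      apply mul_left_cancel₀ hne
      have e1 := hx.truncDD_succ (l + 1) 0 h1 h2 ht
      have e2 := hx.truncDD_succ l 0 h1 h2 ht
      have e3 : ∀ i, truncDD x (l + 1) 0 i t = (x i - t) * truncDD x l 0 i t := fun i =>
        truncatedPower_succ l _
      rw [e1, e3, e3]
      simp only [Nat.cast_zero, add_zero] at e2 ⊢
      linear_combination (t - x j) * e2
  | succ m ih =>
    push_cast at h2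
    by_cases he : x j = x (j + (m + 1 : ℕ) + 1)
    · rcases (hx.eq_iff h1 (by omega) (by push_cast; omega)).1 he with h | h
      · push_cast at h
        rw [hx.truncDD_left _ _ h1 (by push_cast; omega) ht,
          hx.truncDD_left _ _ h1 (by push_cast; omega) ht,
          hx.truncDD_left _ _ (by omega) (by push_cast; omega) ht]
        ring
      · rw [hx.truncDD_right _ _ h (by push_cast; omega) ht,
          hx.truncDD_right _ _ h (by push_cast; omega) ht,
          hx.truncDD_right _ _ (by omega) (by push_cast; omega) ht, hx.right j h (by omega),
          Nat.choose_succ_succ]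
        rcases lt_or_ge l (m + 2) with hl | hl
        · rw [Nat.choose_eq_zero_of_lt hl]
          have e : l + 1 - (m + 1 + 1) = l - (m + 1) := by omega
          rw [e]; push_cast; ring
        · obtain ⟨q, rfl⟩ := Nat.exists_eq_add_of_le hl
          have e1 : m + 2 + q + 1 - (m + 1 + 1) = q + 1 := by omega
          have e2 : m + 2 + q - (m + 1 + 1) = q := by omega
          have e3 : m + 2 + q - (m + 1) = q + 1 := by omega
          rw [e1, e2, e3]; push_cast; ring
    · have hne : x (j + (m + 1 : ℕ) + 1) - x j ≠ 0 := sub_ne_zero.2 (Ne.symm he)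
      apply mul_left_cancel₀ hne
      have e1 := hx.truncDD_succ (l + 1) (m + 1) h1 (by push_cast; omega) ht
      have e2 := hx.truncDD_succ l (m + 1) h1 (by push_cast; omega) ht
      have e3 := hx.truncDD_succ l m (j := j + 1) (by omega) (by omega) ht
      have i1 := ih (j := j + 1) (by omega) (by omega)
      have i2 := ih (j := j) (by omega) (by omega)
      rw [e1, i1, i2]
      have e4 : j + 1 + m + 1 = j + (m + 1 : ℕ) + 1 := by push_cast; ring
      rw [e4] at e3
      linear_combination (t - x j) * e2 - e3

/-- The recursion of Cox and de Boor. -/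
theorem truncDD_recursion (hx : IsExtendedKnotSequence n k x) (l : ℕ) {j : ℤ}
    (h1 : -(k : ℤ) ≤ j) (h2 : j + l + 2 ≤ (n : ℤ) + k) {t : ℝ} (ht : t ∈ Ioo (0 : ℝ) 1) :
    (x (j + l + 2) - x j) * truncDD x (l + 1) (l + 2) j t =
      (x (j + l + 2) - t) * truncDD x l (l + 1) (j + 1) t +
        (t - x j) * truncDD x l (l + 1) j t := by
  have e1 := hx.truncDD_succ (l + 1) (l + 1) h1 (by push_cast; omega) ht
  have e2 := hx.truncDD_leibniz l l (j := j + 1) (by omega) (by omega) ht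
  have e3 := hx.truncDD_leibniz l l h1 (by omega) ht
  have e4 := hx.truncDD_succ l l (j := j + 1) (by omega) (by omega) ht
  have a1 : j + (l + 1 : ℕ) + 1 = j + l + 2 := by push_cast; ring
  have a2 : j + 1 + l + 1 = j + l + 2 := by ring
  rw [a1] at e1
  rw [a2] at e4
  rw [e1, e2, e3]
  linear_combination -e4

/-- Positivity and support are proved together along the Cox–de Boor recursion: each linear factor
there is negative only where the B-spline it multiplies vanishes. Since `0₊ ^ 0 = 1` here, degree
`0` gives a multiple of the indicator of the half-open interval `(x_j, x_{j+1}]`; hence the clauses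
that distinguish `l = 0` from `1 ≤ l`. -/
theorem truncDD_support (hx : IsExtendedKnotSequence n k x) (l : ℕ) :
    ∀ {j : ℤ}, -(k : ℤ) ≤ j → j + l + 1 ≤ (n : ℤ) + k → ∀ {t : ℝ}, t ∈ Ioo (0 : ℝ) 1 →
      0 ≤ truncDD x l (l + 1) j t ∧
      (x j < t → (t < x (j + l + 1) ∨ l = 0 ∧ t = x (j + 1)) → 0 < truncDD x l (l + 1) j t) ∧
      ((t ≤ x j ∨ x (j + l + 1) < t ∨ 1 ≤ l ∧ x (j + l + 1) ≤ t) →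
        truncDD x l (l + 1) j t = 0) := by
  induction l with
  | zero =>
    intro j h1 h2 t ht
    have e := hx.truncDD_succ 0 0 h1 h2 ht
    simp only [Nat.cast_zero, add_zero] at e h2 ⊢
    by_cases he : x j = x (j + 1)
    · have hz : truncDD x 0 (0 + 1) j t = 0 := by
        rcases (hx.eq_iff h1 (by omega) h2).1 he with h | h
        · exact hx.truncDD_left _ _ h1 (by push_cast; omega) ht
        · rw [hx.truncDD_right _ _ h (by push_cast; omega) ht]; simp
      rw [hz]
      refine ⟨le_rfl, fun a b => ?_, fun _ => rfl⟩
      rw [← he] at b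
      rcases b with b | ⟨-, b⟩ <;> linarith
    · have hle : x j ≤ x (j + 1) := hx.mono h1 (by omega) h2
      have hlt : 0 < x (j + 1) - x j := sub_pos.2 (lt_of_le_of_ne hle he)
      have hf : ∀ i, truncDD x 0 0 i t = if t ≤ x i then 1 else 0 := by
        intro i
        show truncatedPower 0 _ = _
        simp [truncatedPower]
      rw [hf, hf] at e
      have hv : truncDD x 0 (0 + 1) j t =
          ((if t ≤ x (j + 1) then 1 else 0) - (if t ≤ x j then 1 else 0)) / (x (j + 1) - x j) := by
        rw [eq_div_iff hlt.ne', ← e]; ring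
      rw [hv]
      refine ⟨div_nonneg ?_ hlt.le, fun a b => div_pos ?_ hlt, fun h => ?_⟩
      · split_ifs <;> linarith
      · rw [if_pos (by rcases b with b | ⟨-, b⟩ <;> linarith), if_neg (by linarith)]; norm_num
      · rcases h with h | h | h
        · rw [if_pos h, if_pos (by linarith)]; simp
        · rw [if_neg (by linarith), if_neg (by linarith)]; simp
        · omega
  | succ l ih =>
    intro j h1 h2 t ht
    push_cast at h2
    have e := hx.truncDD_recursion l h1 (by omega) ht
    obtain ⟨p1, p2, p3⟩ := ih (j := j) h1 (by omega) ht
    obtain ⟨q1, q2, q3⟩ := ih (j := j + 1) (by omega) (by omega) ht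
    have a1 : j + (l + 1 : ℕ) + 1 = j + l + 2 := by push_cast; ring
    have a2 : j + 1 + l + 1 = j + l + 2 := by ring
    rw [a2] at q2 q3
    rw [a1]
    have m1 : x j ≤ x (j + 1) := hx.mono h1 (by omega) (by omega)
    have m2 : x (j + 1) ≤ x (j + l + 1) := hx.mono (by omega) (by omega) (by omega)
    have m3 : x (j + l + 1) ≤ x (j + l + 2) := hx.mono (by omega) (by omega) (by omega)
    by_cases he : x j = x (j + l + 2)
    · have hz : truncDD x (l + 1) (l + 2) j t = 0 := by
        rcases (hx.eq_iff h1 (by omega) (by omega)).1 he with h | h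
        · exact hx.truncDD_left _ _ h1 (by push_cast; omega) ht
        · rw [hx.truncDD_right _ _ h (by push_cast; omega) ht]; simp
      rw [hz]
      refine ⟨le_rfl, fun a b => ?_, fun _ => rfl⟩
      rw [← he] at b
      rcases b with b | ⟨b, -⟩
      · linarith
      · omega
    · have hlt : 0 < x (j + l + 2) - x j := by
        have : x j ≤ x (j + l + 2) := by linarith
        exact sub_pos.2 (lt_of_le_of_ne this he)
      have hv : truncDD x (l + 1) (l + 2) j t = ((x (j + l + 2) - t) * truncDD x l (l + 1) (j + 1) t +
        (t - x j) * truncDD x l (l + 1) j t) / (x (j + l + 2) - x j) := by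
        rw [eq_div_iff hlt.ne', ← e]; ring
      have t1 : 0 ≤ (x (j + l + 2) - t) * truncDD x l (l + 1) (j + 1) t := by
        rcases le_or_gt t (x (j + l + 2)) with h | h
        · exact mul_nonneg (by linarith) q1
        · rw [q3 (Or.inr (Or.inl h))]; simp
      have t2 : 0 ≤ (t - x j) * truncDD x l (l + 1) j t := by
        rcases le_or_gt t (x j) with h | h
        · rw [p3 (Or.inl h)]; simp
        · exact mul_nonneg (by linarith) p1
      have hzero : (t ≤ x j ∨ x (j + l + 2) ≤ t) → truncDD x (l + 1) (l + 2) j t = 0 := by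
        rintro (h | h)
        · rw [hv, p3 (Or.inl h), q3 (Or.inl (by linarith))]; simp
        · have hj : x (j + l + 1) < t := by
            rcases lt_or_ge (x (j + l + 1)) t with h' | h'
            · exact h'
            · exfalso
              -- Coincident knots are both `0` or both `1`, whereas `t` lies strictly between.
              have hE : x (j + l + 1) = x (j + l + 2) := by linarith
              have hT : x (j + l + 1) = t := by linarith
              rcases (hx.eq_iff (by omega) (by omega) (by omega)).1 hE with h3 | h3
              · have := hx.left (j + l + 1) (by omega) (by omega); linarith [ht.1]
              · have := hx.right (j + l + 1) (by omega) (by omega); linarith [ht.2]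
          have hz : (x (j + l + 2) - t) * truncDD x l (l + 1) (j + 1) t = 0 := by
            rcases h.eq_or_lt with h | h
            · rw [h]; simp
            · rw [q3 (Or.inr (Or.inl h))]; simp
          rw [hv, hz, p3 (Or.inr (Or.inl hj))]; simp
      refine ⟨?_, fun a b => ?_, fun h => hzero ?_⟩
      · rw [hv]; exact div_nonneg (add_nonneg t1 t2) hlt.le
      · have b : t < x (j + l + 2) := by
          rcases b with b | ⟨b, -⟩
          · exact b
          · omega
        rw [hv]
        apply div_pos _ hlt
        rcases lt_or_ge (x (j + 1)) t with h | h
        · exact add_pos_of_pos_of_nonneg (mul_pos (by linarith) (q2 h (Or.inl b))) t2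
        · apply add_pos_of_nonneg_of_pos t1
          -- Here `t ≤ x_{j+1}`. If `t` also reaches `x_{j+l+1}`, simplicity of the interior knots
          -- forces `l = 0`, the half-open case.
          refine mul_pos (by linarith) (p2 a ?_)
          rcases lt_or_ge t (x (j + l + 1)) with h' | h'
          · exact Or.inl h'
          · have hE : x (j + 1) = x (j + l + 1) := by linarith
            have hT : t = x (j + 1) := by linarith
            refine Or.inr ⟨?_, hT⟩
            by_contra hl
            rcases (hx.eq_iff (by omega) (by omega) (by omega)).1 hE with h3 | h3
            · have := hx.left (j + 1) (by omega) (by omega); linarith [ht.1]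
            · have := hx.right (j + 1) (by omega) (by omega); linarith [ht.2]
      · rcases h with h | h | h
        · exact Or.inl h
        · exact Or.inr h.le
        · exact Or.inr h.2

end IsExtendedKnotSequence

/-! ### Normalized B-splines: partition of unity and linear precision -/

/-- The normalized B-spline on `(0, 1)`. -/
noncomputable def normB (x : ℤ → ℝ) (l : ℕ) (j : ℤ) (t : ℝ) : ℝ :=
  (x (j + l + 1) - x j) * truncDD x l (l + 1) j t

namespace IsExtendedKnotSequence

variable {n k : ℕ} {x : ℤ → ℝ}

theorem normB_nonneg (hx : IsExtendedKnotSequence n k x) (l : ℕ) {j : ℤ} (h1 : -(k : ℤ) ≤ j)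
    (h2 : j + l + 1 ≤ (n : ℤ) + k) {t : ℝ} (ht : t ∈ Ioo (0 : ℝ) 1) : 0 ≤ normB x l j t :=
  mul_nonneg (sub_nonneg.2 (hx.mono h1 (by omega) h2)) (hx.truncDD_support l h1 h2 ht).1

theorem normB_pos (hx : IsExtendedKnotSequence n k x) (l : ℕ) {j : ℤ} (h1 : -(k : ℤ) ≤ j)
    (h2 : j + l + 1 ≤ (n : ℤ) + k) {t : ℝ} (ht : t ∈ Ioo (0 : ℝ) 1) (ha : x j < t)
    (hb : t < x (j + l + 1)) : 0 < normB x l j t :=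
  mul_pos (sub_pos.2 (ha.trans hb)) ((hx.truncDD_support l h1 h2 ht).2.1 ha (Or.inl hb))

theorem mem_support_of_normB_ne (hx : IsExtendedKnotSequence n k x) {l : ℕ} (hl : 1 ≤ l) {j : ℤ}
    (h1 : -(k : ℤ) ≤ j) (h2 : j + l + 1 ≤ (n : ℤ) + k) {t : ℝ} (ht : t ∈ Ioo (0 : ℝ) 1)
    (h : normB x l j t ≠ 0) : x j < t ∧ t < x (j + l + 1) := by
  by_contra hcon
  apply h
  have : truncDD x l (l + 1) j t = 0 := (hx.truncDD_support l h1 h2 ht).2.2 <| by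
    by_cases h3 : x j < t
    · exact Or.inr (Or.inr ⟨hl, not_lt.1 fun h4 => hcon ⟨h3, h4⟩⟩)
    · exact Or.inl (not_lt.1 h3)
  rw [normB, this, mul_zero]

theorem normB_eq_sub (hx : IsExtendedKnotSequence n k x) (l : ℕ) {j : ℤ} (h1 : -(k : ℤ) ≤ j)
    (h2 : j + l + 1 ≤ (n : ℤ) + k) {t : ℝ} (ht : t ∈ Ioo (0 : ℝ) 1) :
    normB x l j t = truncDD x l l (j + 1) t - truncDD x l l j t :=
  hx.truncDD_succ l l h1 h2 ht

theorem sum_Ico_sub_int (f : ℤ → ℝ) (a : ℤ) (d : ℕ) :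
    ∑ j ∈ Finset.Ico a (a + d), (f (j + 1) - f j) = f (a + d) - f a := by
  induction d with
  | zero => simp
  | succ d ih =>
    have : Finset.Ico a (a + (d + 1 : ℕ)) = insert (a + d) (Finset.Ico a (a + d)) := by
      ext i; simp; omega
    rw [this, Finset.sum_insert (by simp), ih]
    push_cast
    rw [add_assoc]; ring

/-- The sum telescopes. Since `l ≤ k`, the end clusters contain the first and the last window, whose
divided differences are `0` and `1`. -/
theorem sum_normB (hx : IsExtendedKnotSequence n k x) {l : ℕ} (hl : l ≤ k) {t : ℝ}
    (ht : t ∈ Ioo (0 : ℝ) 1) :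
    ∑ j ∈ Finset.Ico (-(k : ℤ)) (n + k - l), normB x l j t = 1 := by
  rw [Finset.sum_congr rfl fun j hj => hx.normB_eq_sub l (Finset.mem_Ico.1 hj).1
    (by have := (Finset.mem_Ico.1 hj).2; omega) ht]
  have e : (n : ℤ) + k - l = -(k : ℤ) + ((n + k + (k - l) : ℕ) : ℤ) := by push_cast [hl]; ring
  rw [e, sum_Ico_sub_int (fun j => truncDD x l l j t)]
  rw [hx.truncDD_left l l le_rfl (by omega) ht, hx.truncDD_right l l (by omega) (by omega) ht]
  simp

theorem grevilleNode_sub (x : ℤ → ℝ) {k : ℕ} (hk : 1 ≤ k) (j : ℤ) :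
    (k : ℝ) * (grevilleNode x k (j + 1) - grevilleNode x k j) = x (j + k + 1) - x (j + 1) := by
  have hk' : (k : ℝ) ≠ 0 := by positivity
  unfold grevilleNode
  rw [← sub_div, mul_div_cancel₀ _ hk']
  clear hk hk'
  induction k with
  | zero => simp
  | succ k ih =>
    rw [Finset.sum_Icc_succ_top (by omega), Finset.sum_Icc_succ_top (by omega)]
    have e1 : j + 1 + ((k + 1 : ℕ) : ℤ) = j + (k + 1 : ℕ) + 1 := by ring
    have e2 : j + ((k + 1 : ℕ) : ℤ) = j + k + 1 := by push_cast; ring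
    rw [e1, e2] at *
    linarith

/-- Summation by parts: by `grevilleNode_sub`, `k (ξ_{j+1} - ξ_j)` times a divided difference of
order `k` is a difference of two of order `k - 1`, so this sum telescopes too. At the right end the
primitive is `ξ_n - k (1 - t) / k = t`, where `ξ_n = 1` is the node one index past the last
B-spline. -/
theorem sum_grevilleNode_mul_normB (hx : IsExtendedKnotSequence n k x) (hk : 1 ≤ k) {t : ℝ}
    (ht : t ∈ Ioo (0 : ℝ) 1) :
    ∑ j ∈ Finset.Ico (-(k : ℤ)) n, grevilleNode x k j * normB x k j t = t := by
  have hk' : (k : ℝ) ≠ 0 := by positivity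
  have key : ∀ j ∈ Finset.Ico (-(k : ℤ)) n, grevilleNode x k j * normB x k j t =
      (fun j => grevilleNode x k j * truncDD x k k j t -
        truncDD x k (k - 1) (j + 1) t / k) (j + 1) -
      (fun j => grevilleNode x k j * truncDD x k k j t - truncDD x k (k - 1) (j + 1) t / k) j := by
    intro j hj
    rw [Finset.mem_Ico] at hj
    have e1 := grevilleNode_sub x hk j
    have e2 := hx.truncDD_succ k (k - 1) (j := j + 1) (by omega) (by omega) ht
    have a1 : j + 1 + ((k - 1 : ℕ) : ℤ) + 1 = j + k + 1 := by omega
    have a2 : k - 1 + 1 = k := by omega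
    rw [a1, a2] at e2
    rw [hx.normB_eq_sub k hj.1 (by omega) ht]
    field_simp
    linear_combination (-truncDD x k k (j + 1) t) * e1 - e2
  have hξ : grevilleNode x k n = 1 := by
    rw [grevilleNode, div_eq_one_iff_eq hk', Finset.sum_congr rfl fun i hi =>
      hx.right _ (by omega) (by have := (Finset.mem_Icc.1 hi).2; omega)]
    simp
  rw [Finset.sum_congr rfl key]
  have e : (n : ℤ) = -(k : ℤ) + ((n + k : ℕ) : ℤ) := by push_cast; ring
  conv_lhs => rw [e]
  rw [sum_Ico_sub_int (fun j => grevilleNode x k j * truncDD x k k j t -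
    truncDD x k (k - 1) (j + 1) t / k), ← e]
  rw [hξ, hx.truncDD_left k k le_rfl (by omega) ht,
    hx.truncDD_left k (k - 1) (j := -(k : ℤ) + 1) (by omega) (by omega) ht,
    hx.truncDD_right k k le_rfl (by omega) ht,
    hx.truncDD_right k (k - 1) (j := (n : ℤ) + 1) (by omega) (by omega) ht, Nat.choose_symm hk]
  have : k - (k - 1) = 1 := by omega
  rw [this]
  simp
  field_simp
  ring

end IsExtendedKnotSequence

/-! ### Knot insertion -/

theorem dividedDifference_congr (f : ℝ → ℝ) {x x' : ℤ → ℝ} (m : ℕ) {j j' : ℤ}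
    (h : ∀ i : ℕ, i ≤ m → x (j + i) = x' (j' + i)) :
    dividedDifference f x m j = dividedDifference f x' m j' := by
  induction m generalizing j j' with
  | zero => simpa [dividedDifference] using congrArg f (h 0 le_rfl)
  | succ m ih =>
    have h0 : x j = x' j' := by simpa using h 0 (by omega)
    have h1 : x (j + (m + 1)) = x' (j' + (m + 1)) := by simpa using h (m + 1) le_rfl
    have e1 : dividedDifference f x m (j + 1) = dividedDifference f x' m (j' + 1) := by
      apply ih
      intro i hi
      have := h (i + 1) (by omega)
      push_cast at this
      rw [add_assoc, add_comm 1, add_assoc, add_comm 1]; exact this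
    have e2 := ih (j := j) (j' := j') fun i hi => h i (by omega)
    rw [dividedDifference, dividedDifference, h0, h1, e1, e2]

theorem truncDD_congr {x x' : ℤ → ℝ} (l m : ℕ) {j j' : ℤ} (t : ℝ)
    (h : ∀ i : ℕ, i ≤ m → x (j + i) = x' (j' + i)) : truncDD x l m j t = truncDD x' l m j' t :=
  dividedDifference_congr _ m h

/-- The knot sequence with a new knot `y` after `x m`. -/
noncomputable def insertKnot (x : ℤ → ℝ) (m : ℤ) (y : ℝ) : ℤ → ℝ := fun i =>
  if i ≤ m then x i else if i = m + 1 then y else x (i - 1)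

theorem insertKnot_of_le (x : ℤ → ℝ) {m : ℤ} (y : ℝ) {i : ℤ} (h : i ≤ m) :
    insertKnot x m y i = x i := if_pos h

theorem insertKnot_self (x : ℤ → ℝ) (m : ℤ) (y : ℝ) : insertKnot x m y (m + 1) = y := by
  simp [insertKnot]

theorem insertKnot_of_gt (x : ℤ → ℝ) {m : ℤ} (y : ℝ) {i : ℤ} (h : m < i) :
    insertKnot x m y (i + 1) = x i := by
  unfold insertKnot
  rw [if_neg (by omega), if_neg (by omega)]; simp

/-- The weights in the refinement of B-splines after the insertion of a knot. -/
noncomputable def insertWeight (x : ℤ → ℝ) (k : ℕ) (m : ℤ) (y : ℝ) (j : ℤ) : ℝ :=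
  if j + k ≤ m then 1 else if m < j then 0 else (y - x j) / (x (j + k) - x j)

namespace IsExtendedKnotSequence

variable {n k : ℕ} {x : ℤ → ℝ}

theorem insertKnot (hx : IsExtendedKnotSequence n k x) {m : ℤ} {y : ℝ} (h0 : 0 ≤ m) (hm : m < n)
    (hl : x m < y) (hr : y < x (m + 1)) : IsExtendedKnotSequence (n + 1) k (insertKnot x m y) where
  left j h1 h2 := by rw [insertKnot_of_le x y (by omega)]; exact hx.left j h1 h2
  lt i j hi hij hj := by
    push_cast at hj
    rcases le_or_gt j m with h | h
    · rw [insertKnot_of_le x y h, insertKnot_of_le x y (by omega)]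
      exact hx.lt i j hi hij (by omega)
    obtain ⟨j, rfl⟩ : ∃ j', j = j' + 1 := ⟨j - 1, by ring⟩
    rcases (show m ≤ j by omega).eq_or_lt with rfl | h'
    · rw [insertKnot_self, insertKnot_of_le x y (by omega)]
      exact (hx.mono (by omega) (by omega) (by omega)).trans_lt hl
    rw [insertKnot_of_gt x y h']
    rcases le_or_gt i m with h3 | h3
    · rw [insertKnot_of_le x y h3]; exact hx.lt i j hi (by omega) (by omega)
    obtain ⟨i, rfl⟩ : ∃ i', i = i' + 1 := ⟨i - 1, by ring⟩
    rcases (show m ≤ i by omega).eq_or_lt with rfl | h4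
    · rw [insertKnot_self]
      exact hr.trans_le (hx.mono (by omega) (by omega) (by omega))
    rw [insertKnot_of_gt x y h4]
    exact hx.lt i j (by omega) (by omega) (by omega)
  right j h1 h2 := by
    push_cast at h1 h2
    obtain ⟨j, rfl⟩ : ∃ j', j = j' + 1 := ⟨j - 1, by ring⟩
    rw [insertKnot_of_gt x y (by omega)]; exact hx.right j (by omega) (by omega)

/-- Both identities are the divided difference recursion on the window enlarged by `y`: one omits
`y` or `x_j`, the other `y` or `x_{j+p}`. The index ranges say that `x_m`, respectively `x_{m+1}`,
lies in the window, so that the enlarged window is consecutive in the new sequence. -/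
theorem truncDD_insert (hx : IsExtendedKnotSequence n k x) {m : ℤ} {y : ℝ} (h0 : 0 ≤ m)
    (hm : m < n) (hl : x m < y) (hr : y < x (m + 1)) (l p : ℕ) {t : ℝ} (ht : t ∈ Ioo (0 : ℝ) 1) :
    (∀ j : ℤ, -(k : ℤ) ≤ j → j + p ≤ (n : ℤ) + k → j ≤ m → m ≤ j + p →
      truncDD x l p j t = truncDD (_root_.insertKnot x m y) l p (j + 1) t -
        (y - x j) * truncDD (_root_.insertKnot x m y) l (p + 1) j t) ∧
    (∀ j : ℤ, -(k : ℤ) ≤ j → j + p ≤ (n : ℤ) + k → j ≤ m + 1 → m + 1 ≤ j + p →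
      truncDD x l p j t = truncDD (_root_.insertKnot x m y) l p j t +
        (x (j + p) - y) * truncDD (_root_.insertKnot x m y) l (p + 1) j t) := by
  have hx' := hx.insertKnot h0 hm hl hr
  set x' := _root_.insertKnot x m y 
  have hle : ∀ i : ℤ, i ≤ m → x' i = x i := fun i h => insertKnot_of_le x y h
  have hself : x' (m + 1) = y := insertKnot_self x m y
  have hgt : ∀ i : ℤ, m < i → x' (i + 1) = x i := fun i h => insertKnot_of_gt x y h
  clear_value x'
  have hE : ∀ (p : ℕ) (j : ℤ), -(k : ℤ) ≤ j → j + p ≤ (n : ℤ) + k →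
      (x' (j + p + 1) - x' j) * truncDD x' l (p + 1) j t =
        truncDD x' l p (j + 1) t - truncDD x' l p j t := fun p j h1 h2 =>
    hx'.truncDD_succ l p h1 (by push_cast; omega) ht
  -- the first family of identities implies the second one
  have hQ' : ∀ p : ℕ, (∀ j : ℤ, -(k : ℤ) ≤ j → j + p ≤ (n : ℤ) + k → j ≤ m → m ≤ j + p →
      truncDD x l p j t = truncDD x' l p (j + 1) t - (y - x j) * truncDD x' l (p + 1) j t) →
      (∀ j : ℤ, -(k : ℤ) ≤ j → j + p ≤ (n : ℤ) + k → j ≤ m + 1 → m + 1 ≤ j + p →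
      truncDD x l p j t = truncDD x' l p j t +
        (x (j + p) - y) * truncDD x' l (p + 1) j t) := by
    intro p hQ j h1 h2 h3 h4
    have e := hE p j h1 h2
    rw [hgt _ (by omega)] at e
    rcases h3.eq_or_lt with rfl | h5
    · rw [hself] at e
      have : truncDD x l p (m + 1) t = truncDD x' l p (m + 1 + 1) t := by
        apply truncDD_congr
        intro i _
        rw [show m + 1 + 1 + (i : ℤ) = m + 1 + i + 1 by ring, hgt _ (by omega)]
      linarith
    · rw [hle _ (by omega)] at e
      rw [hQ j h1 h2 (by omega) (by omega)]
      linear_combination -e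
  -- If the window ends at `x_m`, then `y` is the last node of the enlarged window and the recursion
  -- for the new knots is already the claim.
  have hedge : ∀ (p : ℕ) (j : ℤ), -(k : ℤ) ≤ j → j + p ≤ (n : ℤ) + k → m = j + p →
      truncDD x l p j t = truncDD x' l p (j + 1) t - (y - x j) * truncDD x' l (p + 1) j t := by
    intro p j h1 h2 h3
    have e := hE p j h1 h2
    rw [← h3, hself, hle _ (by omega)] at e
    have : truncDD x l p j t = truncDD x' l p j t := by
      apply truncDD_congr
      intro i _
      rw [hle _ (by omega)]
    linarith
  have hQ : ∀ p : ℕ, (∀ j : ℤ, -(k : ℤ) ≤ j → j + p ≤ (n : ℤ) + k → j ≤ m → m ≤ j + p →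
      truncDD x l p j t = truncDD x' l p (j + 1) t - (y - x j) * truncDD x' l (p + 1) j t) := by
    intro p
    induction p with
    | zero => intro j h1 h2 h3 h4; exact hedge 0 j h1 h2 (by push_cast at *; omega)
    | succ p ih =>
      intro j h1 h2 h3 h4
      rcases h4.eq_or_lt with h5 | h5
      · exact hedge _ j h1 h2 h5
      push_cast at h2 h4 h5
      have e1 := hQ' p ih (j + 1) (by omega) (by omega) (by omega) (by omega)
      have e2 := ih j h1 (by omega) h3 (by omega)
      have e3 := hx.truncDD_succ l p h1 (by omega) ht
      have e4 := hE (p + 1) j h1 (by push_cast; omega)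
      rw [hgt _ (by push_cast; omega), hle _ h3] at e4
      have a1 : j + 1 + (p : ℤ) = j + p + 1 := by ring
      have a2 : j + ((p + 1 : ℕ) : ℤ) = j + p + 1 := by push_cast; ring
      rw [a1] at e1
      rw [a2] at e4
      have hne : x (j + p + 1) - x j ≠ 0 := by
        have b1 : x j ≤ x m := hx.mono h1 h3 (by omega)
        have b2 : x (m + 1) ≤ x (j + p + 1) := hx.mono (by omega) (by omega) (by omega)
        linarith
      apply mul_left_cancel₀ hne
      rw [e3, e1, e2]
      linear_combination (y - x j) * e4
  exact ⟨hQ p, hQ' p (hQ p)⟩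

theorem insertWeight_mem (hx : IsExtendedKnotSequence n k x) {m : ℤ} {y : ℝ}
    (hm : m < n) (hl : x m < y) (hr : y < x (m + 1)) {j : ℤ} (h1 : -(k : ℤ) ≤ j) :
    insertWeight x k m y j ∈ Icc (0 : ℝ) 1 := by
  unfold insertWeight
  split_ifs with h3 h4
  · simp
  · simp
  · have b1 : x j ≤ x m := hx.mono h1 (by omega) (by omega)
    have b2 : x (m + 1) ≤ x (j + k) := hx.mono (by omega) (by omega) (by omega)
    constructor
    · exact div_nonneg (by linarith) (by linarith)
    · rw [div_le_one (by linarith)]; linarith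

/-- Knot insertion. -/
theorem normB_insert (hx : IsExtendedKnotSequence n k x) {m : ℤ} {y : ℝ} (h0 : 0 ≤ m)
    (hm : m < n) (hl : x m < y) (hr : y < x (m + 1)) {j : ℤ} (h1 : -(k : ℤ) ≤ j)
    (h2 : j < (n : ℤ)) {t : ℝ} (ht : t ∈ Ioo (0 : ℝ) 1) :
    normB x k j t = insertWeight x k m y j * normB (_root_.insertKnot x m y) k j t +
      (1 - insertWeight x k m y (j + 1)) * normB (_root_.insertKnot x m y) k (j + 1) t := by
  have hD := hx.truncDD_insert h0 hm hl hr k k ht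
  set x' := _root_.insertKnot x m y 
  have hle : ∀ i : ℤ, i ≤ m → x' i = x i := fun i h => insertKnot_of_le x y h
  have hself : x' (m + 1) = y := insertKnot_self x m y
  have hgt : ∀ i : ℤ, m < i → x' (i + 1) = x i := fun i h => insertKnot_of_gt x y h
  clear_value x'
  rcases lt_or_ge m j with h3 | h3
  · have a1 : insertWeight x k m y j = 0 := by
      rw [insertWeight, if_neg (by omega), if_pos h3]
    have a2 : insertWeight x k m y (j + 1) = 0 := by
      rw [insertWeight, if_neg (by omega), if_pos (by omega)]
    have a3 : truncDD x k (k + 1) j t = truncDD x' k (k + 1) (j + 1) t := by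
      apply truncDD_congr
      intro i _
      rw [show j + 1 + (i : ℤ) = j + i + 1 by ring, hgt _ (by omega)]
    rw [a1, a2, normB, normB, normB, a3, show j + 1 + (k : ℤ) + 1 = j + k + 1 + 1 by ring, 
      hgt j h3, hgt (j + k + 1) (by omega)]
    ring
  rcases lt_or_ge (j + k) m with h4 | h4
  · have a1 : insertWeight x k m y j = 1 := by
      rw [insertWeight, if_pos (by omega)]
    have a2 : insertWeight x k m y (j + 1) = 1 := by
      rw [insertWeight, if_pos (by omega)]
    have a3 : truncDD x k (k + 1) j t = truncDD x' k (k + 1) j t := by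
      apply truncDD_congr
      intro i _
      rw [hle _ (by omega)]
    rw [a1, a2, normB, normB, normB, a3, hle _ h3,
      hle _ (by omega)]
    ring
  -- The old B-spline is a difference of divided differences at `j + 1` and `j`. Expanding them by
  -- the second and the first family makes the common term `truncDD x' k k (j + 1) t` cancel.
  have e1 := hD.1 j h1 (by omega) h3 h4
  have e2 := hD.2 (j + 1) (by omega) (by omega) (by omega)
    (by omega)
  rw [show j + 1 + (k : ℤ) = j + k + 1 by ring] at *
  have b1 : x j ≤ x m := hx.mono h1 (by omega) (by omega)
  have b2 : x (m + 1) ≤ x (j + k + 1) := hx.mono (by omega) (by omega) (by omega)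
  have c1 : insertWeight x k m y j * normB x' k j t = (y - x j) * truncDD x' k (k + 1) j t := by
    rw [normB, hle _ h3, insertWeight]
    rcases h4.eq_or_lt with h5 | h5
    · rw [if_pos (by omega), ← h5, hself]; ring
    · have b3 : x (m + 1) ≤ x (j + k) := hx.mono (by omega) (by omega) (by omega)
      rw [if_neg (by omega), if_neg (by omega), hgt _ (by omega), ← mul_assoc,
        div_mul_cancel₀]
      linarith
  have c2 : (1 - insertWeight x k m y (j + 1)) * normB x' k (j + 1) t =
      (x (j + k + 1) - y) * truncDD x' k (k + 1) (j + 1) t := by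
    rw [normB, show j + 1 + (k : ℤ) + 1 = j + k + 1 + 1 by ring,
      hgt _ (by omega), insertWeight]
    rcases h3.eq_or_lt with h5 | h5
    · rw [if_neg (by omega), if_pos (by omega), h5, hself]; ring
    · have b3 : x (j + 1) ≤ x m := hx.mono (by omega) (by omega) (by omega)
      have hne : x (j + 1 + k) - x (j + 1) ≠ 0 := by
        rw [show j + 1 + (k : ℤ) = j + k + 1 by ring]; linarith
      rw [if_neg (by omega), if_neg (by omega), hle _ (by omega)]
      rw [show j + 1 + (k : ℤ) = j + k + 1 by ring] at *
      field_simp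
      ring
  rw [c1, c2, hx.normB_eq_sub k h1 (by omega) ht, e1, e2]
  ring

end IsExtendedKnotSequence

/-! ### Diminishing of sign variations -/

/-- `c'` arises from `c` by diminishing sign variations: there is a map of indices which preserves
signs and is increasing on pairs of entries of opposite sign. -/
def SignDim {ι κ : Type*} [LT ι] [LT κ] (c' : ι → ℝ) (c : κ → ℝ) : Prop :=
  ∃ e : ι → κ, (∀ i, c' i ≠ 0 → 0 < c' i * c (e i)) ∧
    ∀ i j, i < j → c' i * c' j < 0 → e i < e j

namespace SignDim

variable {ι κ ν : Type*} [LT κ] [LT ν]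

theorem trans [LT ι] {a : ι → ℝ} {b : κ → ℝ} {c : ν → ℝ} (h : SignDim a b) (h' : SignDim b c) :
    SignDim a c := by
  obtain ⟨e, h1, h2⟩ := h
  obtain ⟨e', h1', h2'⟩ := h'
  have key : ∀ i, a i ≠ 0 → 0 < b (e i) * c (e' (e i)) := fun i hi =>
    h1' _ (right_ne_zero_of_mul (h1 i hi).ne')
  refine ⟨e' ∘ e, fun i hi => ?_, fun i j hij hneg => h2' _ _ (h2 i j hij hneg) ?_⟩
  · have := mul_pos (h1 i hi) (key i hi)
    have hb := right_ne_zero_of_mul (h1 i hi).ne'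
    have hb2 : 0 < b (e i) ^ 2 := by positivity
    simp only [Function.comp]
    nlinarith
  · have hi : a i ≠ 0 := by rintro h; simp [h] at hneg
    have hj : a j ≠ 0 := by rintro h; simp [h] at hneg
    have := mul_pos (h1 i hi) (h1 j hj)
    nlinarith

theorem comp [LT ι] {ι' : Type*} [LT ι'] {a : ι → ℝ} {b : κ → ℝ} (h : SignDim a b) (g : ι' → ι)
    (hg : ∀ i j, i < j → g i < g j) : SignDim (a ∘ g) b := by
  obtain ⟨e, h1, h2⟩ := h
  exact ⟨e ∘ g, fun i hi => h1 _ hi, fun i j hij hneg => h2 _ _ (hg _ _ hij) hneg⟩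

/-- Convex combinations of neighbours. -/
theorem of_le_neighbours {a : ℤ → ℝ} {b : ℤ → ℝ} (s t : ℤ → ℤ) (u v : ℤ → ℝ)
    (hu : ∀ i, a i ≠ 0 → 0 ≤ u i) (hv : ∀ i, a i ≠ 0 → 0 ≤ v i)
    (hab : ∀ i, a i ≠ 0 → a i = u i * b (s i) + v i * b (t i))
    (hst : ∀ i, s i ≤ t i) (hts : ∀ i j, i < j → t i ≤ s j) : SignDim a b := by
  classical
  have key : ∀ i, a i ≠ 0 → 0 < a i * b (s i) ∨ 0 < a i * b (t i) := by
    intro i hi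
    by_contra! hcon
    have h1 : 0 < a i * a i := mul_self_pos.2 hi
    have h2 : a i * a i = u i * (a i * b (s i)) + v i * (a i * b (t i)) := by
      linear_combination a i * hab i hi
    have h3 := mul_nonpos_of_nonneg_of_nonpos (hu i hi) hcon.1
    have h4 := mul_nonpos_of_nonneg_of_nonpos (hv i hi) hcon.2
    linarith
  have hpos : ∀ i, a i ≠ 0 → 0 < a i * b (if 0 < a i * b (s i) then s i else t i) := by
    intro i hi
    split_ifs with h
    · exact h
    · exact (key i hi).resolve_left h
  refine ⟨fun i => if 0 < a i * b (s i) then s i else t i, hpos, fun i j hij hneg => ?_⟩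
  have hi : a i ≠ 0 := by rintro h; simp [h] at hneg
  have hj : a j ≠ 0 := by rintro h; simp [h] at hneg
  have hle : (if 0 < a i * b (s i) then s i else t i) ≤ if 0 < a j * b (s j) then s j else t j := by
    have := hst i; have := hst j; have := hts i j hij
    split_ifs <;> omega
  -- A common index would give `a i` and `a j` the same sign.
  refine lt_of_le_of_ne hle fun heq => ?_
  have p1 := hpos i hi
  have p2 := hpos j hj
  simp only at heq
  rw [heq] at p1
  have := mul_pos p1 p2
  nlinarith [sq_nonneg (b (if 0 < a j * b (s j) then s j else t j))]

end SignDim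

/-! ### Variation diminution of splines and of moments, by refinement -/

/-- The spline with B-spline coefficients `c`, on `(0, 1)`. -/
noncomputable def splineSum (x : ℤ → ℝ) (n k : ℕ) (c : ℤ → ℝ) (t : ℝ) : ℝ :=
  ∑ j ∈ Finset.Ico (-(k : ℤ)) n, c j * normB x k j t

/-- The action of the measure `∑ y_r δ_{t_r}` on the B-splines. -/
noncomputable def bsplineMoment (x : ℤ → ℝ) (n k : ℕ) {p : ℕ} (y t : Fin p → ℝ) (j : ℤ) : ℝ :=
  if j ∈ Finset.Ico (-(k : ℤ)) n then ∑ r, y r * normB x k j (t r) else 0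

namespace IsExtendedKnotSequence

variable {n k : ℕ} {x : ℤ → ℝ}

theorem exists_mem_knot_interval (hx : IsExtendedKnotSequence n k x) {y : ℝ}
    (hy : y ∈ Ioo (0 : ℝ) 1) (hne : ∀ i : ℤ, 0 ≤ i → i ≤ n → x i ≠ y) :
    ∃ m : ℤ, 0 ≤ m ∧ m < n ∧ x m < y ∧ y < x (m + 1) := by
  classical
  have h0 : x 0 = 0 := hx.left 0 (by omega) le_rfl
  have h1 : x n = 1 := hx.right n le_rfl (by omega)
  set s := (Finset.Icc (0 : ℤ) n).filter fun i => x i < y with hs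
  have hne' : s.Nonempty := ⟨0, by simp [hs, h0, hy.1]⟩
  have hm := s.max'_mem hne'
  set m := s.max' hne' with hmdef
  rw [hs, Finset.mem_filter, Finset.mem_Icc] at hm
  have hmn : m < n := lt_of_le_of_ne hm.1.2 (by rintro h; rw [h, h1] at hm; linarith [hm.2, hy.2])
  refine ⟨m, hm.1.1, hmn, hm.2, ?_⟩
  by_contra hcon
  have : x (m + 1) < y := lt_of_le_of_ne (not_lt.1 hcon) (hne _ (by omega) (by omega))
  have := s.le_max' (m + 1) (by rw [hs, Finset.mem_filter, Finset.mem_Icc]; exact ⟨by omega, this⟩)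
  omega

/-- Boehm's algorithm, the transpose of `normB_insert`: the new coefficient at `j` collects
contributions from the old B-splines `j - 1` and `j`. Vanishing of `c` outside the range takes care
of both ends. -/
theorem splineSum_insert (hx : IsExtendedKnotSequence n k x) {m : ℤ} {y : ℝ} (h0 : 0 ≤ m)
    (hm : m < n) (hl : x m < y) (hr : y < x (m + 1)) {c : ℤ → ℝ}
    (hc : ∀ j ∉ Finset.Ico (-(k : ℤ)) n, c j = 0) {t : ℝ} (ht : t ∈ Ioo (0 : ℝ) 1) :
    splineSum x n k c t = splineSum (_root_.insertKnot x m y) (n + 1) k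
      (fun j => (1 - insertWeight x k m y j) * c (j - 1) + insertWeight x k m y j * c j) t := by
  unfold splineSum
  set x' := _root_.insertKnot x m y
  set a := insertWeight x k m y with ha
  have e1 : ∑ j ∈ Finset.Ico (-(k : ℤ)) n, c j * normB x k j t =
      ∑ j ∈ Finset.Ico (-(k : ℤ)) n, a j * c j * normB x' k j t +
      ∑ j ∈ Finset.Ico (-(k : ℤ)) n,
        (fun j => (1 - a j) * c (j - 1) * normB x' k j t) (j + 1) := by
    rw [← Finset.sum_add_distrib]
    refine Finset.sum_congr rfl fun j hj => ?_
    rw [Finset.mem_Ico] at hj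
    rw [hx.normB_insert h0 hm hl hr hj.1 hj.2 ht]
    simp only [add_sub_cancel_right]
    ring
  rw [e1, Finset.sum_Ico_add' (fun j => (1 - a j) * c (j - 1) * normB x' k j t)]
  have e2 : ∑ j ∈ Finset.Ico (-(k : ℤ)) n, a j * c j * normB x' k j t =
      ∑ j ∈ Finset.Ico (-(k : ℤ)) (n + 1 : ℕ), a j * c j * normB x' k j t := by
    apply Finset.sum_subset
    · intro j; simp only [Finset.mem_Ico]; omega
    · intro j _ hj; rw [hc j hj]; ring
  have e3 : ∑ j ∈ Finset.Ico (-(k : ℤ) + 1) (n + 1), (1 - a j) * c (j - 1) * normB x' k j t =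
      ∑ j ∈ Finset.Ico (-(k : ℤ)) (n + 1 : ℕ), (1 - a j) * c (j - 1) * normB x' k j t := by
    apply Finset.sum_subset
    · intro j; simp only [Finset.mem_Ico]; omega
    · intro j _ hj
      rw [hc (j - 1) (by simp only [Finset.mem_Ico] at *; omega)]; ring
  rw [e2, e3, ← Finset.sum_add_distrib]
  refine Finset.sum_congr rfl fun j _ => ?_
  ring

/-- One insertion makes new coefficients convex combinations of adjacent old ones, and old moments
nonnegative combinations of adjacent new ones. So coefficients cannot gain variations under
refinement, nor moments under coarsening; both relations compose over `Y`. -/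
theorem exists_refinement (hx : IsExtendedKnotSequence n k x) (Y : Finset ℝ)
    (hY : ∀ y ∈ Y, y ∈ Ioo (0 : ℝ) 1) :
    ∃ (n' : ℕ) (x' : ℤ → ℝ), IsExtendedKnotSequence n' k x' ∧
      (∀ y ∈ Y, ∃ i : ℤ, 0 ≤ i ∧ i ≤ n' ∧ x' i = y) ∧
      (∀ c : ℤ → ℝ, (∀ j ∉ Finset.Ico (-(k : ℤ)) n, c j = 0) →
        ∃ c' : ℤ → ℝ, (∀ j ∉ Finset.Ico (-(k : ℤ)) n', c' j = 0) ∧ SignDim c' c ∧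
          ∀ t ∈ Ioo (0 : ℝ) 1, splineSum x n k c t = splineSum x' n' k c' t) ∧
      (∀ (p : ℕ) (y t : Fin p → ℝ), (∀ r, t r ∈ Ioo (0 : ℝ) 1) →
        SignDim (bsplineMoment x n k y t) (bsplineMoment x' n' k y t)) := by
  classical
  induction Y using Finset.induction_on with
  | empty =>
    refine ⟨n, x, hx, by simp, fun c hc => ⟨c, hc, ⟨id, ?_, fun i j h _ => h⟩, fun t _ => rfl⟩,
      fun p y t _ => ⟨id, ?_, fun i j h _ => h⟩⟩
    · intro i hi; exact mul_self_pos.2 hi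
    · intro i hi; exact mul_self_pos.2 hi
  | insert y Y _ ih =>
    obtain ⟨n', x', hx', hk, h1, h2⟩ := ih fun z hz => hY z (Finset.mem_insert_of_mem hz)
    by_cases hy : ∃ i : ℤ, 0 ≤ i ∧ i ≤ n' ∧ x' i = y
    · refine ⟨n', x', hx', fun z hz => ?_, h1, h2⟩
      rcases Finset.mem_insert.1 hz with rfl | hz
      · exact hy
      · exact hk z hz
    push Not at hy
    obtain ⟨m, hm0, hmn, hl, hr⟩ :=
      hx'.exists_mem_knot_interval (hY y (Finset.mem_insert_self _ _)) hy
    have hw : ∀ j : ℤ, -(k : ℤ) ≤ j → insertWeight x' k m y j ∈ Icc (0 : ℝ) 1 := fun j hj =>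
      hx'.insertWeight_mem hmn hl hr hj
    refine ⟨n' + 1, _root_.insertKnot x' m y, hx'.insertKnot hm0 hmn hl hr, fun z hz => ?_,
      fun c hc => ?_, fun p z t ht => (h2 p z t ht).trans ?_⟩
    · rcases Finset.mem_insert.1 hz with rfl | hz
      · exact ⟨m + 1, by omega, by push_cast; omega, insertKnot_self _ _ _⟩
      obtain ⟨i, hi0, hin, hi⟩ := hk z hz
      rcases le_or_gt i m with him | him
      · exact ⟨i, hi0, by push_cast; omega, by rw [insertKnot_of_le _ _ him, hi]⟩
      · exact ⟨i + 1, by omega, by push_cast; omega, by rw [insertKnot_of_gt _ _ him, hi]⟩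
    · obtain ⟨c', hc', hdim, hs⟩ := h1 c hc
      have hz : ∀ j ∉ Finset.Ico (-(k : ℤ)) (n' + 1 : ℕ),
          (1 - insertWeight x' k m y j) * c' (j - 1) + insertWeight x' k m y j * c' j = 0 := by
        intro j hj
        rw [Finset.mem_Ico] at hj
        rw [hc' j (by rw [Finset.mem_Ico]; push_cast at hj; omega),
          hc' (j - 1) (by rw [Finset.mem_Ico]; push_cast at hj; omega)]
        ring
      refine ⟨_, hz, SignDim.trans ?_ hdim, fun t ht => ?_⟩
      · have hmem : ∀ j, (1 - insertWeight x' k m y j) * c' (j - 1) +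
            insertWeight x' k m y j * c' j ≠ 0 → -(k : ℤ) ≤ j := fun j hj => by
          by_contra hcon
          exact hj (hz j (by rw [Finset.mem_Ico]; omega))
        refine SignDim.of_le_neighbours (fun i => i - 1) (fun i => i)
          (fun i => 1 - insertWeight x' k m y i) (fun i => insertWeight x' k m y i)
          (fun i hi => ?_) (fun i hi => ?_) (fun i _ => rfl) (fun i => by simp)
          (fun i j h => by omega)
        · have := (hw i (hmem i hi)).2; linarith
        · exact (hw i (hmem i hi)).1
      · rw [hs t ht, hx'.splineSum_insert hm0 hmn hl hr hc' ht]
    · have hmem : ∀ j, bsplineMoment x' n' k z t j ≠ 0 → j ∈ Finset.Ico (-(k : ℤ)) n' :=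
        fun j hj => by
          by_contra hcon
          exact hj (if_neg hcon)
      refine SignDim.of_le_neighbours (fun i => i) (fun i => i + 1)
          (fun i => insertWeight x' k m y i) (fun i => 1 - insertWeight x' k m y (i + 1))
          (fun i hi => ?_) (fun i hi => ?_) (fun i hi => ?_) (fun i => by simp)
          (fun i j h => by omega)
      · exact (hw i (Finset.mem_Ico.1 (hmem i hi)).1).1
      · have := (hw (i + 1) (by have := (Finset.mem_Ico.1 (hmem i hi)).1; omega)).2
        linarith
      · have hi' := Finset.mem_Ico.1 (hmem i hi)
        unfold bsplineMoment
        rw [if_pos (hmem i hi), if_pos (by rw [Finset.mem_Ico]; push_cast; omega),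
          if_pos (by rw [Finset.mem_Ico]; push_cast; omega), Finset.mul_sum, Finset.mul_sum,
          ← Finset.sum_add_distrib]
        refine Finset.sum_congr rfl fun r _ => ?_
        rw [hx'.normB_insert hm0 hmn hl hr hi'.1 hi'.2 (ht r)]
        ring

/-- After inserting knots, different points belong to the supports of different B-splines. -/
theorem exists_separating_refinement (hx : IsExtendedKnotSequence n k x) (hk : 1 ≤ k) {p : ℕ}
    {t : Fin p → ℝ} (hmono : StrictMono t) (ht : ∀ r, t r ∈ Ioo (0 : ℝ) 1) :
    ∃ (n' : ℕ) (x' : ℤ → ℝ), IsExtendedKnotSequence n' k x' ∧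
      (∀ r r', r < r' → ∀ j ∈ Finset.Ico (-(k : ℤ)) n', ∀ j' ∈ Finset.Ico (-(k : ℤ)) n',
        normB x' k j (t r) ≠ 0 → normB x' k j' (t r') ≠ 0 → j < j') ∧
      (∀ c : ℤ → ℝ, (∀ j ∉ Finset.Ico (-(k : ℤ)) n, c j = 0) →
        ∃ c' : ℤ → ℝ, (∀ j ∉ Finset.Ico (-(k : ℤ)) n', c' j = 0) ∧ SignDim c' c ∧
          ∀ t ∈ Ioo (0 : ℝ) 1, splineSum x n k c t = splineSum x' n' k c' t) ∧
      (∀ (p : ℕ) (y t : Fin p → ℝ), (∀ r, t r ∈ Ioo (0 : ℝ) 1) →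
        SignDim (bsplineMoment x n k y t) (bsplineMoment x' n' k y t)) := by
  classical
  -- These are `k + 1` equally spaced points strictly between two of the `t r`, one more than the
  -- number of indices strictly inside the window of a B-spline of degree `k`.
  set g : Fin p × Fin p × Fin (k + 1) → ℝ := fun q =>
    t q.1 + (t q.2.1 - t q.1) * (((q.2.2 : ℕ) + 1 : ℝ) / (k + 2)) with hg
  have hfrac : ∀ l : Fin (k + 1), 0 < ((l : ℕ) + 1 : ℝ) / (k + 2) ∧
      ((l : ℕ) + 1 : ℝ) / (k + 2) < 1 := by
    intro l
    refine ⟨by positivity, ?_⟩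
    rw [div_lt_one (by positivity)]
    have : ((l : ℕ) : ℝ) < k + 1 := by exact_mod_cast l.2
    linarith
  have hgm : ∀ r r' l, r < r' → t r < g (r, r', l) ∧ g (r, r', l) < t r' := by
    intro r r' l h
    have h1 := hmono h
    obtain ⟨h2, h3⟩ := hfrac l
    simp only [hg]
    constructor <;> nlinarith
  set Y := ((Finset.univ : Finset (Fin p × Fin p × Fin (k + 1))).filter fun q =>
    q.1 < q.2.1).image g with hYdef
  obtain ⟨n', x', hx', hY, h1, h2⟩ := hx.exists_refinement Y (by
    intro y hy
    rw [hYdef, Finset.mem_image] at hy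
    obtain ⟨⟨r, r', l⟩, hq, rfl⟩ := hy
    have := hgm r r' l (Finset.mem_filter.1 hq).2
    exact ⟨(ht r).1.trans this.1, this.2.trans (ht r').2⟩)
  refine ⟨n', x', hx', ?_, h1, h2⟩
  intro r r' hrr j hj j' hj' hN hN'
  rw [Finset.mem_Ico] at hj hj'
  by_contra hcon
  have s1 := hx'.mem_support_of_normB_ne hk hj.1 (by omega) (ht r) hN
  have s2 := hx'.mem_support_of_normB_ne hk hj'.1 (by omega) (ht r') hN'
  have hi : ∀ l : Fin (k + 1), ∃ i : ℤ, 0 ≤ i ∧ i ≤ n' ∧ x' i = g (r, r', l) := fun l =>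
    hY _ (Finset.mem_image.2 ⟨(r, r', l), Finset.mem_filter.2 ⟨Finset.mem_univ _, hrr⟩, rfl⟩)
  choose i hi0 hin hi using hi
  have hinj : Function.Injective i := by
    intro l l' h
    have h3 : g (r, r', l) = g (r, r', l') := by rw [← hi, ← hi, h]
    simp only [hg] at h3
    have h4 : t r' - t r ≠ 0 := (sub_pos.2 (hmono hrr)).ne'
    have h5 := mul_left_cancel₀ h4 (add_left_cancel h3)
    have h6 : (k : ℝ) + 2 ≠ 0 := by positivity
    rw [div_left_inj' h6] at h5
    have h7 : ((l : ℕ) : ℝ) = (l' : ℕ) := by linarith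
    exact Fin.ext (by exact_mod_cast h7)
  -- If `j' ≤ j`, all `k + 1` inserted points lie strictly between `x'_{j'}` and `x'_{j'+k+1}`,
  -- where only `k` indices are available.
  have hsub : (Finset.univ.image i) ⊆ Finset.Ioo j' (j' + k + 1) := by
    intro a ha
    obtain ⟨l, -, rfl⟩ := Finset.mem_image.1 ha
    have h3 := hgm r r' l hrr
    rw [← hi] at h3
    rw [Finset.mem_Ioo]
    have h0 := hi0 l
    have hn := hin l
    constructor
    · by_contra h4
      have m1 : x' (i l) ≤ x' j' := hx'.mono (by omega) (by omega) (by omega)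
      have m2 : x' j' ≤ x' j := hx'.mono (by omega) (by omega) (by omega)
      linarith
    · by_contra h4
      have m1 : x' (j' + k + 1) ≤ x' (i l) := hx'.mono (by omega) (by omega) (by omega)
      linarith
  have hcard := Finset.card_le_card hsub
  rw [Finset.card_image_of_injective _ hinj, Finset.card_univ, Fintype.card_fin, Int.card_Ioo]
    at hcard
  omega

/-- The variation diminishing property of splines. -/
theorem signDim_splineSum (hx : IsExtendedKnotSequence n k x) (hk : 1 ≤ k) {p : ℕ}
    {t : Fin p → ℝ} (hmono : StrictMono t) (ht : ∀ r, t r ∈ Ioo (0 : ℝ) 1) {c : ℤ → ℝ}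
    (hc : ∀ j ∉ Finset.Ico (-(k : ℤ)) n, c j = 0) :
    SignDim (fun r => splineSum x n k c (t r)) c := by
  obtain ⟨n', x', hx', hsep, h1, -⟩ := hx.exists_separating_refinement hk hmono ht
  obtain ⟨c', hc', hdim, hs⟩ := h1 c hc
  refine SignDim.trans ?_ hdim
  -- A value is a nonnegative combination of the coefficients alive at `t r`, so one of these has
  -- its sign; separation makes the choice increasing.
  have key : ∀ r, ∃ j : ℤ, splineSum x n k c (t r) ≠ 0 → j ∈ Finset.Ico (-(k : ℤ)) n' ∧
      normB x' k j (t r) ≠ 0 ∧ 0 < splineSum x n k c (t r) * c' j := by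
    intro r
    by_cases h0 : splineSum x n k c (t r) = 0
    · exact ⟨0, fun h => absurd h0 h⟩
    by_contra! hcon
    have hneg : ∀ j ∈ Finset.Ico (-(k : ℤ)) n',
        splineSum x n k c (t r) * (c' j * normB x' k j (t r)) ≤ 0 := by
      intro j hj
      by_cases hN : normB x' k j (t r) = 0
      · simp [hN]
      · have h3 := (hcon j).2 hj hN
        rw [Finset.mem_Ico] at hj
        rw [← mul_assoc]
        exact mul_nonpos_of_nonpos_of_nonneg h3 (hx'.normB_nonneg k hj.1 (by omega) (ht r))
    have h4 := Finset.sum_nonpos hneg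
    rw [← Finset.mul_sum] at h4
    have h5 : splineSum x n k c (t r) = ∑ j ∈ Finset.Ico (-(k : ℤ)) n', c' j * normB x' k j (t r) :=
      hs _ (ht r)
    rw [← h5] at h4
    have := mul_self_pos.2 h0
    linarith
  choose e he using key
  refine ⟨e, fun r hr => (he r hr).2.2, fun r r' hrr hneg => ?_⟩
  have hr : splineSum x n k c (t r) ≠ 0 := left_ne_zero_of_mul hneg.ne
  have hr' : splineSum x n k c (t r') ≠ 0 := right_ne_zero_of_mul hneg.ne
  exact hsep r r' hrr _ (he r hr).1 _ (he r' hr').1 (he r hr).2.1 (he r' hr').2.1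

/-- The counterpart of `signDim_splineSum` for the transposed collocation matrix. After refinement,
each nonzero moment has the sign of a weight at some point in the support. For moments of opposite
sign these points differ, and the reverse order would contradict separation. -/
theorem signDim_bsplineMoment (hx : IsExtendedKnotSequence n k x) (hk : 1 ≤ k) {p : ℕ} [NeZero p]
    {t : Fin p → ℝ} (hmono : StrictMono t) (ht : ∀ r, t r ∈ Ioo (0 : ℝ) 1) (y : Fin p → ℝ) :
    SignDim (bsplineMoment x n k y t) y := by
  obtain ⟨n', x', hx', hsep, -, h2⟩ := hx.exists_separating_refinement hk hmono ht
  refine (h2 p y t ht).trans ?_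
  set h := bsplineMoment x' n' k y t with hh
  have key : ∀ j, ∃ r : Fin p, h j ≠ 0 → j ∈ Finset.Ico (-(k : ℤ)) n' ∧
      normB x' k j (t r) ≠ 0 ∧ 0 < h j * y r := by
    intro j
    by_cases h0 : h j = 0
    · exact ⟨0, fun h => absurd h0 h⟩
    have hj : j ∈ Finset.Ico (-(k : ℤ)) n' := by
      by_contra hcon
      exact h0 (if_neg hcon)
    by_contra! hcon
    have hneg : ∀ r ∈ Finset.univ, h j * (y r * normB x' k j (t r)) ≤ 0 := by
      intro r _
      by_cases hN : normB x' k j (t r) = 0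
      · simp [hN]
      · have h3 := (hcon r).2 hj hN
        rw [Finset.mem_Ico] at hj
        rw [← mul_assoc]
        exact mul_nonpos_of_nonpos_of_nonneg h3 (hx'.normB_nonneg k hj.1 (by omega) (ht r))
    have h4 := Finset.sum_nonpos hneg
    rw [← Finset.mul_sum] at h4
    have h5 : h j = ∑ r, y r * normB x' k j (t r) := if_pos hj
    rw [← h5] at h4
    have := mul_self_pos.2 h0
    linarith
  choose e he using key
  refine ⟨e, fun r hr => (he r hr).2.2, fun j j' hjj hneg => ?_⟩
  have hj : h j ≠ 0 := left_ne_zero_of_mul hneg.ne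
  have hj' : h j' ≠ 0 := right_ne_zero_of_mul hneg.ne
  have p1 := he j hj
  have p2 := he j' hj'
  rcases lt_trichotomy (e j) (e j') with h3 | h3 | h3
  · exact h3
  · exfalso
    rw [h3] at p1
    have := mul_pos p1.2.2 p2.2.2
    nlinarith [sq_nonneg (y (e j'))]
  · have := hsep _ _ h3 j' p2.1 j p1.1 p2.2.1 p1.2.1
    omega

end IsExtendedKnotSequence

/-! ### Derivatives and local linear independence -/

theorem hasDerivAt_truncatedPower (l : ℕ) {u : ℝ} (hu : u ≠ 0) :
    HasDerivAt (truncatedPower (l + 1)) ((l + 1) * truncatedPower l u) u := by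
  rcases lt_or_gt_of_ne hu with h | h
  · have h1 : truncatedPower (l + 1) =ᶠ[𝓝 u] fun _ => 0 := by
      filter_upwards [Iio_mem_nhds h] with s hs
      exact if_neg (not_le.2 hs)
    rw [truncatedPower, if_neg (not_le.2 h), mul_zero]
    exact (hasDerivAt_const u (0 : ℝ)).congr_of_eventuallyEq h1
  · have h1 : truncatedPower (l + 1) =ᶠ[𝓝 u] fun s => s ^ (l + 1) := by
      filter_upwards [Ioi_mem_nhds h] with s hs
      exact if_pos (le_of_lt hs)
    rw [truncatedPower, if_pos h.le]
    have := (hasDerivAt_pow (l + 1) u).congr_of_eventuallyEq h1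
    simpa using this

theorem sum_range_mul_sub (c m : ℕ → ℝ) (L : ℕ) :
    ∑ i ∈ Finset.range (L + 1), c i * (m i - m (i + 1)) =
      c 0 * m 0 - c L * m (L + 1) + ∑ i ∈ Finset.range L, (c (i + 1) - c i) * m (i + 1) := by
  induction L with
  | zero => simp; ring
  | succ L ih => rw [Finset.sum_range_succ, ih, Finset.sum_range_succ _ L]; ring

theorem sum_range_add_int (f : ℤ → ℝ) (a : ℤ) (d : ℕ) :
    ∑ i ∈ Finset.range d, f (a + i) = ∑ j ∈ Finset.Ico a (a + d), f j := by
  induction d with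
  | zero => simp
  | succ d ih =>
    have : Finset.Ico a (a + (d + 1 : ℕ)) = insert (a + d) (Finset.Ico a (a + d)) := by
      ext i; simp; omega
    rw [this, Finset.sum_insert (by simp), Finset.sum_range_succ, ih, add_comm]

namespace IsExtendedKnotSequence

variable {n k : ℕ} {x : ℤ → ℝ}

/-- Differentiation in `t` commutes with the divided difference in `s`, and away from the knots no
kink of the truncated power is met. -/
theorem hasDerivAt_truncDD (hx : IsExtendedKnotSequence n k x) (l m : ℕ) {j : ℤ}
    (h1 : -(k : ℤ) ≤ j) (h2 : j + m ≤ (n : ℤ) + k) {t : ℝ} (ht : t ∈ Ioo (0 : ℝ) 1)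
    (hne : ∀ i : ℤ, -(k : ℤ) ≤ i → i ≤ n + k → x i ≠ t) :
    HasDerivAt (truncDD x (l + 1) m j) (-(l + 1) * truncDD x l m j t) t := by
  induction m generalizing j with
  | zero =>
    have h := (hasDerivAt_truncatedPower l
      (sub_ne_zero.2 (hne j h1 (by push_cast at h2; omega)))).comp t
      ((hasDerivAt_id t).const_sub (x j))
    refine HasDerivAt.congr_deriv (f := truncDD x (l + 1) 0 j) h ?_
    show _ = -(l + 1) * truncatedPower l (x j - t)
    ring
  | succ m ih =>
    push_cast at h2
    have hIoo : Ioo (0 : ℝ) 1 ∈ 𝓝 t := isOpen_Ioo.mem_nhds ht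
    by_cases he : x j = x (j + m + 1)
    · rcases (hx.eq_iff h1 (by omega) (by omega)).1 he with h | h
      · rw [hx.truncDD_left _ _ h1 (by push_cast; omega) ht, mul_zero]
        refine (hasDerivAt_const t (0 : ℝ)).congr_of_eventuallyEq ?_
        filter_upwards [hIoo] with s hs
        exact hx.truncDD_left _ _ h1 (by push_cast; omega) hs
      · rw [hx.truncDD_right _ _ h (by push_cast; omega) ht]
        have hev : truncDD x (l + 1) (m + 1) j =ᶠ[𝓝 t] fun t =>
            ((l + 1).choose (m + 1) : ℝ) * (1 - t) ^ (l + 1 - (m + 1)) := by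
          filter_upwards [hIoo] with s hs
          exact hx.truncDD_right _ _ h (by push_cast; omega) hs
        have hd := (((hasDerivAt_id t).const_sub 1).pow (l + 1 - (m + 1))).const_mul
          ((l + 1).choose (m + 1) : ℝ)
        refine (HasDerivAt.congr_of_eventuallyEq ?_ hev)
        refine HasDerivAt.congr_deriv hd ?_
        have hc := Nat.choose_mul_succ_eq l (m + 1)
        have hc' : (l.choose (m + 1) : ℝ) * (l + 1) =
            (l + 1).choose (m + 1) * ((l + 1 - (m + 1) : ℕ) : ℝ) := by exact_mod_cast hc
        rw [show l + 1 - (m + 1) - 1 = l - (m + 1) by omega]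
        simp only [id]
        linear_combination ((1 - t) ^ (l - (m + 1))) * hc'
    · have hne' : x (j + m + 1) - x j ≠ 0 := sub_ne_zero.2 (Ne.symm he)
      have hd := ((ih (j := j + 1) (by omega) (by omega)).sub (ih h1 (by omega))).div_const
        (x (j + m + 1) - x j)
      have hev : truncDD x (l + 1) (m + 1) j =ᶠ[𝓝 t] fun t =>
          (truncDD x (l + 1) m (j + 1) t - truncDD x (l + 1) m j t) / (x (j + m + 1) - x j) := by
        filter_upwards [hIoo] with s hs
        rw [eq_div_iff hne', ← hx.truncDD_succ (l + 1) m h1 (by omega) hs]; ring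
      refine (HasDerivAt.congr_of_eventuallyEq ?_ hev)
      refine HasDerivAt.congr_deriv hd ?_
      rw [div_eq_iff hne']
      linear_combination (l + 1 : ℝ) * hx.truncDD_succ l m h1 (by omega) ht

/-- The B-splines which do not vanish on a knot interval are linearly independent on every
subinterval. -/
theorem local_independence (hx : IsExtendedKnotSequence n k x) {μ : ℤ} (hμ0 : 0 ≤ μ) (hμ : μ < n)
    {α β : ℝ} (hαβ : α < β) (hα : x μ ≤ α) (hβ : β ≤ x (μ + 1)) {l : ℕ} (hl : l ≤ k) :
    ∀ c : ℕ → ℝ, (∀ t ∈ Ioo α β, ∑ i ∈ Finset.range (l + 1), c i * normB x l (μ - l + i) t = 0) →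
      ∀ i ≤ l, c i = 0 := by
  have hI : ∀ t ∈ Ioo α β, t ∈ Ioo (0 : ℝ) 1 := fun t ht =>
    ⟨(hx.mem_Icc (by omega) (by omega)).1.trans_lt (hα.trans_lt ht.1),
      (ht.2.trans_le hβ).trans_le (hx.mem_Icc (by omega) (by omega)).2⟩
  have hout : ∀ (l : ℕ) (j : ℤ), -(k : ℤ) ≤ j → j + l + 1 ≤ (n : ℤ) + k → (j + l < μ ∨ μ < j) →
      ∀ t ∈ Ioo α β, truncDD x l (l + 1) j t = 0 := by
    intro l j h1 h2 h3 t ht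
    apply (hx.truncDD_support l h1 h2 (hI t ht)).2.2
    rcases h3 with h3 | h3
    · have : x (j + l + 1) ≤ x μ := hx.mono (by omega) (by omega) (by omega)
      exact Or.inr (Or.inl (this.trans_lt (hα.trans_lt ht.1)))
    · have : x (μ + 1) ≤ x j := hx.mono (by omega) (by omega) (by omega)
      exact Or.inl ((ht.2.trans_le hβ).le.trans this)
  have hsum : ∀ l ≤ k, ∀ t ∈ Ioo α β,
      ∑ i ∈ Finset.range (l + 1), normB x l (μ - l + i) t = 1 := by
    intro l hl t ht
    rw [sum_range_add_int (fun j => normB x l j t), ← hx.sum_normB hl (hI t ht)]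
    apply Finset.sum_subset
    · intro j; simp only [Finset.mem_Ico]; push_cast; omega
    · intro j hj hj'
      rw [Finset.mem_Ico] at hj hj'
      rw [normB, hout l j hj.1 (by omega) (by push_cast at hj'; omega) t ht, mul_zero]
  induction l with
  | zero =>
    intro c hc i hi
    obtain rfl : i = 0 := by omega
    obtain ⟨t, ht⟩ := nonempty_Ioo.2 hαβ
    have h1 := hc t ht
    have h2 := hsum 0 hl t ht
    simp only [zero_add, Finset.range_one, Finset.sum_singleton] at h1 h2
    rwa [h2, mul_one] at h1
  | succ l ih =>
    intro c hc
    -- differentiate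
    have hder : ∀ t ∈ Ioo α β, ∑ i ∈ Finset.range (l + 1 + 1), c i *
        (truncDD x l (l + 1) (μ - (l + 1 : ℕ) + i) t -
          truncDD x l (l + 1) (μ - (l + 1 : ℕ) + (i + 1 : ℕ)) t) = 0 := by
      intro t ht
      have hne : ∀ i : ℤ, -(k : ℤ) ≤ i → i ≤ n + k → x i ≠ t := by
        intro i hi1 hi2 h
        rcases le_or_gt i μ with h3 | h3
        · have := hx.mono hi1 h3 (by omega)
          linarith [ht.1]
        · have : x (μ + 1) ≤ x i := hx.mono (by omega) (by omega) hi2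
          linarith [ht.2]
      have hd : HasDerivAt (fun t => ∑ i ∈ Finset.range (l + 1 + 1), c i *
          normB x (l + 1) (μ - (l + 1 : ℕ) + i) t) (∑ i ∈ Finset.range (l + 1 + 1), c i *
            ((-(l + 1) * truncDD x l (l + 1) (μ - (l + 1 : ℕ) + (i + 1 : ℕ)) t) -
            (-(l + 1) * truncDD x l (l + 1) (μ - (l + 1 : ℕ) + i) t))) t := by
        apply HasDerivAt.fun_sum
        intro i hi
        rw [Finset.mem_range] at hi
        apply HasDerivAt.const_mul
        have e1 := hx.hasDerivAt_truncDD l (l + 1) (j := μ - (l + 1 : ℕ) + (i + 1 : ℕ))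
          (by push_cast; omega) (by push_cast; omega) (hI t ht) hne
        have e2 := hx.hasDerivAt_truncDD l (l + 1) (j := μ - (l + 1 : ℕ) + i)
          (by push_cast; omega) (by push_cast; omega) (hI t ht) hne
        refine (e1.sub e2).congr_of_eventuallyEq ?_
        filter_upwards [isOpen_Ioo.mem_nhds ht] with s hs
        rw [hx.normB_eq_sub (l + 1) (by push_cast; omega) (by push_cast; omega) (hI s hs)]
        have : μ - (l + 1 : ℕ) + i + 1 = μ - (l + 1 : ℕ) + (i + 1 : ℕ) := by push_cast; ring
        rw [this]; rfl
      have hz : HasDerivAt (fun t => ∑ i ∈ Finset.range (l + 1 + 1), c i *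
          normB x (l + 1) (μ - (l + 1 : ℕ) + i) t) 0 t := by
        refine (hasDerivAt_const t (0 : ℝ)).congr_of_eventuallyEq ?_
        filter_upwards [isOpen_Ioo.mem_nhds ht] with s hs
        exact hc s hs
      have h0 := hd.unique hz
      have hl0 : (l + 1 : ℝ) ≠ 0 := by positivity
      apply mul_left_cancel₀ hl0
      rw [mul_zero, ← h0, Finset.mul_sum]
      refine Finset.sum_congr rfl fun i _ => ?_
      ring
    -- Abel summation turns the derivative into a combination of B-splines of degree `l`; the two
    -- boundary terms belong to windows that miss the knot interval.
    have hconst : ∀ i ≤ l, (c (i + 1) - c i) /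
        (x (μ - l + i + l + 1) - x (μ - l + i)) = 0 := by
      apply ih (by omega) (fun i => (c (i + 1) - c i) / (x (μ - l + i + l + 1) - x (μ - l + i)))
      intro t ht
      have h0 := hder t ht
      rw [sum_range_mul_sub c (fun i => truncDD x l (l + 1) (μ - (l + 1 : ℕ) + i) t) (l + 1)] at h0
      rw [hout l (μ - (l + 1 : ℕ) + (0 : ℕ)) (by push_cast; omega) (by push_cast; omega)
        (Or.inl (by push_cast; omega)) t ht,
        hout l (μ - (l + 1 : ℕ) + (l + 1 + 1 : ℕ)) (by push_cast; omega) (by push_cast; omega)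
        (Or.inr (by push_cast; omega)) t ht] at h0
      simp only [mul_zero, sub_zero, zero_add] at h0
      rw [← h0]
      refine Finset.sum_congr rfl fun i hi => ?_
      rw [Finset.mem_range] at hi
      have hpos : x (μ - l + i) < x (μ - l + i + l + 1) :=
        hx.lt_of (by omega) (by omega) (by omega) (by omega) (by omega)
      rw [normB, ← mul_assoc, div_mul_cancel₀ _ (sub_pos.2 hpos).ne']
      congr 2
      push_cast; ring
    have hconst' : ∀ i ≤ l, c (i + 1) = c i := by
      intro i hi
      have hpos : x (μ - l + i) < x (μ - l + i + l + 1) :=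
        hx.lt_of (by omega) (by omega) (by omega) (by omega) (by omega)
      have := (div_eq_zero_iff.1 (hconst i hi)).resolve_right (sub_pos.2 hpos).ne'
      linarith
    have hall : ∀ i ≤ l + 1, c i = c 0 := by
      intro i
      induction i with
      | zero => intro _; rfl
      | succ i ihi => intro hi; rw [hconst' i (by omega), ihi (by omega)]
    -- All coefficients agree, and by the partition of unity the vanishing sum equals their common
    -- value.
    obtain ⟨t, ht⟩ := nonempty_Ioo.2 hαβ
    have h1 := hc t ht
    rw [Finset.sum_congr rfl fun i hi => by
      rw [hall i (by rw [Finset.mem_range] at hi; omega)], ← Finset.mul_sum, hsum (l + 1) hl t ht,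
      mul_one] at h1
    intro i hi
    rw [hall i hi, h1]

/-- If the spline vanished immediately to the right of `t`, local independence there would
annihilate every coefficient of a live B-spline, `c j` included. This supplies the auxiliary point
for `schoenberg_whitney`. -/
theorem exists_splineSum_ne_zero (hx : IsExtendedKnotSequence n k x) (hk : 1 ≤ k) {c : ℤ → ℝ}
    {j : ℤ} (hj : j ∈ Finset.Ico (-(k : ℤ)) n) (hc : c j ≠ 0) {t b : ℝ} (ht : t ∈ Ioo (0 : ℝ) 1)
    (hN : normB x k j t ≠ 0) (hb : t < b) :
    ∃ τ ∈ Ioo t b, τ < 1 ∧ splineSum x n k c τ ≠ 0 := by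
  rw [Finset.mem_Ico] at hj
  obtain ⟨hs1, hs2⟩ := hx.mem_support_of_normB_ne hk hj.1 (by omega) ht hN
  obtain ⟨μ, hμ0, hμ, h1, h2⟩ : ∃ m : ℤ, 0 ≤ m ∧ m < n ∧ x m ≤ t ∧ t < x (m + 1) := by
    by_cases h : ∃ i : ℤ, 0 ≤ i ∧ i ≤ n ∧ x i = t
    · obtain ⟨i, hi0, hin, hi⟩ := h
      have hin' : i < n := by
        refine lt_of_le_of_ne hin ?_
        rintro rfl
        rw [hx.right n le_rfl (by omega)] at hi
        linarith [ht.2]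
      exact ⟨i, hi0, hin', hi.le, hi ▸ hx.lt i (i + 1) hi0 (by omega) (by omega)⟩
    · push Not at h
      obtain ⟨m, a, b, c, d⟩ := hx.exists_mem_knot_interval ht h
      exact ⟨m, a, b, c.le, d⟩
  have hjμ : j ≤ μ := by
    by_contra hcon
    have : x (μ + 1) ≤ x j := hx.mono (by omega) (by omega) (by omega)
    linarith
  have hμj : μ ≤ j + k := by
    by_contra hcon
    have : x (j + k + 1) ≤ x μ := hx.mono (by omega) (by omega) (by omega)
    linarith
  by_contra! hcon
  have hx1 : x (μ + 1) ≤ 1 := (hx.mem_Icc (by omega) (by omega)).2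
  have hzero := hx.local_independence hμ0 hμ (lt_min hb h2) h1 (min_le_right _ _) le_rfl
    (fun i => c (μ - k + i)) (by
      intro s hs
      have hs' : s < x (μ + 1) := hs.2.trans_le (min_le_right _ _)
      have hsI : s ∈ Ioo (0 : ℝ) 1 := ⟨ht.1.trans hs.1, hs'.trans_le hx1⟩
      have h0 := hcon s ⟨hs.1, hs.2.trans_le (min_le_left _ _)⟩ hsI.2
      rw [← h0, splineSum, sum_range_add_int (fun j => c j * normB x k j s)]
      apply Finset.sum_subset
      · intro j; simp only [Finset.mem_Ico]; push_cast; omega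
      · intro i hi hi'
        rw [Finset.mem_Ico] at hi hi'
        by_cases hN0 : normB x k i s = 0
        · rw [hN0, mul_zero]
        exfalso
        obtain ⟨g1, g2⟩ := hx.mem_support_of_normB_ne hk hi.1 (by omega) hsI hN0
        push_cast at hi'
        rcases lt_or_ge μ i with h3 | h3
        · have : x (μ + 1) ≤ x i := hx.mono (by omega) (by omega) (by omega)
          linarith
        · have : x (i + k + 1) ≤ x μ := hx.mono (by omega) (by omega) (by omega)
          linarith [hs.1]) (j - μ + k).toNat (by omega)
  apply hc
  rw [← hzero]
  congr 1
  omega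

end IsExtendedKnotSequence

/-! ### The Schoenberg–Whitney theorem -/

theorem exists_pos_perturb {ι : Type*} [Finite ι] (a b : ι → ℝ) (ha : ∀ i, a i ≠ 0) :
    ∀ᶠ ε in 𝓝[>] (0 : ℝ), ∀ i, 0 < a i * (a i + ε * b i) := by
  rw [eventually_all]
  intro i
  have hc : Tendsto (fun ε : ℝ => a i * (a i + ε * b i)) (𝓝[>] 0) (𝓝 (a i * (a i + 0 * b i))) :=
    (Continuous.tendsto (by fun_prop) 0).mono_left nhdsWithin_le_nhds
  rw [zero_mul, add_zero] at hc
  exact hc.eventually_const_lt (mul_self_pos.2 (ha i))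

theorem StrictMono.eq_id_fin {p : ℕ} {σ : Fin p → Fin p} (h : StrictMono σ) : σ = id := by
  have : Function.Surjective σ := Finite.surjective_of_injective h.injective
  exact (StrictMono.range_inj h strictMono_id).1 (by rw [this.range_eq, Set.range_id])

namespace IsExtendedKnotSequence

variable {n k : ℕ} {x : ℤ → ℝ}

theorem splineSum_extend {p : ℕ} {j : Fin p → ℤ} (hj : Function.Injective j)
    (hjm : ∀ r, j r ∈ Finset.Ico (-(k : ℤ)) n) (a : Fin p → ℝ) (t : ℝ) :
    splineSum x n k (Function.extend j a 0) t = ∑ s, a s * normB x k (j s) t := by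
  classical
  unfold splineSum
  have h1 : ∑ s, a s * normB x k (j s) t =
      ∑ i ∈ Finset.univ.image j, Function.extend j a 0 i * normB x k i t := by
    rw [Finset.sum_image fun _ _ _ _ h => hj h]
    exact Finset.sum_congr rfl fun s _ => by rw [hj.extend_apply]
  rw [h1]
  symm
  apply Finset.sum_subset
  · intro i hi
    obtain ⟨s, -, rfl⟩ := Finset.mem_image.1 hi
    exact hjm s
  · intro i _ hi
    rw [Function.extend_apply' _ _ _ (by rintro ⟨s, rfl⟩; exact hi (Finset.mem_image_of_mem _ (Finset.mem_univ _)))]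
    simp

/-- If a combination of `p` B-splines attains values of alternating sign at `p` points, then these
are the signs of the coefficients. -/
theorem pos_of_alternating (hx : IsExtendedKnotSequence n k x) (hk : 1 ≤ k) {p : ℕ}
    {j : Fin (p + 2) → ℤ} (hj : StrictMono j) (hjm : ∀ r, j r ∈ Finset.Ico (-(k : ℤ)) n)
    {u : Fin (p + 2) → ℝ} (hu : StrictMono u) (hum : ∀ r, u r ∈ Ioo (0 : ℝ) 1)
    (a : Fin (p + 2) → ℝ)
    (halt : ∀ r : Fin (p + 1), (∑ s, a s * normB x k (j s) (u r.castSucc)) *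
      (∑ s, a s * normB x k (j s) (u r.succ)) < 0) (r : Fin (p + 2)) :
    0 < (∑ s, a s * normB x k (j s) (u r)) * a r := by
  obtain ⟨e, he1, he2⟩ := hx.signDim_splineSum hk hu hum (c := Function.extend j a 0) (by
    intro i hi
    rw [Function.extend_apply' _ _ _ (by rintro ⟨s, rfl⟩; exact hi (hjm s))]; rfl)
  simp only [splineSum_extend hj.injective hjm] at he1 he2
  have hne : ∀ r, (∑ s, a s * normB x k (j s) (u r)) ≠ 0 := by
    intro r
    induction r using Fin.cases with
    | zero => exact left_ne_zero_of_mul (halt 0).ne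
    | succ r => exact right_ne_zero_of_mul (halt r).ne
  have hemono : StrictMono e :=
    Fin.strictMono_iff_lt_succ.2 fun r => he2 _ _ (Fin.castSucc_lt_succ) (halt r)
  have hrange : ∀ r, ∃ s, j s = e r := by
    intro r
    by_contra hcon
    have := he1 r (hne r)
    rw [Function.extend_apply' _ _ _ hcon] at this
    simp at this
  choose σ hσ using hrange
  -- The `p + 2` alternating values are assigned increasingly to `p + 2` available coefficients,
  -- which leaves only the identity.
  have hσm : StrictMono σ := fun r r' h => by
    rw [← hj.lt_iff_lt, hσ, hσ]; exact hemono h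
  have hid := hσm.eq_id_fin
  have := he1 r (hne r)
  rwa [← hσ, hj.injective.extend_apply, hid] at this

/-- The Schoenberg–Whitney theorem. -/
theorem schoenberg_whitney (hx : IsExtendedKnotSequence n k x) (hk : 1 ≤ k) (p : ℕ) :
    ∀ (j : Fin p → ℤ), StrictMono j → (∀ r, j r ∈ Finset.Ico (-(k : ℤ)) n) →
    ∀ t : Fin p → ℝ, StrictMono t → (∀ r, t r ∈ Ioo (0 : ℝ) 1) →
    (∀ r, normB x k (j r) (t r) ≠ 0) → ∀ a : Fin p → ℝ,
    (∀ r, ∑ s, a s * normB x k (j s) (t r) = 0) → a = 0 := by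
  induction p with
  | zero => intro j _ _ t _ _ _ a _; exact Subsingleton.elim _ _
  | succ p ih =>
    intro j hj hjm t ht htm hN a ha
    -- Deleting row and column `q` together keeps the diagonal condition, so each reduced system is
    -- nonsingular by induction.
    have hred := fun q : Fin (p + 1) => ih (j ∘ q.succAbove)
      (hj.comp (Fin.strictMono_succAbove q)) (fun r => hjm _) (t ∘ q.succAbove)
      (ht.comp (Fin.strictMono_succAbove q)) (fun r => htm _) (fun r => hN _)
    by_cases hz : ∃ q, a q = 0
    · obtain ⟨q, hq⟩ := hz
      have h0 := hred q (a ∘ q.succAbove) (by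
        intro r
        have := ha (q.succAbove r)
        rw [Fin.sum_univ_succAbove _ q, hq, zero_mul, zero_add] at this
        exact this)
      funext s
      rcases Fin.eq_self_or_eq_succAbove q s with rfl | ⟨s, rfl⟩
      · exact hq
      · exact congrFun h0 s
    push Not at hz
    exfalso
    rcases p with _ | p
    · have := ha 0
      rw [Fin.sum_univ_succ, Fin.sum_univ_zero, add_zero, mul_eq_zero] at this
      exact this.elim (hz 0) (hN 0)
    -- solvability of the reduced systems
    have hsolve : ∀ (q : Fin (p + 2)) (z : Fin (p + 1) → ℝ), ∃ w : Fin (p + 2) → ℝ,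
        ∀ r, ∑ s, w s * normB x k (j s) (t (q.succAbove r)) = z r := by
      intro q z
      set L := Matrix.mulVecLin (Matrix.of fun r s : Fin (p + 1) =>
        normB x k (j (q.succAbove s)) (t (q.succAbove r))) with hL
      have hLapp : ∀ w r, L w r = ∑ s, w s *
          normB x k (j (q.succAbove s)) (t (q.succAbove r)) := by
        intro w r
        simp [hL, Matrix.mulVec, dotProduct, mul_comm]
      have hinj : Function.Injective L := by
        rw [← LinearMap.ker_eq_bot, LinearMap.ker_eq_bot']
        intro w hw
        exact hred q w fun r => (hLapp w r).symm.trans (congrFun hw r)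
      obtain ⟨w, hw⟩ := LinearMap.injective_iff_surjective.1 hinj z
      refine ⟨q.insertNth 0 w, fun r => ?_⟩
      rw [Fin.sum_univ_succAbove _ q, Fin.insertNth_apply_same, zero_mul, zero_add, ← hw, hLapp]
      exact Finset.sum_congr rfl fun s _ => by rw [Fin.insertNth_apply_succAbove]
    -- The kernel spline vanishes at every `t r` but not at `τ`, between the first two. Small
    -- perturbations of its coefficients produce alternating values on two chains of `p + 2` points,
    -- each containing `τ` and omitting the first or the last `t r`. As `τ` has position `0` in one
    -- chain and `1` in the other, `pos_of_alternating` yields contradictory signs for `a 1`.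
    obtain ⟨τ, hτ, hτ1, hF⟩ := hx.exists_splineSum_ne_zero hk (c := Function.extend j a 0) (hjm 0)
      (by rw [hj.injective.extend_apply]; exact hz 0) (htm 0) (hN 0)
      (ht (show (0 : Fin (p + 2)) < 1 by simp))
    rw [splineSum_extend hj.injective hjm] at hF
    have hτI : τ ∈ Ioo (0 : ℝ) 1 := ⟨(htm 0).1.trans hτ.1, hτ1⟩
    set F := ∑ s, a s * normB x k (j s) τ with hFdef
    have hFF : 0 < F * F := mul_self_pos.2 hF
    -- perturbation of the coefficients
    have hpert : ∀ w : Fin (p + 2) → ℝ, ∃ ε > 0, (∀ s, 0 < a s * (a s + ε * w s)) ∧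
        0 < F * ∑ s, (a s + ε * w s) * normB x k (j s) τ := by
      intro w
      have e1 := exists_pos_perturb a w hz
      have e2 := exists_pos_perturb (fun _ : Unit => F)
        (fun _ => ∑ s, w s * normB x k (j s) τ) fun _ => hF
      obtain ⟨ε, ⟨h1, h2⟩, h3⟩ := ((e1.and e2).and self_mem_nhdsWithin).exists
      refine ⟨ε, h3, h1, ?_⟩
      have h4 := h2 ()
      rw [Finset.mul_sum, hFdef, ← Finset.sum_add_distrib] at h4
      rw [hFdef]
      convert h4 using 3
      ring
    have hval : ∀ (w : Fin (p + 2) → ℝ) (ε : ℝ) (r : Fin (p + 2)),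
        ∑ s, (a s + ε * w s) * normB x k (j s) (t r) =
          ε * ∑ s, w s * normB x k (j s) (t r) := by
      intro w ε r
      have h1 := ha r
      rw [Finset.mul_sum, ← zero_add (∑ s, ε * (w s * normB x k (j s) (t r))), ← h1,
        ← Finset.sum_add_distrib]
      exact Finset.sum_congr rfl fun s _ => by ring
    -- the first chain of points
    have c1 : F * a 1 < 0 := by
      obtain ⟨w, hw⟩ := hsolve 0 fun r => -F * (-1) ^ (r : ℕ)
      obtain ⟨ε, hε, hs, hFp⟩ := hpert w
      have hu : StrictMono (Fin.cons τ (fun r : Fin (p + 1) => t r.succ) : Fin (p + 2) → ℝ) := by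
        rw [Fin.strictMono_iff_lt_succ]
        intro r
        induction r using Fin.cases with
        | zero => simpa using hτ.2
        | succ r =>
          rw [← Fin.succ_castSucc, Fin.cons_succ, Fin.cons_succ]
          exact ht (by simp [Fin.lt_def])
      have hv : ∀ r : Fin (p + 1), ∑ s, (a s + ε * w s) * normB x k (j s)
          ((Fin.cons τ (fun r : Fin (p + 1) => t r.succ) : Fin (p + 2) → ℝ) r.succ) =
          ε * (-F * (-1) ^ (r : ℕ)) := by
        intro r
        rw [Fin.cons_succ, hval, ← hw, Fin.succAbove_zero]
      have := hx.pos_of_alternating hk hj hjm hu (by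
        intro r
        induction r using Fin.cases with
        | zero => simpa using hτI
        | succ r => simpa using htm _) (fun s => a s + ε * w s) (by
        intro r
        induction r using Fin.cases with
        | zero =>
          rw [hv, Fin.castSucc_zero, Fin.cons_zero]
          simp only [Fin.val_zero, pow_zero]
          nlinarith
        | succ r =>
          rw [← Fin.succ_castSucc, hv, hv]
          simp only [Fin.val_castSucc, Fin.val_succ, pow_succ]
          have h1 : ((-1 : ℝ) ^ (r : ℕ)) * (-1) ^ (r : ℕ) = 1 := by
            rw [← mul_pow]; simp
          have h2 : 0 < ε * ε * (F * F) := by positivity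
          linear_combination h2 + (-(ε * ε * (F * F))) * h1) 1
      rw [show (1 : Fin (p + 2)) = Fin.succ 0 from rfl, hv] at this
      have h3 := hs 1
      rw [show (1 : Fin (p + 2)) = Fin.succ 0 from rfl] at h3 ⊢
      simp only [Fin.val_zero, pow_zero, mul_one] at this
      by_contra hcon
      push Not at hcon
      have h4 := mul_nonneg hcon h3.le
      have h5 : 0 < (a (Fin.succ 0)) ^ 2 := by have := hz (Fin.succ 0); positivity
      have h6 : 0 < -(F * (a (Fin.succ 0) + ε * w (Fin.succ 0))) :=
        pos_of_mul_pos_right (by linarith : 0 < ε * -(F * (a (Fin.succ 0) + ε * w (Fin.succ 0)))) hε.le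
      nlinarith
    -- the second chain of points
    have c2 : 0 < F * a 1 := by
      -- The first two points receive the same sign, opposite to that of `F`, because `τ` is placed
      -- between them.
      obtain ⟨w, hw⟩ := hsolve (Fin.last _) fun r =>
        -F * (if r = 0 then 1 else (-1) ^ ((r : ℕ) - 1))
      obtain ⟨ε, hε, hs, hFp⟩ := hpert w
      set u : Fin (p + 2) → ℝ := Fin.cons (t 0) (Fin.cons τ (fun r : Fin p => t r.succ.castSucc))
        with hudef
      have hu0 : u 0 = t 0 := rfl
      have hu1 : u (Fin.succ 0) = τ := rfl
      have hu2 : ∀ r : Fin p, u r.succ.succ = t r.succ.castSucc := fun r => rfl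
      have hu : StrictMono u := by
        rw [Fin.strictMono_iff_lt_succ]
        intro r
        induction r using Fin.cases with
        | zero => rw [Fin.castSucc_zero, hu0, hu1]; exact hτ.1
        | succ r =>
          rcases p with _ | p
          · exact r.elim0
          induction r using Fin.cases with
          | zero =>
            rw [← Fin.succ_castSucc, Fin.castSucc_zero, hu1, hu2]
            exact hτ.2
          | succ r =>
            rw [← Fin.succ_castSucc, ← Fin.succ_castSucc, hu2, hu2]
            exact ht (by simp [Fin.lt_def])
      have v0 : ∑ s, (a s + ε * w s) * normB x k (j s) (u 0) = ε * -F := by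
        have := hw 0
        rw [Fin.succAbove_last, Fin.castSucc_zero] at this
        rw [hu0, hval, this]; simp
      have v1 : 0 < F * ∑ s, (a s + ε * w s) * normB x k (j s) (u (Fin.succ 0)) := by
        rw [hu1]; exact hFp
      have v2 : ∀ r : Fin p, ∑ s, (a s + ε * w s) * normB x k (j s) (u r.succ.succ) =
          ε * (-F * (-1) ^ (r : ℕ)) := by
        intro r
        have := hw r.succ
        rw [Fin.succAbove_last] at this
        rw [hu2, hval, this]; simp
      have := hx.pos_of_alternating hk hj hjm hu (by
        intro r
        induction r using Fin.cases with
        | zero => exact htm 0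
        | succ r =>
          rcases p with _ | p
          · rw [show r = 0 from Fin.ext (by omega), hu1]; exact hτI
          induction r using Fin.cases with
          | zero => exact hτI
          | succ r => exact htm _) (fun s => a s + ε * w s) (by
        intro r
        induction r using Fin.cases with
        | zero =>
          rw [Fin.castSucc_zero, v0]
          nlinarith
        | succ r =>
          rcases p with _ | p
          · exact r.elim0
          induction r using Fin.cases with
          | zero =>
            rw [← Fin.succ_castSucc, Fin.castSucc_zero, v2]
            simp only [Fin.val_zero, pow_zero]
            nlinarith
          | succ r =>
            rw [← Fin.succ_castSucc, ← Fin.succ_castSucc, v2, v2]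
            simp only [Fin.val_castSucc, Fin.val_succ, pow_succ]
            have h1 : ((-1 : ℝ) ^ (r : ℕ)) * (-1) ^ (r : ℕ) = 1 := by
              rw [← mul_pow]; simp
            have h2 : 0 < ε * ε * (F * F) := by positivity
            linear_combination h2 + (-(ε * ε * (F * F))) * h1) (Fin.succ 0)
      have h3 := hs 1
      rw [show (1 : Fin (p + 2)) = Fin.succ 0 from rfl] at h3 ⊢
      set G := ∑ s, (a s + ε * w s) * normB x k (j s) (u (Fin.succ 0))
      set b := a (Fin.succ 0) + ε * w (Fin.succ 0)
      have h4 : 0 < (F * G) * (G * b) * (a (Fin.succ 0) * b) := mul_pos (mul_pos v1 this) h3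
      have h5 : (F * G) * (G * b) * (a (Fin.succ 0) * b) = (F * a (Fin.succ 0)) * (G * b) ^ 2 := by
        ring
      rw [h5] at h4
      exact pos_of_mul_pos_left h4 (by positivity)
    linarith

end IsExtendedKnotSequence

/-! ### Alternations and the number of sign changes -/

/-- `l` lists indices, in increasing order, at which the entries of `v` have alternating signs. -/
def IsAlternation {ι : Type*} [LT ι] (v : ι → ℝ) (l : List ι) : Prop :=
  l.IsChain (fun i j => i < j ∧ v i * v j < 0) ∧ ∀ i ∈ l, v i ≠ 0

/-- The maximal length of an alternation; it exceeds the number of sign changes by one. -/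
noncomputable def altNum {ι : Type*} [LT ι] (v : ι → ℝ) : ℕ :=
  sSup {q | ∃ l, IsAlternation v l ∧ l.length = q}

section Alternation

variable {ι : Type*} [LinearOrder ι] {v w : ι → ℝ}

theorem IsAlternation.map {l : List ι} (h : IsAlternation v l) {e : ι → ι}
    (h1 : ∀ i, v i ≠ 0 → 0 < v i * w (e i)) (h2 : ∀ i j, i < j → v i * v j < 0 → e i < e j) :
    IsAlternation w (l.map e) := by
  refine ⟨List.isChain_map_of_isChain (R := fun i j => i < j ∧ v i * v j < 0) e ?_ h.1,
    fun i hi => ?_⟩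
  · rintro i j ⟨hij, hneg⟩
    refine ⟨h2 i j hij hneg, ?_⟩
    have p1 := h1 i (left_ne_zero_of_mul hneg.ne)
    have p2 := h1 j (right_ne_zero_of_mul hneg.ne)
    have := mul_pos p1 p2
    nlinarith
  · obtain ⟨j, hj, rfl⟩ := List.mem_map.1 hi
    exact right_ne_zero_of_mul (h1 j (h.2 j hj)).ne'

theorem IsAlternation.cons {a b : ι} {l : List ι} (h : IsAlternation v (b :: l)) (hab : a < b)
    (hneg : v a * v b < 0) : IsAlternation v (a :: b :: l) :=
  ⟨List.isChain_cons_cons.2 ⟨⟨hab, hneg⟩, h.1⟩, fun i hi => by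
    rcases List.mem_cons.1 hi with rfl | hi
    · exact left_ne_zero_of_mul hneg.ne
    · exact h.2 i hi⟩

variable [Fintype ι]

theorem IsAlternation.length_le {l : List ι} (h : IsAlternation v l) :
    l.length ≤ Fintype.card ι := by
  have h1 : l.IsChain (· < ·) := h.1.imp fun _ _ h => h.1
  have h2 : l.Nodup := (List.isChain_iff_pairwise.1 h1).imp ne_of_lt
  exact h2.length_le_card

theorem bddAbove_alternation : BddAbove {q | ∃ l, IsAlternation v l ∧ l.length = q} :=
  ⟨Fintype.card ι, by rintro _ ⟨l, hl, rfl⟩; exact hl.length_le⟩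

theorem IsAlternation.length_le_altNum {l : List ι} (h : IsAlternation v l) :
    l.length ≤ altNum v :=
  le_csSup bddAbove_alternation ⟨l, h, rfl⟩

theorem exists_alternation (v : ι → ℝ) : ∃ l, IsAlternation v l ∧ l.length = altNum v :=
  Nat.sSup_mem (s := {q | ∃ l, IsAlternation v l ∧ l.length = q})
    ⟨0, [], ⟨List.isChain_nil, by simp⟩, rfl⟩ bddAbove_alternation

theorem SignDim.altNum_le (h : SignDim v w) : altNum v ≤ altNum w := by
  obtain ⟨e, h1, h2⟩ := h
  obtain ⟨l, hl, hlen⟩ := exists_alternation v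
  have := (hl.map h1 h2).length_le_altNum
  rwa [List.length_map, hlen] at this

/-- A longest alternation can be made to start at the first nonzero entry. -/
theorem exists_alternation_cons {a : ι} (ha : v a ≠ 0) (hfirst : ∀ i < a, v i = 0) :
    ∃ l, IsAlternation v (a :: l) ∧ (a :: l).length = altNum v := by
  obtain ⟨l, hl, hlen⟩ := exists_alternation v
  rcases l with _ | ⟨b, l⟩
  · have h1 : IsAlternation v [a] := ⟨List.isChain_singleton _, by simpa using ha⟩
    have := h1.length_le_altNum
    rw [← hlen] at this
    simp at this
  have hb : v b ≠ 0 := hl.2 b (by simp)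
  have hab : a ≤ b := not_lt.1 fun h => hb (hfirst b h)
  rcases lt_or_gt_of_ne (mul_ne_zero ha hb) with hneg | hpos
  · have hlt : a < b := lt_of_le_of_ne hab (by
      rintro rfl; nlinarith [mul_self_nonneg (v a)])
    have := (hl.cons hlt hneg).length_le_altNum
    rw [← hlen] at this
    simp at this
  · refine ⟨l, ⟨?_, fun i hi => ?_⟩, by simpa using hlen⟩
    · rcases l with _ | ⟨c, l⟩
      · exact List.isChain_singleton _
      · obtain ⟨⟨h1, h2⟩, h3⟩ := List.isChain_cons_cons.1 hl.1
        refine List.isChain_cons_cons.2 ⟨⟨hab.trans_lt h1, ?_⟩, h3⟩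
        by_contra hcon
        push Not at hcon
        have : 0 < v b * v b := mul_self_pos.2 hb
        have hac : v a * v c ≠ 0 := mul_ne_zero ha (right_ne_zero_of_mul h2.ne)
        have := mul_pos hpos (lt_of_le_of_ne hcon hac.symm)
        nlinarith [mul_self_pos.2 ha]
    · rcases List.mem_cons.1 hi with rfl | hi
      · exact ha
      · exact hl.2 i (by simp [hi])

/-- If the number of sign changes is not diminished, then the first sign is preserved. -/
theorem SignDim.first_sign (h : SignDim v w) (heq : altNum v = altNum w) {a b : ι} (ha : v a ≠ 0)
    (hfa : ∀ i < a, v i = 0) (hb : w b ≠ 0) (hfb : ∀ i < b, w i = 0) : 0 < v a * w b := by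
  obtain ⟨e, h1, h2⟩ := h
  obtain ⟨l, hl, hlen⟩ := exists_alternation_cons ha hfa
  have hm := hl.map h1 h2
  rw [List.map_cons] at hm
  have hpos := h1 a ha
  by_contra hcon
  have hneg : v a * w b < 0 := lt_of_le_of_ne (not_lt.1 hcon) (mul_ne_zero ha hb)
  have hwe : w (e a) ≠ 0 := right_ne_zero_of_mul hpos.ne'
  have hbe : w b * w (e a) < 0 := by
    by_contra hc
    have := mul_nonpos_of_nonneg_of_nonpos (not_lt.1 hc) (mul_nonpos_of_nonpos_of_nonneg hneg.le hpos.le)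
    have h5 : 0 < (v a * w b) ^ 2 * (w (e a)) ^ 2 := by
      have := hneg.ne; positivity
    have h6 : 0 < -(v a * w b) * (v a * w (e a)) := mul_pos (by linarith) hpos
    nlinarith [mul_self_pos.2 ha]
  -- The image of a longest alternation of `v` starts at `e a`; an earlier entry of opposite sign
  -- could be put in front and would make it too long.
  have hlt : b < e a := by
    rcases lt_trichotomy b (e a) with h | h | h
    · exact h
    · rw [h] at hbe; nlinarith [mul_self_nonneg (w (e a))]
    · exact absurd (hfb _ h) hwe
  have := (hm.cons hlt hbe).length_le_altNum
  rw [← heq, ← hlen] at this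
  simp at this

theorem exists_first_ne_zero {E : Type*} [Zero E] {u : ι → E} (hu : u ≠ 0) :
    ∃ a, u a ≠ 0 ∧ ∀ i < a, u i = 0 := by
  classical
  obtain ⟨i, hi⟩ := Function.ne_iff.1 hu
  have hne : (Finset.univ.filter fun i => u i ≠ 0).Nonempty := ⟨i, by simpa using hi⟩
  refine ⟨_, (Finset.mem_filter.1 (Finset.min'_mem _ hne)).2, fun j hj => ?_⟩
  by_contra hcon
  exact absurd (Finset.min'_le _ j (by simpa using hcon)) (not_le.2 hj)

end Alternation

/-! ### Positivity of the eigenvalues of sign diminishing matrices -/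

/-- A complex number whose powers eventually stay in a closed half plane bounded by the imaginary
axis is real and positive. -/
theorem pos_of_re_pow_mul_nonneg {μ : ℂ} (hμ : μ ≠ 0) {s : ℝ} (hs : s ≠ 0) {m₀ : ℕ}
    (h : ∀ m ≥ m₀, 0 ≤ (μ ^ m).re * s) : μ.im = 0 ∧ 0 < μ.re := by
  have hnorm : 0 < ‖μ‖ := norm_pos_iff.2 hμ
  set θ := Complex.arg μ with hθ
  have hpow : ∀ m : ℕ, (μ ^ m).re = ‖μ‖ ^ m * Real.cos (m * θ) := by
    intro m
    conv_lhs => rw [← Complex.norm_mul_cos_add_sin_mul_I μ, mul_pow, Complex.cos_add_sin_mul_I_pow]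
    rw [← Complex.ofReal_pow, Complex.re_ofReal_mul]
    congr 1
    rw [← hθ]
    have e1 : Complex.cos (m * (θ : ℂ)) = (Real.cos (m * θ) : ℂ) := by push_cast; rfl
    have e2 : Complex.sin (m * (θ : ℂ)) = (Real.sin (m * θ) : ℂ) := by push_cast; rfl
    rw [e1, e2]
    simp only [Complex.add_re, Complex.ofReal_re, Complex.mul_re, Complex.ofReal_im, Complex.I_re,
      Complex.I_im]
    ring
  have hcos : ∀ m ≥ m₀, 0 ≤ Real.cos (m * θ) * s := by
    intro m hm
    have h1 := h m hm
    rw [hpow, mul_assoc] at h1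
    exact nonneg_of_mul_nonneg_right h1 (by positivity)
  have h2m : ∀ m : ℕ, Real.cos ((2 * m : ℕ) * θ) = 2 * Real.cos (m * θ) ^ 2 - 1 := by
    intro m; push_cast; rw [mul_assoc, Real.cos_two_mul]
  have h3m : ∀ m : ℕ, Real.cos ((3 * m : ℕ) * θ) =
      4 * Real.cos (m * θ) ^ 3 - 3 * Real.cos (m * θ) := by
    intro m; push_cast; rw [mul_assoc, Real.cos_three_mul]
  rcases lt_or_gt_of_ne hs with hs | hs
  · exfalso
    have hc : ∀ m ≥ m₀, Real.cos (m * θ) ≤ 0 := fun m hm => by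
      by_contra hcon
      have := hcos m hm
      nlinarith
    -- If `c = cos (m θ) < 0`, doubling the angle gives `2 c² ≤ 1`, while tripling it gives `4 c² ≥
    -- 3`.
    have hz : ∀ m ≥ m₀, Real.cos (m * θ) = 0 := by
      intro m hm
      by_contra hne
      have a1 := hc m hm
      have a2 := hc (2 * m) (by omega)
      have a3 := hc (3 * m) (by omega)
      rw [h2m] at a2
      rw [h3m] at a3
      have a4 : Real.cos (m * θ) < 0 := lt_of_le_of_ne a1 hne
      nlinarith
    have b1 := hz m₀ le_rfl
    have b2 := hz (2 * m₀) (by omega)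
    rw [h2m, b1] at b2
    norm_num at b2
  · have hc : ∀ m ≥ m₀, 0 ≤ Real.cos (m * θ) := fun m hm => by
      by_contra hcon
      have := hcos m hm
      nlinarith
    -- While the cosine stays nonnegative, doubling the angle at least doubles `1 - cos`, which
    -- remains at most `1`.
    have hgrow : ∀ (j m : ℕ), m ≥ m₀ → (2 : ℝ) ^ j * (1 - Real.cos (m * θ)) ≤ 1 := by
      intro j
      induction j with
      | zero => intro m hm; have := hc m hm; simp; exact this
      | succ j ih =>
        intro m hm
        have a1 := ih (2 * m) (by omega)
        rw [h2m] at a1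
        have a2 := hc m hm
        have a3 : 1 - Real.cos (m * θ) ≥ 0 := by linarith [Real.cos_le_one (m * θ)]
        have a4 : 2 * (1 - Real.cos (m * θ)) ≤ 1 - (2 * Real.cos (m * θ) ^ 2 - 1) := by nlinarith
        have a5 : (0 : ℝ) < 2 ^ j := by positivity
        rw [pow_succ]
        nlinarith
    have hone : ∀ m ≥ m₀, Real.cos (m * θ) = 1 := by
      intro m hm
      by_contra hne
      have a1 : 0 < 1 - Real.cos (m * θ) :=
        sub_pos.2 (lt_of_le_of_ne (Real.cos_le_one _) hne)
      obtain ⟨j, hj⟩ := pow_unbounded_of_one_lt (1 / (1 - Real.cos (m * θ))) (one_lt_two)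
      rw [div_lt_iff₀ a1] at hj
      linarith [hgrow j m hm]
    have b1 := hone m₀ le_rfl
    have b2 := hone (m₀ + 1) (by omega)
    have b3 : Real.sin (m₀ * θ) = 0 := by
      have := Real.sin_sq_add_cos_sq (m₀ * θ)
      rw [b1] at this
      nlinarith
    have b4 : Real.cos θ = 1 := by
      push_cast at b2
      rw [add_mul, one_mul, Real.cos_add, b1, b3] at b2
      linarith
    have b5 := Complex.norm_mul_cos_add_sin_mul_I μ
    have b6 : Real.sin θ = 0 := by
      have := Real.sin_sq_add_cos_sq θ
      rw [b4] at this
      nlinarith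
    rw [← hθ, ← Complex.ofReal_cos, ← Complex.ofReal_sin, b4, b6] at b5
    simp only [Complex.ofReal_one, Complex.ofReal_zero, zero_mul, add_zero, mul_one] at b5
    rw [← b5]
    exact ⟨Complex.ofReal_im _, by rw [Complex.ofReal_re]; exact hnorm⟩

section Matrix

open Matrix

variable {N : ℕ}

/-- The eigenvalues of a nonsingular sign diminishing matrix are real and positive. -/
theorem eigenvalue_pos_of_signDim {M : Matrix (Fin N) (Fin N) ℝ} (hV : ∀ v, SignDim (M *ᵥ v) v)
    (hdet : M.det ≠ 0) {μ : ℂ} {z : Fin N → ℂ} (hz : z ≠ 0)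
    (hMz : M.map (Complex.ofReal) *ᵥ z = μ • z) : μ.im = 0 ∧ 0 < μ.re := by
  obtain ⟨a, ha, hfa⟩ := exists_first_ne_zero hz
  set w : Fin N → ℂ := (z a)⁻¹ • z with hw
  have hwa : w a = 1 := by simp [hw, ha]
  have hwi : ∀ i < a, w i = 0 := fun i hi => by simp [hw, hfa i hi]
  have hMw : ∀ i, ∑ j, (M i j : ℂ) * w j = μ * w i := by
    intro i
    have h1 : M.map (Complex.ofReal) *ᵥ w = μ • w := by
      rw [hw, mulVec_smul, hMz, smul_comm]
    exact congrFun h1 i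
  -- Since `M` is real, the real parts of the complex orbit form an orbit of `M`.
  set v : ℕ → Fin N → ℝ := fun m i => (μ ^ m * w i).re with hv
  have hstep : ∀ m, M *ᵥ v m = v (m + 1) := by
    intro m
    funext i
    have : μ ^ (m + 1) * w i = ∑ j, (M i j : ℂ) * (μ ^ m * w j) := by
      rw [pow_succ, mul_assoc, ← hMw, Finset.mul_sum]
      exact Finset.sum_congr rfl fun j _ => by ring
    simp only [hv]
    rw [this, Complex.re_sum]
    show ∑ j, M i j * (μ ^ m * w j).re = _
    exact Finset.sum_congr rfl fun j _ => (Complex.re_ofReal_mul _ _).symm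
  have hinj : ∀ u : Fin N → ℝ, u ≠ 0 → M *ᵥ u ≠ 0 := fun u hu h =>
    hdet (exists_mulVec_eq_zero_iff.1 ⟨u, hu, h⟩)
  have hne : ∀ m, v m ≠ 0 := by
    intro m
    induction m with
    | zero => intro h; have := congrFun h a; simp [hv, hwa] at this
    | succ m ih => rw [← hstep]; exact hinj _ ih
  have hμ : μ ≠ 0 := by
    rintro rfl
    exact hne 1 (by funext i; simp [hv])
  have hdim : ∀ m, SignDim (v (m + 1)) (v m) := fun m => hstep m ▸ hV (v m)
  have hanti : Antitone fun m => altNum (v m) := antitone_nat_of_succ_le fun m => (hdim m).altNum_le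
  -- From the minimum on, the number of alternations is constant, so `SignDim.first_sign` freezes
  -- the sign of the first nonzero entry.
  obtain ⟨m₀, hm₀⟩ : ∃ m₀, ∀ m, altNum (v m₀) ≤ altNum (v m) :=
    ⟨Function.argmin fun m => altNum (v m), fun m =>
      Function.argmin_le (fun m => altNum (v m)) m⟩
  choose f hf1 hf2 using fun m => exists_first_ne_zero (hne m)
  have hsign : ∀ m ≥ m₀, 0 < v m (f m) * v m₀ (f m₀) := by
    intro m hm
    induction m, hm using Nat.le_induction with
    | base => exact mul_self_pos.2 (hf1 m₀)
    | succ m hm ih =>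
      have heq : altNum (v (m + 1)) = altNum (v m) :=
        le_antisymm (hanti (Nat.le_succ m)) ((hanti hm).trans (hm₀ _))
      have h1 := (hdim m).first_sign heq (hf1 _) (hf2 _) (hf1 _) (hf2 _)
      have h2 := mul_pos h1 ih
      have h3 : v (m + 1) (f (m + 1)) * v m (f m) * (v m (f m) * v m₀ (f m₀)) =
        v (m + 1) (f (m + 1)) * v m₀ (f m₀) * (v m (f m)) ^ 2 := by ring
      rw [h3] at h2
      exact pos_of_mul_pos_left h2 (by positivity)
  refine pos_of_re_pow_mul_nonneg hμ (hf1 m₀) (m₀ := m₀) fun m hm => ?_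
  -- Entries before `a` vanish, so this entry is either `0` or the first nonzero one.
  have hva : v m a = (μ ^ m).re := by simp [hv, hwa]
  by_cases h0 : v m a = 0
  · rw [← hva, h0, zero_mul]
  · have hfm : f m = a := by
      rcases lt_trichotomy (f m) a with h | h | h
      · exact absurd (by simp [hv, hwi _ h]) (hf1 m)
      · exact h
      · exact absurd (hf2 m a h) h0
    rw [← hva, ← hfm]
    exact (hsign m hm).le

/-- The first entry of an eigenvector does not vanish. -/
theorem eigenvector_first_ne_zero {M : Matrix (Fin (N + 1)) (Fin (N + 1)) ℝ}
    (hV : ∀ v, SignDim (M *ᵥ v) v) (hsup : ∀ i : Fin N, 0 < M i.castSucc i.succ) {r : ℝ} (hr : 0 < r)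
    {v : Fin (N + 1) → ℝ} (hv : v ≠ 0) (hMv : M *ᵥ v = r • v) : v 0 ≠ 0 := by
  obtain ⟨a, ha, hfa⟩ := exists_first_ne_zero hv
  intro h0
  obtain ⟨b, rfl⟩ : ∃ b : Fin N, a = b.succ :=
    Fin.exists_succ_eq.2 (by rintro rfl; exact ha h0) |>.imp fun _ h => h.symm
  have hp := exists_pos_perturb (fun i : {i // v i ≠ 0} => r * v i)
    (fun i => -(v b.succ * M i b.succ)) fun i => mul_ne_zero hr.ne' i.2
  have hlt : ∀ᶠ ε in 𝓝[>] (0 : ℝ), ε < 1 := nhdsWithin_le_nhds (Iio_mem_nhds one_pos)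
  obtain ⟨ε, ⟨hε, hε1⟩, hε0⟩ := ((hp.and hlt).and self_mem_nhdsWithin).exists
  have hε0 : 0 < ε := hε0
  -- Shrinking the first nonzero entry preserves all signs of `v`. In row `b`, where `v` vanishes,
  -- the superdiagonal entry of `M` then creates an entry opposite in sign to `v b.succ`, so `M *ᵥ
  -- v'` would have one alternation more than `v`.
  set v' : Fin (N + 1) → ℝ := v - Pi.single b.succ (ε * v b.succ) with hv'
  have hMv' : ∀ i, (M *ᵥ v') i = r * v i + ε * -(v b.succ * M i b.succ) := by
    intro i
    rw [hv', mulVec_sub, hMv, mulVec_single]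
    simp
    ring
  have hdim : SignDim v' v := by
    refine ⟨id, fun i hi => ?_, fun i j hij _ => hij⟩
    by_cases hib : i = b.succ
    · subst hib
      have : v' b.succ * v b.succ = (1 - ε) * (v b.succ * v b.succ) := by simp [hv']; ring
      rw [id, this]
      exact mul_pos (by linarith) (mul_self_pos.2 ha)
    · have : v' i = v i := by simp [hv', hib]
      rw [this] at hi
      rw [id, this]
      exact mul_self_pos.2 hi
  obtain ⟨l, hl, hlen⟩ := exists_alternation_cons ha hfa
  have hsign : ∀ i, v i ≠ 0 → 0 < v i * (M *ᵥ v') i := by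
    intro i hi
    have := hε ⟨i, hi⟩
    rw [mul_assoc] at this
    rw [hMv']
    exact pos_of_mul_pos_right this hr.le
  have hl' := hl.map (w := M *ᵥ v') (e := id) hsign fun i j hij _ => hij
  rw [List.map_id] at hl'
  have hz : v b.castSucc = 0 := hfa _ Fin.castSucc_lt_succ
  have hneg : (M *ᵥ v') b.castSucc * (M *ᵥ v') b.succ < 0 := by
    have h1 := hsign b.succ ha
    have h2 : (M *ᵥ v') b.castSucc = -(ε * M b.castSucc b.succ) * v b.succ := by
      rw [hMv', hz]; ring
    rw [h2]
    have h3 := mul_pos (mul_pos hε0 (hsup b)) h1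
    linarith
  have h1 := (hl'.cons Fin.castSucc_lt_succ hneg).length_le_altNum
  have h2 := (hV v').altNum_le
  have h3 := hdim.altNum_le
  rw [List.length_cons, hlen] at h1
  omega

end Matrix

/-! ### Simplicity of the eigenvalues -/

section Matrix

open Matrix Polynomial

/-- For real `r`, rotating `lam + η ζ - r` by the conjugate of `ζ` gives imaginary part `-(lam - r)
Im ζ`, independent of `η`. Hence a monic real-rooted polynomial cannot become small along a nonreal
ray unless it is small at its origin. -/
theorem prod_norm_sub_le {S : Multiset ℂ} (hS : ∀ r ∈ S, r.im = 0) (lam η : ℝ) {ζ : ℂ}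
    (hζ : ‖ζ‖ = 1) :
    |ζ.im| ^ S.card * ‖(S.map fun r => (lam : ℂ) - r).prod‖ ≤
      ‖(S.map fun r => (lam + η * ζ : ℂ) - r).prod‖ := by
  induction S using Multiset.induction with
  | empty => simp
  | cons r S ih =>
    have h1 := ih fun r hr => hS r (Multiset.mem_cons_of_mem hr)
    obtain ⟨d, hd⟩ : ∃ d : ℝ, (lam : ℂ) - r = d := by
      refine ⟨lam - r.re, ?_⟩
      apply Complex.ext
      · simp
      · simp [hS r (Multiset.mem_cons_self r S)]
    have h2 : |ζ.im| * ‖(lam : ℂ) - r‖ ≤ ‖(lam + η * ζ : ℂ) - r‖ := by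
      have e1 : (lam + η * ζ : ℂ) - r = d + η * ζ := by rw [← hd]; ring
      rw [e1, hd]
      have e2 : ‖(d + η * ζ : ℂ)‖ = ‖(starRingEnd ℂ ζ) * (d + η * ζ)‖ := by
        rw [norm_mul, Complex.norm_conj, hζ, one_mul]
      have e3 : ((starRingEnd ℂ ζ) * (d + η * ζ)).im = -(d * ζ.im) := by
        simp
        ring
      rw [e2]
      refine le_trans ?_ (Complex.abs_im_le_norm _)
      rw [e3, abs_neg, abs_mul, Complex.norm_real, Real.norm_eq_abs, mul_comm]
    rw [Multiset.map_cons, Multiset.map_cons, Multiset.prod_cons, Multiset.prod_cons, norm_mul,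
      norm_mul, Multiset.card_cons, pow_succ]
    calc |ζ.im| ^ S.card * |ζ.im| * (‖(lam : ℂ) - r‖ * ‖(S.map fun r => (lam : ℂ) - r).prod‖)
        = (|ζ.im| * ‖(lam : ℂ) - r‖) *
          (|ζ.im| ^ S.card * ‖(S.map fun r => (lam : ℂ) - r).prod‖) := by ring
      _ ≤ _ := mul_le_mul h2 h1 (by positivity) (norm_nonneg _)

/-- If the polynomials `p + τ q` have only real zeros for all small real `τ`, then multiple zeros of
`p` are zeros of `q`. -/
theorem eval_eq_zero_of_real_rooted {d : ℕ} {p q : ℝ[X]} {lam : ℝ}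
    (hp : 2 ≤ p.rootMultiplicity lam) (hp0 : p ≠ 0)
    (P : ℝ → ℂ[X]) (hmonic : ∀ τ, (P τ).Monic) (hdeg : ∀ τ, (P τ).natDegree = d)
    (hP : ∀ τ z, (P τ).eval z = (p.map (algebraMap ℝ ℂ)).eval z +
      τ * (q.map (algebraMap ℝ ℂ)).eval z)
    (hreal : ∀ᶠ τ in 𝓝 (0 : ℝ), ∀ r ∈ (P τ).roots, r.im = 0) : q.eval lam = 0 := by
  by_contra hq
  set m := p.rootMultiplicity lam with hm
  obtain ⟨h, hph, hh⟩ := Polynomial.exists_eq_pow_rootMultiplicity_mul_and_not_dvd p hp0 lam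
  rw [← hm] at hph
  have hc : h.eval lam ≠ 0 := fun hz => hh (dvd_iff_isRoot.2 hz)
  set c := h.eval lam with hcdef
  set κ := q.eval lam with hκ
  -- As `ζ ^ m = -1`, the leading term of `p` is negated along this ray; `m ≥ 2` keeps the ray off
  -- the real axis.
  set ζ : ℂ := Complex.exp ((Real.pi / m : ℝ) * Complex.I) with hζ
  have hmR : (m : ℝ) ≠ 0 := by positivity
  have hζn : ‖ζ‖ = 1 := Complex.norm_exp_ofReal_mul_I _
  have hζm : ζ ^ m = -1 := by
    rw [hζ, ← Complex.exp_nat_mul, ← Complex.exp_pi_mul_I]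
    congr 1
    have : (m : ℂ) ≠ 0 := by exact_mod_cast hmR
    push_cast
    field_simp
  have hζim : 0 < ζ.im := by
    rw [hζ, Complex.exp_ofReal_mul_I_im]
    apply Real.sin_pos_of_pos_of_lt_pi
    · have := Real.pi_pos; positivity
    · rw [div_lt_iff₀ (by positivity)]
      have : (2 : ℝ) ≤ m := by exact_mod_cast hp
      nlinarith [Real.pi_pos]
  set z : ℝ → ℂ := fun η => lam + η * ζ with hz
  -- With this `τ` the value at `lam` is `c η ^ m`, but at `lam + η ζ` the terms of order `η ^ m`
  -- cancel, which contradicts `prod_norm_sub_le` as `η → 0`.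
  set τ : ℝ → ℝ := fun η => c * η ^ m / κ with hτ
  have hmap : ∀ (f : ℝ[X]), (f.map (algebraMap ℝ ℂ)).eval (lam : ℂ) = (f.eval lam : ℝ) := by
    intro f
    have := Polynomial.eval_map_algebraMap (B := ℂ) f (algebraMap ℝ ℂ lam)
    rw [Polynomial.aeval_algebraMap_apply] at this
    simpa using this
  have hplam : p.eval lam = 0 := by
    rw [hph]; simp [show m ≠ 0 by omega]
  have hτ0 : Tendsto τ (𝓝[>] 0) (𝓝 0) := by
    have : Tendsto τ (𝓝[>] 0) (𝓝 (τ 0)) :=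
      (Continuous.tendsto (by simp only [hτ]; fun_prop) 0).mono_left nhdsWithin_le_nhds
    simpa [hτ, show m ≠ 0 by omega] using this
  set G : ℂ → ℂ := fun w => -(h.map (algebraMap ℝ ℂ)).eval w +
    (c / κ : ℝ) * (q.map (algebraMap ℝ ℂ)).eval w with hG
  have hval : ∀ η, (P (τ η)).eval (z η) = (η : ℂ) ^ m * G (z η) := by
    intro η
    rw [hP, hph, Polynomial.map_mul, Polynomial.map_pow, Polynomial.map_sub, Polynomial.map_X,
      Polynomial.map_C, eval_mul, eval_pow, eval_sub, eval_X, eval_C]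
    have e1 : z η - algebraMap ℝ ℂ lam = η * ζ := by simp [hz]
    rw [e1, mul_pow, hζm]
    simp only [hG, hτ]
    push_cast
    ring
  have hlow : ∀ᶠ η in 𝓝[>] (0 : ℝ), |ζ.im| ^ d * |c| ≤ ‖G (z η)‖ := by
    filter_upwards [hτ0.eventually hreal, self_mem_nhdsWithin] with η hη hη0
    have hη0 : 0 < η := hη0
    have key := prod_norm_sub_le hη lam η hζn
    have hs := IsAlgClosed.splits (P (τ η))
    rw [← hs.eval_eq_prod_roots_of_monic (hmonic _), ← hs.eval_eq_prod_roots_of_monic (hmonic _)]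
      at key
    rw [splits_iff_card_roots.1 hs, hdeg] at key
    have e1 : (P (τ η)).eval (lam : ℂ) = (c * η ^ m : ℝ) := by
      rw [hP, hmap, hmap, hplam, ← hκ]
      simp only [hτ]
      have : (κ : ℂ) ≠ 0 := by exact_mod_cast hq
      push_cast
      field_simp
      simp
    have e2 : (P (τ η)).eval (lam + η * ζ : ℂ) = (η : ℂ) ^ m * G (z η) := hval η
    rw [e1, e2, norm_mul, norm_pow, Complex.norm_real, Complex.norm_real, Real.norm_eq_abs,
      Real.norm_eq_abs, abs_mul, abs_pow, abs_of_pos hη0] at key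
    have hpm : 0 < η ^ m := by positivity
    refine le_of_mul_le_mul_left ?_ hpm
    linarith
  have hlim : Tendsto (fun η => ‖G (z η)‖) (𝓝[>] 0) (𝓝 0) := by
    have hcont : Continuous fun η => ‖G (z η)‖ := by
      simp only [hG, hz]
      fun_prop
    have h1 : Tendsto (fun η => ‖G (z η)‖) (𝓝[>] 0) (𝓝 ‖G (z 0)‖) :=
      (hcont.tendsto 0).mono_left nhdsWithin_le_nhds
    have h2 : G (z 0) = 0 := by
      have : z 0 = lam := by simp [hz]
      rw [this]
      simp only [hG]
      rw [hmap, hmap, ← hκ, ← hcdef]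
      have : (κ : ℂ) ≠ 0 := by exact_mod_cast hq
      push_cast
      field_simp
      ring
    rwa [h2, norm_zero] at h1
  have h1 := ge_of_tendsto hlim hlow
  have h2 : 0 < |ζ.im| ^ d * |c| := by
    have := abs_pos.2 hζim.ne'
    have := abs_pos.2 hc
    positivity
  linarith

variable {N : ℕ}

theorem im_eq_zero_of_mem_roots {M : Matrix (Fin N) (Fin N) ℝ} (hV : ∀ v, SignDim (M *ᵥ v) v)
    (hdet : M.det ≠ 0) {μ : ℂ} (hμ : μ ∈ (M.map (algebraMap ℝ ℂ)).charpoly.roots) :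
    μ.im = 0 ∧ 0 < μ.re := by
  have h1 := (mem_roots'.1 hμ).2
  rw [IsRoot.def, eval_charpoly] at h1
  obtain ⟨z, hz, hMz⟩ := exists_mulVec_eq_zero_iff.2 h1
  refine eigenvalue_pos_of_signDim hV hdet hz (μ := μ) ?_
  rw [sub_mulVec, sub_eq_zero] at hMz
  rw [show M.map Complex.ofReal = M.map (algebraMap ℝ ℂ) from rfl, ← hMz]
  ext i
  simp [Matrix.scalar_apply, mulVec_diagonal]

theorem SignDim.of_pos_mul {ι : Type*} [LT ι] {a v : ι → ℝ} (ha : ∀ i, 0 < a i) :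
    SignDim (fun i => a i * v i) v := by
  refine ⟨id, fun i hi => ?_, fun i j h _ => h⟩
  have : v i ≠ 0 := right_ne_zero_of_mul hi
  rw [id, mul_assoc]
  exact mul_pos (ha i) (mul_self_pos.2 this)

/-- The eigenvalues of a matrix which, together with its transpose, diminishes sign variations are
simple. -/
theorem rootMultiplicity_le_one {M : Matrix (Fin (N + 1)) (Fin (N + 1)) ℝ}
    (hV : ∀ v, SignDim (M *ᵥ v) v) (hV' : ∀ v, SignDim (Mᵀ *ᵥ v) v) (hdet : M.det ≠ 0)
    (hsup : ∀ i : Fin N, 0 < M i.castSucc i.succ) (hsub : ∀ i : Fin N, 0 < M i.succ i.castSucc)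
    {r : ℝ} (hr : 0 < r) : M.charpoly.rootMultiplicity r ≤ 1 := by
  by_contra hcon
  have h2 : 2 ≤ M.charpoly.rootMultiplicity r := by omega
  -- Scaling column `0` by `1 + τ > 0` preserves sign diminution and nonsingularity, hence
  -- real-rootedness; the characteristic polynomial is affine in `τ` with slope `Q`.
  set D : ℝ → Fin (N + 1) → ℝ := fun τ => Function.update 1 0 (1 + τ) with hD
  set Q : ℝ[X] := (updateCol (charmatrix M) 0 (fun i => C (-(M i 0)))).det with hQ
  have hQeval : ∀ (z : ℂ), (Q.map (algebraMap ℝ ℂ)).eval z =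
      (updateCol (scalar _ z - M.map (algebraMap ℝ ℂ)) 0 fun i => -(M i 0 : ℂ)).det := by
    intro z
    have h := RingHom.map_det (Polynomial.eval₂RingHom (algebraMap ℝ ℂ) z)
      (updateCol (charmatrix M) 0 fun i => C (-(M i 0)))
    rw [Polynomial.coe_eval₂RingHom] at h
    rw [hQ, eval_map, h]
    congr 1
    ext i j
    rcases eq_or_ne j 0 with rfl | hj
    · simp
    · rcases eq_or_ne i j with rfl | hij
      · simp [hj]
      · simp [hj, hij]
  have key := eval_eq_zero_of_real_rooted (d := N + 1) (q := Q) h2 M.charpoly_monic.ne_zero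
    (fun τ => ((M * diagonal (D τ)).map (algebraMap ℝ ℂ)).charpoly) (fun τ => charpoly_monic _)
    (fun τ => by simp [charpoly_natDegree_eq_dim]) (fun τ z => by
      rw [eval_charpoly, hQeval, ← charpoly_map, eval_charpoly]
      have e1 : scalar (Fin (N + 1)) z - (M * diagonal (D τ)).map (algebraMap ℝ ℂ) =
          updateCol (scalar _ z - M.map (algebraMap ℝ ℂ)) 0
            ((fun i => (scalar (Fin (N + 1)) z - M.map (algebraMap ℝ ℂ)) i 0) +
              (τ : ℂ) • fun i => -(M i 0 : ℂ)) := by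
        ext i j
        rcases eq_or_ne j 0 with rfl | hj
        · simp [hD, mul_diagonal]
          ring
        · simp [hD, mul_diagonal, hj]
      rw [e1, det_updateCol_add, det_updateCol_smul]
      congr 2
      exact updateCol_eq_self _ _)
    (by
      filter_upwards [Ioi_mem_nhds (show (-1 : ℝ) < 0 by norm_num)] with τ hτ μ hμ
      rw [mem_Ioi] at hτ
      have hpos : ∀ i, 0 < D τ i := by
        intro i
        rcases eq_or_ne i 0 with rfl | hi
        · simp [hD]; linarith
        · simp [hD, hi]
      refine (im_eq_zero_of_mem_roots (fun v => ?_) ?_ hμ).1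
      · rw [← mulVec_mulVec]
        refine (hV _).trans ?_
        have : diagonal (D τ) *ᵥ v = fun i => D τ i * v i := by
          ext i; rw [mulVec_diagonal]
        rw [this]
        exact SignDim.of_pos_mul hpos
      · rw [det_mul, det_diagonal]
        exact mul_ne_zero hdet (Finset.prod_pos fun i _ => hpos i).ne')
  have hQr : (updateCol (scalar _ r - M) 0 fun i => -(M i 0)).det = 0 := by
    have h := RingHom.map_det (Polynomial.evalRingHom r)
      (updateCol (charmatrix M) 0 fun i => C (-(M i 0)))
    rw [Polynomial.coe_evalRingHom, ← hQ, key] at h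
    rw [h]
    congr 1
    ext i j
    rcases eq_or_ne j 0 with rfl | hj
    · simp
    · rcases eq_or_ne i j with rfl | hij
      · simp [hj]
      · simp [hj, hij]
  obtain ⟨u, hu, hMu⟩ := exists_mulVec_eq_zero_iff.2 hQr
  set u' : Fin (N + 1) → ℝ := Function.update u 0 0 with hu'
  have e1 : r • u' - M *ᵥ u' = u 0 • fun i => M i 0 := by
    funext i
    have h1 := congrFun hMu i
    rw [mulVec, dotProduct, Fin.sum_univ_succ] at h1
    have h2 : ((r • u' - M *ᵥ u') i : ℝ) = ((scalar (Fin (N + 1)) r - M) *ᵥ u') i := by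
      rw [sub_mulVec]
      simp [Matrix.scalar_apply]
    rw [h2, mulVec, dotProduct, Fin.sum_univ_succ]
    simp only [hu', Function.update_self, mul_zero, zero_add, Pi.smul_apply, smul_eq_mul]
    simp [Fin.succ_ne_zero] at h1 ⊢
    linarith
  have hroot : M.charpoly.eval r = 0 := by
    have : M.charpoly.IsRoot r := (rootMultiplicity_pos M.charpoly_monic.ne_zero).1 (by omega)
    exact this
  -- a left eigenvector
  obtain ⟨y, hy, hMy⟩ : ∃ y : Fin (N + 1) → ℝ, y ≠ 0 ∧ Mᵀ *ᵥ y = r • y := by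
    rw [← charpoly_transpose, eval_charpoly] at hroot
    obtain ⟨y, hy, hMy⟩ := exists_mulVec_eq_zero_iff.2 hroot
    refine ⟨y, hy, ?_⟩
    rw [sub_mulVec, sub_eq_zero] at hMy
    rw [← hMy]
    ext i
    simp [Matrix.scalar_apply, mulVec_diagonal]
  have hy0 := eigenvector_first_ne_zero hV' (fun i => by simpa using hsub i) hr hy hMy
  -- Pairing `(r - M) u' = u 0 • (column 0 of M)` with the left eigenvector `y` leaves `u 0 * (r * y
  -- 0) = 0`.
  have hu0 : u 0 = 0 := by
    have h3 : y ⬝ᵥ (r • u' - M *ᵥ u') = 0 := by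
      rw [dotProduct_sub, dotProduct_mulVec, ← mulVec_transpose, hMy]
      simp
    rw [e1, dotProduct_smul] at h3
    have h4 : (y ⬝ᵥ fun i => M i 0) = r * y 0 := by
      have := congrFun hMy 0
      simpa [mulVec, dotProduct, mul_comm] using this
    rw [h4, smul_eq_mul] at h3
    rcases mul_eq_zero.1 h3 with h | h
    · exact h
    · exact absurd h (mul_ne_zero hr.ne' hy0)
  have huu : u' = u := by
    rw [hu', ← hu0, Function.update_eq_self]
  rw [huu, hu0, zero_smul, sub_eq_zero] at e1
  exact eigenvector_first_ne_zero hV hsup hr hu e1.symm hu0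

theorem exists_mulVec_eq_smul_of_isRoot {M : Matrix (Fin N) (Fin N) ℝ} {r : ℝ}
    (h : M.charpoly.IsRoot r) : ∃ v ≠ 0, M *ᵥ v = r • v := by
  rw [IsRoot.def, eval_charpoly] at h
  obtain ⟨y, hy, hMy⟩ := exists_mulVec_eq_zero_iff.2 h
  refine ⟨y, hy, ?_⟩
  rw [sub_mulVec, sub_eq_zero] at hMy
  rw [← hMy]
  ext i
  simp [Matrix.scalar_apply, mulVec_diagonal]

/-- The characteristic polynomial has `N` complex roots with multiplicity; all are positive reals
and simple, hence distinct. -/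
theorem exists_eigenvalues {M : Matrix (Fin N) (Fin N) ℝ}
    (hV : ∀ v, SignDim (M *ᵥ v) v) (hV' : ∀ v, SignDim (Mᵀ *ᵥ v) v) (hdet : M.det ≠ 0)
    (hsup : ∀ i j : Fin N, (i : ℕ) + 1 = j → 0 < M i j)
    (hsub : ∀ i j : Fin N, (j : ℕ) + 1 = i → 0 < M i j) :
    ∃ Λ : Finset ℝ, Λ.card = N ∧ ∀ r ∈ Λ, 0 < r ∧ ∃ v ≠ 0, M *ᵥ v = r • v := by
  classical
  set S := (M.map (algebraMap ℝ ℂ)).charpoly.roots with hS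
  have hreal : ∀ μ ∈ S, μ.im = 0 ∧ 0 < μ.re := fun μ hμ => im_eq_zero_of_mem_roots hV hdet hμ
  have hre : ∀ μ ∈ S, algebraMap ℝ ℂ μ.re = μ := fun μ hμ =>
    Complex.ext (by simp) (by simp [(hreal μ hμ).1])
  have hinj : Function.Injective (algebraMap ℝ ℂ) := (algebraMap ℝ ℂ).injective
  have hnodup : S.Nodup := by
    rw [Multiset.nodup_iff_count_le_one]
    intro μ
    by_cases hμ : μ ∈ S
    · rw [hS, count_roots, ← hre μ hμ, charpoly_map, ← eq_rootMultiplicity_map hinj]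
      obtain _ | N := N
      · rw [charpoly_isEmpty, ← C_1, rootMultiplicity_C]
        exact zero_le_one
      · exact rootMultiplicity_le_one hV hV' hdet (fun i => hsup _ _ (by simp))
          (fun i => hsub _ _ (by simp)) (hreal μ hμ).2
    · rw [Multiset.count_eq_zero_of_notMem hμ]; exact zero_le_one
  have hcard : S.card = N := by
    rw [hS, splits_iff_card_roots.1 (IsAlgClosed.splits _), charpoly_natDegree_eq_dim,
      Fintype.card_fin]
  refine ⟨S.toFinset.image Complex.re, ?_, ?_⟩
  · rw [Finset.card_image_of_injOn, Multiset.toFinset_card_of_nodup hnodup, hcard]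
    intro a ha b hb hab
    have ha' : a ∈ S := by simpa using ha
    have hb' : b ∈ S := by simpa using hb
    rw [← hre a ha', ← hre b hb']
    exact congrArg _ hab
  · intro r hr
    obtain ⟨μ, hμ, rfl⟩ := Finset.mem_image.1 hr
    have hμ' : μ ∈ S := by simpa using hμ
    refine ⟨(hreal μ hμ').2, exists_mulVec_eq_smul_of_isRoot ?_⟩
    have h1 := (mem_roots'.1 hμ').2
    rw [← hre μ hμ', charpoly_map] at h1
    exact h1.of_map hinj

end Matrix

/-! ### The interior collocation matrix at the Greville nodes -/

section Greville

variable {n k : ℕ} {x : ℤ → ℝ}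

namespace IsExtendedKnotSequence

theorem grevilleNode_lt (hx : IsExtendedKnotSequence n k x) (hk : 1 ≤ k) {i j : ℤ}
    (hi : -(k : ℤ) ≤ i) (hij : i < j) (hj : j < n) : grevilleNode x k i < grevilleNode x k j := by
  have hk' : (0 : ℝ) < k := by exact_mod_cast hk
  have step : ∀ m : ℤ, -(k : ℤ) ≤ m → m + 1 < n → grevilleNode x k m < grevilleNode x k (m + 1) := by
    intro m h1 h2
    have h3 := grevilleNode_sub x hk m
    have h4 := hx.lt_of (i := m + 1) (j := m + k + 1) (by omega) (by omega) (by omega) (by omega) h2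
    have : 0 < (k : ℝ) * (grevilleNode x k (m + 1) - grevilleNode x k m) := by linarith
    linarith [pos_of_mul_pos_right this hk'.le]
  revert hj
  refine Int.leInduction (m := i + 1) (motive := fun j _ => j < n →
    grevilleNode x k i < grevilleNode x k j) (fun h => step i hi h) ?_ j (by omega)
  intro m hm ih h
  exact (ih (by omega)).trans (step m (by omega) h)

theorem grevilleNode_mem_Ioo (hx : IsExtendedKnotSequence n k x) (hk : 2 ≤ k) {m : ℤ}
    (h1 : -(k : ℤ) < m) (h2 : m + 1 < n) : grevilleNode x k m ∈ Ioo (x (m + 1)) (x (m + k)) := by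
  have hk' : (0 : ℝ) < k := by exact_mod_cast (by omega : 0 < k)
  have hlt := hx.lt_of (i := m + 1) (j := m + k) (by omega) (by omega) (by omega) (by omega) h2
  constructor
  · rw [grevilleNode, lt_div_iff₀ hk']
    have : ∑ i ∈ Finset.Icc 1 k, x (m + 1) < ∑ i ∈ Finset.Icc 1 k, x (m + (i : ℤ)) := by
      refine Finset.sum_lt_sum (fun i hi => ?_) ⟨k, by simp; omega, hlt⟩
      rw [Finset.mem_Icc] at hi
      exact hx.mono (by omega) (by omega) (by omega)
    simpa [mul_comm] using this
  · rw [grevilleNode, div_lt_iff₀ hk']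
    have : ∑ i ∈ Finset.Icc 1 k, x (m + (i : ℤ)) < ∑ i ∈ Finset.Icc 1 k, x (m + k) := by
      refine Finset.sum_lt_sum (fun i hi => ?_) ⟨1, by simp; omega, by simpa using hlt⟩
      rw [Finset.mem_Icc] at hi
      exact hx.mono (by omega) (by omega) (by omega)
    simpa [mul_comm] using this

theorem grevilleNode_mem_unit (hx : IsExtendedKnotSequence n k x) (hk : 2 ≤ k) {m : ℤ}
    (h1 : -(k : ℤ) < m) (h2 : m + 1 < n) : grevilleNode x k m ∈ Ioo (0 : ℝ) 1 := by
  have h := hx.grevilleNode_mem_Ioo hk h1 h2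
  exact ⟨(hx.mem_Icc (by omega) (by omega)).1.trans_lt h.1,
    h.2.trans_le (hx.mem_Icc (by omega) (by omega)).2⟩

/-- The node `ξ_m` lies strictly between `x_{m+1}` and `x_{m+k}`, an interval common to the supports
of `N_{m-1}`, `N_m` and `N_{m+1}`. For `k = 1` that interval would be empty. -/
theorem normB_grevilleNode_pos (hx : IsExtendedKnotSequence n k x) (hk : 2 ≤ k) {m j : ℤ}
    (h1 : -(k : ℤ) < m) (h2 : m + 1 < n) (hj1 : -(k : ℤ) ≤ j) (hj2 : j < n) (hmj : m ≤ j + 1)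
    (hjm : j ≤ m + 1) : 0 < normB x k j (grevilleNode x k m) := by
  have h := hx.grevilleNode_mem_Ioo hk h1 h2
  exact hx.normB_pos k hj1 (by omega) (hx.grevilleNode_mem_unit hk h1 h2)
    ((hx.mono hj1 hjm (by omega)).trans_lt h.1)
    (h.2.trans_le (hx.mono (by omega) (by omega) (by omega)))

end IsExtendedKnotSequence

/-- The index of the `i`-th interior B-spline. -/
def innerIndex (k : ℕ) {N : ℕ} (i : Fin N) : ℤ := (i : ℤ) + 1 - k

theorem innerIndex_strictMono (k N : ℕ) : StrictMono (innerIndex k : Fin N → ℤ) := by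
  intro i j h
  have : (i : ℕ) < j := h
  unfold innerIndex
  omega

/-- The interior collocation matrix `N_j(ξ_i)`. -/
noncomputable def innerMatrix (x : ℤ → ℝ) (n k : ℕ) :
    Matrix (Fin (n + k - 2)) (Fin (n + k - 2)) ℝ :=
  fun i j => normB x k (innerIndex k j) (grevilleNode x k (innerIndex k i))

open Matrix

namespace SignDim

/-- The index map sends nonzero entries to nonzero entries, so on these it stays in the range of
`g`; elsewhere its value is irrelevant. -/
theorem of_extend {ι κ ν : Type*} [LinearOrder ι] [LinearOrder κ] [LT ν] {g : ι → κ}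
    (hg : StrictMono g) {a : ν → ℝ} {b : ι → ℝ} (h : SignDim a (Function.extend g b 0)) [Nonempty ι] :
    SignDim a b := by
  obtain ⟨e, h1, h2⟩ := h
  have key : ∀ i, a i ≠ 0 → ∃ s, g s = e i := by
    intro i hi
    by_contra hcon
    have := h1 i hi
    rw [Function.extend_apply' _ _ _ hcon] at this
    simp at this
  have hs : ∀ i, a i ≠ 0 → g (Function.invFun g (e i)) = e i := fun i hi =>
    Function.invFun_eq (key i hi)
  refine ⟨fun i => Function.invFun g (e i), fun i hi => ?_, fun i j hij hneg => ?_⟩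
  · have := h1 i hi
    rwa [← hs i hi, hg.injective.extend_apply] at this
  · rw [← hg.lt_iff_lt, hs i (left_ne_zero_of_mul hneg.ne), hs j (right_ne_zero_of_mul hneg.ne)]
    exact h2 i j hij hneg

end SignDim

namespace IsExtendedKnotSequence

theorem splineSum_extend_innerIndex (v : Fin (n + k - 2) → ℝ) (i : Fin (n + k - 2)) :
    splineSum x n k (Function.extend (innerIndex k) v 0) (grevilleNode x k (innerIndex k i)) =
      (innerMatrix x n k *ᵥ v) i := by
  rw [splineSum_extend (innerIndex_strictMono k _).injective]
  · simp [mulVec, dotProduct, innerMatrix, mul_comm]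
  · intro r
    have := r.2
    simp only [Finset.mem_Ico, innerIndex]
    omega

theorem exists_eigenvalues_innerMatrix (hx : IsExtendedKnotSequence n k x) (hk : 1 ≤ k)
    (hnk : 2 ≤ k ∨ n = 1) :
    ∃ Λ : Finset ℝ, Λ.card = n + k - 2 ∧ ∀ r ∈ Λ, 0 < r ∧ ∃ v ≠ 0, innerMatrix x n k *ᵥ v = r • v := by
  -- The case `n = k = 1` has no interior nodes; otherwise `hnk` gives `2 ≤ k`.
  rcases Nat.eq_zero_or_pos (n + k - 2) with h0 | hpos
  · exact ⟨∅, by simp [h0], by simp⟩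
  have hk2 : 2 ≤ k := by omega
  have : NeZero (n + k - 2) := ⟨hpos.ne'⟩
  have hm := innerIndex_strictMono k (n + k - 2)
  have hr1 : ∀ i : Fin (n + k - 2), -(k : ℤ) < innerIndex k i := fun i => by
    simp only [innerIndex]; omega
  have hr2 : ∀ i : Fin (n + k - 2), innerIndex k i + 1 < n := fun i => by
    simp only [innerIndex]; omega
  have hmem : ∀ i : Fin (n + k - 2), innerIndex k i ∈ Finset.Ico (-(k : ℤ)) n := fun i => by
    have := hr1 i; have := hr2 i
    rw [Finset.mem_Ico]; omega
  set t : Fin (n + k - 2) → ℝ := fun i => grevilleNode x k (innerIndex k i) with ht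
  have htm : StrictMono t := fun i j h =>
    hx.grevilleNode_lt hk (hr1 i).le (hm h) (by have := hr2 j; omega)
  have htu : ∀ i, t i ∈ Ioo (0 : ℝ) 1 := fun i => hx.grevilleNode_mem_unit hk2 (hr1 i) (hr2 i)
  have hband : ∀ i j : Fin (n + k - 2), (i : ℕ) ≤ j + 1 → (j : ℕ) ≤ i + 1 →
      0 < innerMatrix x n k i j := fun i j h1 h2 =>
    hx.normB_grevilleNode_pos hk2 (hr1 i) (hr2 i) (hr1 j).le (by have := hr2 j; omega)
      (by simp only [innerIndex]; omega) (by simp only [innerIndex]; omega)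
  apply exists_eigenvalues
  · intro v
    have h := hx.signDim_splineSum hk htm htu (c := Function.extend (innerIndex k) v 0) (by
      intro j hj
      rw [Function.extend_apply']
      · rfl
      · rintro ⟨i, rfl⟩; exact hj (hmem i))
    have h2 := h.of_extend hm
    simp only [ht, splineSum_extend_innerIndex] at h2
    exact h2
  · intro y
    have h := (hx.signDim_bsplineMoment hk htm htu y).comp (innerIndex k) fun i j h => hm h
    convert h using 1
    funext j
    simp only [Function.comp, bsplineMoment, if_pos (hmem j)]
    simp [mulVec, dotProduct, innerMatrix, ht, mul_comm]
  · intro hdet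
    obtain ⟨v, hv, hMv⟩ := exists_mulVec_eq_zero_iff.2 hdet
    refine hv (hx.schoenberg_whitney hk _ (innerIndex k) hm hmem t htm htu
      (fun r => (hband r r (by omega) (by omega)).ne') v fun r => ?_)
    have := congrFun hMv r
    simpa [mulVec, dotProduct, innerMatrix, mul_comm] using this
  · exact fun i j h => hband i j (by omega) (by omega)
  · exact fun i j h => hband i j (by omega) (by omega)

theorem splineSum_lt (hx : IsExtendedKnotSequence n k x) {c : ℤ → ℝ} {C t : ℝ} {j : ℤ}
    (ht : t ∈ Ioo (0 : ℝ) 1) (hc : ∀ i, c i ≤ C) (hj : j ∈ Finset.Ico (-(k : ℤ)) n) (hcj : c j < C)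
    (hpos : 0 < normB x k j t) : splineSum x n k c t < C := by
  have h1 : ∑ j ∈ Finset.Ico (-(k : ℤ)) n, normB x k j t = 1 := by
    have := hx.sum_normB le_rfl ht
    simpa using this
  calc splineSum x n k c t < ∑ j ∈ Finset.Ico (-(k : ℤ)) n, C * normB x k j t := by
        refine Finset.sum_lt_sum (fun i hi => ?_) ⟨j, hj, mul_lt_mul_of_pos_right hcj hpos⟩
        rw [Finset.mem_Ico] at hi
        exact mul_le_mul_of_nonneg_right (hc i) (hx.normB_nonneg k hi.1 (by omega) ht)
    _ = C := by rw [← Finset.mul_sum, h1, mul_one]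

theorem abs_splineSum_le (hx : IsExtendedKnotSequence n k x) (c : ℤ → ℝ) {t : ℝ}
    (ht : t ∈ Ioo (0 : ℝ) 1) : |splineSum x n k c t| ≤ splineSum x n k (fun j => |c j|) t := by
  refine (Finset.abs_sum_le_sum_abs _ _).trans (Finset.sum_le_sum fun i hi => ?_)
  rw [Finset.mem_Ico] at hi
  rw [abs_mul, abs_of_nonneg (hx.normB_nonneg k hi.1 (by omega) ht)]

/-- A maximum principle: at the leftmost index where `|v|` is maximal, the left neighbour is
strictly smaller in modulus, or lies outside and counts as `0`, and its B-spline has positive weight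
in the average. -/
theorem eigenvalue_innerMatrix_lt_one (hx : IsExtendedKnotSequence n k x) (hk : 1 ≤ k)
    (hnk : 2 ≤ k ∨ n = 1) {r : ℝ} {v : Fin (n + k - 2) → ℝ} (hv : v ≠ 0)
    (hMv : innerMatrix x n k *ᵥ v = r • v) : r < 1 := by
  classical
  obtain ⟨i₀, hi₀⟩ := Function.ne_iff.1 hv
  have hk2 : 2 ≤ k := by have := i₀.2; omega
  obtain ⟨i₁, -, hi₁⟩ := Finset.exists_max_image Finset.univ (fun i => |v i|) ⟨i₀, Finset.mem_univ _⟩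
  obtain ⟨i, hi, hmin⟩ := Finset.exists_min_image
    (Finset.univ.filter fun i => ∀ j, |v j| ≤ |v i|) id ⟨i₁, by simpa using hi₁⟩
  have hmax : ∀ j, |v j| ≤ |v i| := by simpa using hi
  have hpos : 0 < |v i| := (abs_pos.2 hi₀).trans_le (hmax i₀)
  set c : ℤ → ℝ := Function.extend (innerIndex k) v 0 with hc
  have hinj := (innerIndex_strictMono k (n + k - 2)).injective
  have hle : ∀ j, |c j| ≤ |v i| := fun j => by
    by_cases hj : ∃ s : Fin (n + k - 2), innerIndex k s = j
    · obtain ⟨s, rfl⟩ := hj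
      rw [hc, hinj.extend_apply]; exact hmax s
    · rw [hc, Function.extend_apply' _ _ _ hj]; simp
  have hlt : |c (innerIndex k i - 1)| < |v i| := by
    by_cases hj : ∃ s : Fin (n + k - 2), innerIndex k s = innerIndex k i - 1
    · obtain ⟨s, hs⟩ := hj
      rw [← hs, hc, hinj.extend_apply]
      by_contra hcon
      have hsi := hmin s (by
        simp only [Finset.mem_filter, Finset.mem_univ, true_and]
        exact fun j => (hmax j).trans (not_lt.1 hcon))
      have := (innerIndex_strictMono k (n + k - 2)).monotone hsi
      simp only [id] at this
      omega
    · rw [hc, Function.extend_apply' _ _ _ hj]; simpa using hpos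
  have hr1 : -(k : ℤ) < innerIndex k i := by simp only [innerIndex]; omega
  have hr2 : innerIndex k i + 1 < n := by simp only [innerIndex]; omega
  have ht := hx.grevilleNode_mem_unit hk2 hr1 hr2
  have h1 := hx.splineSum_lt ht hle (j := innerIndex k i - 1)
    (Finset.mem_Ico.2 ⟨by omega, by omega⟩) hlt
    (hx.normB_grevilleNode_pos hk2 hr1 hr2 (by omega) (by omega) (by omega) (by omega))
  have h2 := (hx.abs_splineSum_le c ht).trans_lt h1
  rw [hc, splineSum_extend_innerIndex, hMv, Pi.smul_apply, smul_eq_mul, abs_mul] at h2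
  have h3 : |r| < 1 := by
    by_contra hcon
    nlinarith [not_lt.1 hcon]
  exact (le_abs_self r).trans_lt h3

/-- The interior eigenvalues of the collocation map. -/
theorem exists_inner_eigenvalues (hx : IsExtendedKnotSequence n k x) (hk : 1 ≤ k)
    (hnk : 2 ≤ k ∨ n = 1) :
    ∃ Λ : Finset ℝ, Λ.card = n + k - 2 ∧ ∀ r ∈ Λ, 0 < r ∧ r < 1 ∧ ∃ c : ℤ → ℝ, c ≠ 0 ∧
      (∀ j, c j ≠ 0 → -(k : ℤ) < j ∧ j + 1 < n) ∧
      ∀ m : ℤ, -(k : ℤ) < m → m + 1 < n → splineSum x n k c (grevilleNode x k m) = r * c m := by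
  obtain ⟨Λ, hcard, hΛ⟩ := hx.exists_eigenvalues_innerMatrix hk hnk
  refine ⟨Λ, hcard, fun r hr => ?_⟩
  obtain ⟨h0, v, hv, hMv⟩ := hΛ r hr
  have hinj := (innerIndex_strictMono k (n + k - 2)).injective
  refine ⟨h0, hx.eigenvalue_innerMatrix_lt_one hk hnk hv hMv,
    Function.extend (innerIndex k) v 0, ?_, ?_, ?_⟩
  · obtain ⟨i, hi⟩ := Function.ne_iff.1 hv
    refine Function.ne_iff.2 ⟨innerIndex k i, ?_⟩
    rwa [hinj.extend_apply]
  · intro j hj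
    by_cases h : ∃ s : Fin (n + k - 2), innerIndex k s = j
    · obtain ⟨s, rfl⟩ := h
      simp only [innerIndex]
      omega
    · exact absurd (by rw [Function.extend_apply' _ _ _ h]; rfl) hj
  · intro m h1 h2
    obtain ⟨i, rfl⟩ : ∃ i : Fin (n + k - 2), innerIndex k i = m :=
      ⟨⟨(m + k - 1).toNat, by omega⟩, by simp only [innerIndex]; omega⟩
    rw [splineSum_extend_innerIndex, hMv, hinj.extend_apply]
    rfl

end IsExtendedKnotSequence

end Greville

/-! ### Spectra of the two compositions of a pair of linear maps; dimension count -/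

section EndomorphismSpectrum

open Module Module.End

variable {K E F : Type*} [Field K] [AddCommGroup E] [Module K E] [AddCommGroup F] [Module K F]

theorem pow_comp_sub_smul_comm (f : E →ₗ[K] F) (g : F →ₗ[K] E) (μ : K) (m : ℕ) (v : E) :
    f (((g ∘ₗ f - μ • (1 : End K E)) ^ m) v) = ((f ∘ₗ g - μ • (1 : End K F)) ^ m) (f v) := by
  induction m generalizing v with
  | zero => simp
  | succ m ih => rw [pow_succ, pow_succ, Module.End.mul_apply, Module.End.mul_apply, ih]; simp

theorem map_mem_genEigenspace_comp (f : E →ₗ[K] F) (g : F →ₗ[K] E) {μ : K} {m : ℕ∞} {v : E}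
    (hv : v ∈ genEigenspace (g ∘ₗ f) μ m) : f v ∈ genEigenspace (f ∘ₗ g) μ m := by
  rw [mem_genEigenspace] at hv ⊢
  obtain ⟨l, hl, h⟩ := hv
  refine ⟨l, hl, ?_⟩
  rw [LinearMap.mem_ker] at h ⊢
  rw [← pow_comp_sub_smul_comm, h, map_zero]

/-- On the kernel of `f` the operator `g ∘ f - μ` acts as multiplication by `-μ`, which is
invertible. -/
theorem eq_zero_of_mem_genEigenspace_comp (f : E →ₗ[K] F) (g : F →ₗ[K] E) {μ : K} (hμ : μ ≠ 0)
    {m : ℕ∞} {v : E} (hv : v ∈ genEigenspace (g ∘ₗ f) μ m) (hf : f v = 0) : v = 0 := by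
  rw [mem_genEigenspace] at hv
  obtain ⟨l, -, h⟩ := hv
  rw [LinearMap.mem_ker] at h
  have key : ∀ l : ℕ, ((g ∘ₗ f - μ • (1 : End K E)) ^ l) v = (-μ) ^ l • v := by
    intro l
    induction l with
    | zero => simp
    | succ l ih =>
      rw [pow_succ', Module.End.mul_apply, ih, map_smul]
      simp [hf, pow_succ, smul_smul]
  rw [key] at h
  exact (smul_eq_zero.1 h).resolve_left (pow_ne_zero _ (neg_ne_zero.2 hμ))

theorem exists_injective_genEigenspace_comp (f : E →ₗ[K] F) (g : F →ₗ[K] E) {μ : K} (hμ : μ ≠ 0)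
    (m : ℕ∞) : ∃ φ : genEigenspace (g ∘ₗ f) μ m →ₗ[K] genEigenspace (f ∘ₗ g) μ m,
      Function.Injective φ := by
  refine ⟨f.restrict fun v hv => map_mem_genEigenspace_comp f g hv, ?_⟩
  rw [← LinearMap.ker_eq_bot, LinearMap.ker_eq_bot']
  rintro ⟨v, hv⟩ h
  have : f v = 0 := congrArg Subtype.val h
  exact Subtype.ext (eq_zero_of_mem_genEigenspace_comp f g hμ hv this)

/-- `f` and `g` inject the generalized eigenspaces into each other. Only `E` need be
finite-dimensional; this carries multiplicities from coefficient vectors to `C([0, 1])`. -/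
theorem finrank_genEigenspace_comp [FiniteDimensional K E] (f : E →ₗ[K] F) (g : F →ₗ[K] E) {μ : K}
    (hμ : μ ≠ 0) (m : ℕ∞) : finrank K (genEigenspace (f ∘ₗ g) μ m) =
      finrank K (genEigenspace (g ∘ₗ f) μ m) := by
  obtain ⟨φ, hφ⟩ := exists_injective_genEigenspace_comp f g hμ m
  obtain ⟨ψ, hψ⟩ := exists_injective_genEigenspace_comp g f hμ m
  have : Module.Finite K (genEigenspace (f ∘ₗ g) μ m) := Module.Finite.of_injective ψ hψ
  exact le_antisymm (LinearMap.finrank_le_finrank_of_injective hψ)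
    (LinearMap.finrank_le_finrank_of_injective hφ)

theorem hasEigenvalue_comp (f : E →ₗ[K] F) (g : F →ₗ[K] E) {μ : K} (hμ : μ ≠ 0)
    (h : HasEigenvalue (g ∘ₗ f) μ) : HasEigenvalue (f ∘ₗ g) μ := by
  obtain ⟨v, hv⟩ := h.exists_hasEigenvector
  exact hasEigenvalue_of_hasEigenvector (x := f v) ⟨map_mem_genEigenspace_comp f g hv.1,
    fun h0 => hv.2 (eq_zero_of_mem_genEigenspace_comp f g hμ hv.1 h0)⟩

variable [FiniteDimensional K E]

theorem sum_finrank_maxGenEigenspace_le (A : End K E) (S : Finset K) :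
    ∑ μ ∈ S, finrank K (maxGenEigenspace A μ) ≤ finrank K E := by
  classical
  have h1 : iSupIndep fun μ : S => maxGenEigenspace A (μ : K) :=
    A.independent_maxGenEigenspace.comp Subtype.val_injective
  have h2 := LinearMap.finrank_le_finrank_of_injective h1.dfinsupp_lsum_injective
  have h3 : finrank K (Π₀ μ : S, maxGenEigenspace A (μ : K)) =
      ∑ μ : S, finrank K (maxGenEigenspace A (μ : K)) :=
    Module.finrank_directSum K fun μ : S => maxGenEigenspace A (μ : K)
  rw [h3] at h2
  rwa [← Finset.sum_coe_sort S fun μ => finrank K (maxGenEigenspace A μ)]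

/-- If the known parts of the eigenspaces already exhaust the dimension, they are everything. -/
theorem spectrum_of_sum_finrank (A : End K E) (S : Finset K) (m : K → ℕ)
    (hm : ∀ μ ∈ S, m μ ≤ finrank K (eigenspace A μ)) (hsum : finrank K E ≤ ∑ μ ∈ S, m μ) :
    (∀ μ ∈ S, finrank K (eigenspace A μ) = m μ ∧ finrank K (maxGenEigenspace A μ) = m μ) ∧
      ∀ μ, HasEigenvalue A μ → μ ∈ S := by
  classical
  have hle : ∀ μ, finrank K (eigenspace A μ) ≤ finrank K (maxGenEigenspace A μ) := fun μ =>
    Submodule.finrank_mono ((genEigenspace A μ).monotone le_top)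
  have hm' : ∀ μ ∈ S, m μ ≤ finrank K (maxGenEigenspace A μ) := fun μ h => (hm μ h).trans (hle μ)
  refine ⟨fun μ hμ => ?_, fun μ hμ => ?_⟩
  · have h1 := sum_finrank_maxGenEigenspace_le A S
    have h2 : ∑ μ ∈ S, m μ = ∑ μ ∈ S, finrank K (maxGenEigenspace A μ) :=
      le_antisymm (Finset.sum_le_sum hm') (h1.trans hsum)
    have h3 := (Finset.sum_eq_sum_iff_of_le hm').1 h2 μ hμ
    have h4 := hle μ
    have h5 := hm μ hμ
    omega
  · by_contra hS
    have h1 := sum_finrank_maxGenEigenspace_le A (insert μ S)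
    rw [Finset.sum_insert hS] at h1
    have h2 := Finset.sum_le_sum hm'
    have h3 : 0 < finrank K (eigenspace A μ) := by
      rw [finrank_pos_iff]
      exact Submodule.nontrivial_iff_ne_bot.2 hμ
    have h4 := hle μ
    omega

end EndomorphismSpectrum

/-! ### B-splines on the closed interval and their boundary values -/

section BSplineOnUnitInterval

variable {n k : ℕ} {x : ℤ → ℝ}

namespace IsExtendedKnotSequence

theorem bspline_eq_normB (hx : IsExtendedKnotSequence n k x) (hk : 1 ≤ k) {j : ℤ}
    (h1 : -(k : ℤ) ≤ j) (h2 : j < n) {t : ℝ} (ht : t ∈ Ioo (0 : ℝ) 1) :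
    bspline x k j t = normB x k j t := by
  obtain ⟨G, hG, e⟩ := hx.exists_continuous_dividedDifference hk (k + 1) j h1
    (by push_cast; omega)
  have e' : ∀ s ∈ Ioo (0 : ℝ) 1, bsplineFormula x k j s = (x (j + k + 1) - x j) * G s := fun s hs => by
    rw [bsplineFormula, e s hs]
  have hval : normB x k j t = (x (j + k + 1) - x j) * G t := e' t ht
  rw [hval]
  refine extendFrom_eq (subset_closure ht) ?_
  have hc : Tendsto (fun t => (x (j + k + 1) - x j) * G t) (𝓝[Ioo (0 : ℝ) 1] t)
      (𝓝 ((x (j + k + 1) - x j) * G t)) :=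
    (Continuous.tendsto (by fun_prop) t).mono_left nhdsWithin_le_nhds
  refine hc.congr' ?_
  filter_upwards [self_mem_nhdsWithin] with s hs
  exact (e' s hs).symm

theorem eqOn_Icc_of_eqOn_Ioo {f g : ℝ → ℝ} (hf : ContinuousOn f (Icc 0 1))
    (hg : ContinuousOn g (Icc 0 1)) (h : EqOn f g (Ioo 0 1)) : EqOn f g (Icc 0 1) :=
  h.of_subset_closure hf hg Ioo_subset_Icc_self (by rw [closure_Ioo zero_ne_one])

theorem bspline_nonneg (hx : IsExtendedKnotSequence n k x) (hk : 1 ≤ k) {j : ℤ}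
    (h1 : -(k : ℤ) ≤ j) (h2 : j < n) {t : ℝ} (ht : t ∈ Icc (0 : ℝ) 1) : 0 ≤ bspline x k j t := by
  have hc := hx.continuousOn_bspline hk h1 h2
  have := eqOn_Icc_of_eqOn_Ioo hc (hc.sup continuousOn_const) (g := fun t => bspline x k j t ⊔ 0)
    (fun s hs => by
      have := hx.normB_nonneg k h1 (by omega) hs
      rw [← hx.bspline_eq_normB hk h1 h2 hs] at this
      simp [this]) ht
  rw [this]
  exact le_sup_right

theorem sum_fin_eq_sum_Ico (F : ℤ → ℝ) :
    ∑ i : Fin (n + k), F ((i : ℤ) - k) = ∑ j ∈ Finset.Ico (-(k : ℤ)) n, F j := by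
  refine Finset.sum_nbij (fun i => (i : ℤ) - k) ?_ ?_ ?_ fun _ _ => rfl
  · intro i _
    rw [Finset.mem_Ico]
    omega
  · intro i _ j _ h
    simp only at h
    exact Fin.ext (by omega)
  · intro j hj
    rw [Finset.mem_coe, Finset.mem_Ico] at hj
    exact ⟨⟨(j + k).toNat, by omega⟩, by simp, by simp only; omega⟩

theorem sum_bspline (hx : IsExtendedKnotSequence n k x) (hk : 1 ≤ k) {t : ℝ}
    (ht : t ∈ Icc (0 : ℝ) 1) : ∑ i : Fin (n + k), bspline x k ((i : ℤ) - k) t = 1 := by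
  refine eqOn_Icc_of_eqOn_Ioo (f := fun t => ∑ i : Fin (n + k), bspline x k ((i : ℤ) - k) t)
    (g := fun _ => 1) ?_ continuousOn_const ?_ ht
  · exact continuousOn_finsetSum _ fun i _ => hx.continuousOn_bspline hk (by omega) (by omega)
  · intro s hs
    have h1 := hx.sum_normB le_rfl hs
    simp only [add_sub_cancel_right] at h1
    rw [← sum_fin_eq_sum_Ico] at h1
    simp only
    rw [← h1]
    exact Finset.sum_congr rfl fun i _ => hx.bspline_eq_normB hk (by omega) (by omega) hs

theorem sum_grevilleNode_mul_bspline (hx : IsExtendedKnotSequence n k x) (hk : 1 ≤ k) {t : ℝ}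
    (ht : t ∈ Icc (0 : ℝ) 1) :
    ∑ i : Fin (n + k), grevilleNode x k ((i : ℤ) - k) * bspline x k ((i : ℤ) - k) t = t := by
  refine eqOn_Icc_of_eqOn_Ioo (f := fun t => ∑ i : Fin (n + k),
    grevilleNode x k ((i : ℤ) - k) * bspline x k ((i : ℤ) - k) t)
    (g := fun t => t) ?_ continuousOn_id ?_ ht
  · exact continuousOn_finsetSum _ fun i _ => continuousOn_const.mul
      (hx.continuousOn_bspline hk (by omega) (by omega))
  · intro s hs
    have h1 := hx.sum_grevilleNode_mul_normB hk hs
    rw [← sum_fin_eq_sum_Ico] at h1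
    simp only
    refine Eq.trans (Finset.sum_congr rfl fun i _ => ?_) h1
    rw [hx.bspline_eq_normB hk (by omega) (by omega) hs]

theorem grevilleNode_first (hx : IsExtendedKnotSequence n k x) : grevilleNode x k (-k) = 0 := by
  rw [grevilleNode, Finset.sum_eq_zero, zero_div]
  intro i hi
  rw [Finset.mem_Icc] at hi
  exact hx.left _ (by omega) (by omega)

theorem grevilleNode_last (hx : IsExtendedKnotSequence n k x) (hk : 1 ≤ k) :
    grevilleNode x k (n - 1) = 1 := by
  have hk' : (k : ℝ) ≠ 0 := by positivity
  have : ∑ i ∈ Finset.Icc 1 k, x ((n : ℤ) - 1 + (i : ℤ)) = ∑ i ∈ Finset.Icc 1 k, 1 := by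
    refine Finset.sum_congr rfl fun i hi => ?_
    rw [Finset.mem_Icc] at hi
    exact hx.right _ (by omega) (by omega)
  rw [grevilleNode, this]
  simp [hk']

/-- Linear precision at `0` is a vanishing sum of nonnegative terms `ξ_j N_j(0)`, and only the first
node is `0`. -/
theorem bspline_zero_eq_zero (hx : IsExtendedKnotSequence n k x) (hk : 1 ≤ k) {i : Fin (n + k)}
    (hi : (i : ℕ) ≠ 0) : bspline x k ((i : ℤ) - k) 0 = 0 := by
  have h0 : (0 : ℝ) ∈ Icc (0 : ℝ) 1 := by simp
  have h := hx.sum_grevilleNode_mul_bspline hk h0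
  rw [Finset.sum_eq_zero_iff_of_nonneg fun i _ => mul_nonneg
    (hx.grevilleNode_mem hk (by omega) (by omega)).1
    (hx.bspline_nonneg hk (by omega) (by omega) h0)] at h
  have hpos := hx.grevilleNode_lt hk (i := -k) (j := (i : ℤ) - k) le_rfl (by omega) (by omega)
  rw [hx.grevilleNode_first] at hpos
  exact (mul_eq_zero.1 (h i (Finset.mem_univ _))).resolve_left hpos.ne'

theorem bspline_one_eq_zero (hx : IsExtendedKnotSequence n k x) (hk : 1 ≤ k) {i : Fin (n + k)}
    (hi : (i : ℕ) + 1 ≠ n + k) : bspline x k ((i : ℤ) - k) 1 = 0 := by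
  have h0 : (1 : ℝ) ∈ Icc (0 : ℝ) 1 := by simp
  have h : ∑ i : Fin (n + k), (1 - grevilleNode x k ((i : ℤ) - k)) *
      bspline x k ((i : ℤ) - k) 1 = 0 := by
    simp only [sub_mul, one_mul, Finset.sum_sub_distrib]
    rw [hx.sum_bspline hk h0, hx.sum_grevilleNode_mul_bspline hk h0, sub_self]
  rw [Finset.sum_eq_zero_iff_of_nonneg fun i _ => mul_nonneg
    (sub_nonneg.2 (hx.grevilleNode_mem hk (by omega) (by omega)).2)
    (hx.bspline_nonneg hk (by omega) (by omega) h0)] at h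
  have hpos := hx.grevilleNode_lt hk (i := (i : ℤ) - k) (j := n - 1) (by omega) (by omega) (by omega)
  rw [hx.grevilleNode_last hk] at hpos
  exact (mul_eq_zero.1 (h i (Finset.mem_univ _))).resolve_left (sub_pos.2 hpos).ne'

end IsExtendedKnotSequence

end BSplineOnUnitInterval

/-! ### The spectrum of the Schoenberg operator -/

section SchoenbergOperator

open Module Module.End

variable (𝕜 : Type*) [RCLike 𝕜] {n k : ℕ} {x : ℤ → ℝ}

/-- Evaluation at the Greville nodes. -/
noncomputable def grevilleEval (hk : 1 ≤ k) (hx : IsExtendedKnotSequence n k x) :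
    C(Icc (0 : ℝ) 1, 𝕜) →ₗ[𝕜] (Fin (n + k) → 𝕜) where
  toFun f i := f ⟨grevilleNode x k ((i : ℤ) - k), hx.grevilleNode_mem hk (by omega) (by omega)⟩
  map_add' _ _ := rfl
  map_smul' _ _ := rfl

/-- The spline with given B-spline coefficients. -/
noncomputable def splineMap (hk : 1 ≤ k) (hx : IsExtendedKnotSequence n k x) :
    (Fin (n + k) → 𝕜) →ₗ[𝕜] C(Icc (0 : ℝ) 1, 𝕜) where
  toFun a :=
    { toFun := fun t => ∑ i : Fin (n + k), a i * ((bspline x k ((i : ℤ) - k) (t : ℝ) : ℝ) : 𝕜)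
      continuous_toFun := by
        refine continuous_finsetSum _ fun i _ => continuous_const.mul ?_
        exact RCLike.continuous_ofReal.comp
          (hx.continuousOn_bspline hk (by omega) (by omega)).domRestrict }
  map_add' a b := by
    ext t
    simp [add_mul, Finset.sum_add_distrib]
  map_smul' c a := by
    ext t
    simp [mul_assoc, Finset.mul_sum]

theorem schoenbergOperator_eq_comp (hk : 1 ≤ k) (hx : IsExtendedKnotSequence n k x) :
    schoenbergOperator 𝕜 hk hx = splineMap 𝕜 hk hx ∘ₗ grevilleEval 𝕜 hk hx := rfl

/-- The collocation operator on coefficient vectors. -/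
noncomputable def collocation (hk : 1 ≤ k) (hx : IsExtendedKnotSequence n k x) :
    End 𝕜 (Fin (n + k) → 𝕜) :=
  grevilleEval 𝕜 hk hx ∘ₗ splineMap 𝕜 hk hx

variable {𝕜}

theorem collocation_ofReal (hk : 1 ≤ k) (hx : IsExtendedKnotSequence n k x) {r : ℝ}
    {a : Fin (n + k) → ℝ} (h : ∀ i : Fin (n + k), ∑ j : Fin (n + k), a j *
      bspline x k ((j : ℤ) - k) (grevilleNode x k ((i : ℤ) - k)) = r * a i) :
    (fun i => ((a i : ℝ) : 𝕜)) ∈ eigenspace (collocation 𝕜 hk hx) ((r : ℝ) : 𝕜) := by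
  rw [mem_eigenspace_iff]
  funext i
  have : collocation 𝕜 hk hx (fun i => ((a i : ℝ) : 𝕜)) i = ((∑ j : Fin (n + k), a j *
      bspline x k ((j : ℤ) - k) (grevilleNode x k ((i : ℤ) - k)) : ℝ) : 𝕜) := by
    push_cast
    rfl
  rw [this, h]
  simp

theorem one_mem_eigenspace_collocation (hk : 1 ≤ k) (hx : IsExtendedKnotSequence n k x) :
    (fun _ => 1) ∈ eigenspace (collocation 𝕜 hk hx) (1 : 𝕜) := by
  have := collocation_ofReal (𝕜 := 𝕜) hk hx (r := 1) (a := fun _ => 1) fun i => by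
    simpa using hx.sum_bspline hk (hx.grevilleNode_mem hk (by omega) (by omega))
  simpa using this

theorem grevilleNode_mem_eigenspace_collocation (hk : 1 ≤ k) (hx : IsExtendedKnotSequence n k x) :
    (fun i : Fin (n + k) => ((grevilleNode x k ((i : ℤ) - k) : ℝ) : 𝕜)) ∈
      eigenspace (collocation 𝕜 hk hx) (1 : 𝕜) := by
  have := collocation_ofReal (𝕜 := 𝕜) hk hx (r := 1)
    (a := fun i => grevilleNode x k ((i : ℤ) - k)) fun i => by
    simpa using hx.sum_grevilleNode_mul_bspline hk (hx.grevilleNode_mem hk (by omega) (by omega))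
  simpa using this

theorem two_le_finrank_eigenspace_collocation (hk : 1 ≤ k) (hx : IsExtendedKnotSequence n k x) :
    2 ≤ finrank 𝕜 (eigenspace (collocation 𝕜 hk hx) (1 : 𝕜)) := by
  have hn := hx.pos_n
  let u : eigenspace (collocation 𝕜 hk hx) (1 : 𝕜) := ⟨_, one_mem_eigenspace_collocation hk hx⟩
  let w : eigenspace (collocation 𝕜 hk hx) (1 : 𝕜) :=
    ⟨_, grevilleNode_mem_eigenspace_collocation hk hx⟩
  have hli : LinearIndependent 𝕜 ![u, w] := by
    rw [LinearIndependent.pair_iff]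
    intro s t h
    have h' : ∀ i : Fin (n + k), s * 1 + t * ((grevilleNode x k ((i : ℤ) - k) : ℝ) : 𝕜) = 0 :=
      fun i => congrFun (congrArg Subtype.val h) i
    have h0 := h' ⟨0, by omega⟩
    have h1 := h' ⟨n + k - 1, by omega⟩
    have e0 : (((⟨0, by omega⟩ : Fin (n + k)) : ℕ) : ℤ) - k = -k := by simp
    have e1 : (((⟨n + k - 1, by omega⟩ : Fin (n + k)) : ℕ) : ℤ) - k = n - 1 := by
      simp only; omega
    rw [e0, hx.grevilleNode_first] at h0
    rw [e1, hx.grevilleNode_last hk] at h1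
    have hs : s = 0 := by simpa using h0
    refine ⟨hs, by simpa [hs] using h1⟩
  simpa using hli.fintype_card_le_finrank

/-- The two boundary equations hold because the only B-spline alive at an end point has coefficient
`0` there. -/
theorem one_le_finrank_eigenspace_collocation (hk : 1 ≤ k) (hx : IsExtendedKnotSequence n k x)
    {r : ℝ} {c : ℤ → ℝ} (hc : c ≠ 0) (hsupp : ∀ j, c j ≠ 0 → -(k : ℤ) < j ∧ j + 1 < n)
    (h : ∀ m : ℤ, -(k : ℤ) < m → m + 1 < n →
      splineSum x n k c (grevilleNode x k m) = r * c m) (hnk : 2 ≤ k ∨ n = 1) :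
    1 ≤ finrank 𝕜 (eigenspace (collocation 𝕜 hk hx) ((r : ℝ) : 𝕜)) := by
  obtain ⟨j, hj⟩ := Function.ne_iff.1 hc
  obtain ⟨hj1, hj2⟩ := hsupp j hj
  have hk2 : 2 ≤ k := by omega
  have hz : ∀ j, j ≤ -(k : ℤ) ∨ (n : ℤ) ≤ j + 1 → c j = 0 := fun j h => by
    by_contra hcon
    have := hsupp j hcon
    omega
  have hmem := collocation_ofReal (𝕜 := 𝕜) hk hx (r := r)
    (a := fun i => c ((i : ℤ) - k)) fun i => by
      rcases Nat.eq_zero_or_pos (i : ℕ) with h0 | h0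
      · have e : (i : ℤ) - k = -k := by omega
        rw [e, hx.grevilleNode_first, hz _ (Or.inl le_rfl), mul_zero]
        refine Finset.sum_eq_zero fun l _ => ?_
        rcases eq_or_ne (l : ℕ) 0 with hl | hl
        · rw [hz _ (Or.inl (by omega)), zero_mul]
        · rw [hx.bspline_zero_eq_zero hk hl, mul_zero]
      by_cases h1 : (i : ℕ) + 1 = n + k
      · have e : (i : ℤ) - k = n - 1 := by omega
        rw [e, hx.grevilleNode_last hk, hz _ (Or.inr (by omega)), mul_zero]
        refine Finset.sum_eq_zero fun l _ => ?_
        by_cases hl : (l : ℕ) + 1 = n + k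
        · rw [hz _ (Or.inr (by omega)), zero_mul]
        · rw [hx.bspline_one_eq_zero hk hl, mul_zero]
      rw [← h _ (by omega) (by omega), splineSum, ← IsExtendedKnotSequence.sum_fin_eq_sum_Ico]
      refine Finset.sum_congr rfl fun l _ => ?_
      rw [hx.bspline_eq_normB hk (by omega) (by omega)
        (hx.grevilleNode_mem_unit hk2 (by omega) (by omega))]
  refine Nat.one_le_iff_ne_zero.2 fun h0 => ?_
  rw [Submodule.finrank_eq_zero] at h0
  rw [h0, Submodule.mem_bot] at hmem
  have := congrFun hmem ⟨(j + k).toNat, by omega⟩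
  simp only [Pi.zero_apply, RCLike.ofReal_eq_zero] at this
  rw [show (((j + k).toNat : ℕ) : ℤ) - k = j by omega] at this
  exact hj this

/-- The product of the differences to all nodes is annihilated, and it is not the zero function
because it has only finitely many zeros. -/
theorem hasEigenvalue_zero_schoenbergOperator (hk : 1 ≤ k) (hx : IsExtendedKnotSequence n k x) :
    HasEigenvalue (schoenbergOperator 𝕜 hk hx) 0 := by
  let f : C(Icc (0 : ℝ) 1, 𝕜) :=
    ⟨fun t => ∏ i : Fin (n + k), (((t : ℝ) - grevilleNode x k ((i : ℤ) - k) : ℝ) : 𝕜),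
      continuous_finsetProd _ fun i _ => RCLike.continuous_ofReal.comp (by fun_prop)⟩
  refine hasEigenvalue_of_hasEigenvector (x := f) ⟨?_, ?_⟩
  · rw [mem_eigenspace_iff, zero_smul, schoenbergOperator_eq_comp, LinearMap.comp_apply]
    convert map_zero (splineMap 𝕜 hk hx)
    funext i
    exact Finset.prod_eq_zero (Finset.mem_univ i) (by simp)
  · intro h0
    obtain ⟨t, ht, hne⟩ := (Icc_infinite (zero_lt_one (α := ℝ))).exists_notMem_finset
      (Finset.univ.image fun i : Fin (n + k) => grevilleNode x k ((i : ℤ) - k))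
    have h1 : ∏ i : Fin (n + k), ((t - grevilleNode x k ((i : ℤ) - k) : ℝ) : 𝕜) = 0 :=
      show f ⟨t, ht⟩ = 0 by rw [h0]; rfl
    obtain ⟨i, -, hi⟩ := Finset.prod_eq_zero_iff.1 h1
    rw [RCLike.ofReal_eq_zero, sub_eq_zero] at hi
    exact hne (Finset.mem_image.2 ⟨i, Finset.mem_univ _, hi.symm⟩)

/-- The spectrum of the Schoenberg operator, without an ordering of the eigenvalues. -/
theorem exists_spectrum_schoenbergOperator (𝕜 : Type*) [RCLike 𝕜] (hk : 1 ≤ k)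
    (hnk : 2 ≤ k ∨ n = 1) (hx : IsExtendedKnotSequence n k x) :
    ∃ Λ : Finset ℝ, Λ.card = n + k - 2 ∧ (∀ r ∈ Λ, 0 < r ∧ r < 1) ∧
      (∀ μ : 𝕜, (schoenbergOperator 𝕜 hk hx).HasEigenvalue μ ↔
        μ = 0 ∨ μ = 1 ∨ ∃ r ∈ Λ, μ = ((r : ℝ) : 𝕜)) ∧
      (∀ r ∈ Λ, finrank 𝕜 ((schoenbergOperator 𝕜 hk hx).eigenspace ((r : ℝ) : 𝕜)) = 1 ∧
        finrank 𝕜 ((schoenbergOperator 𝕜 hk hx).maxGenEigenspace ((r : ℝ) : 𝕜)) = 1) ∧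
      finrank 𝕜 ((schoenbergOperator 𝕜 hk hx).eigenspace (1 : 𝕜)) = 2 ∧
      finrank 𝕜 ((schoenbergOperator 𝕜 hk hx).maxGenEigenspace (1 : 𝕜)) = 2 := by
  classical
  have hn := hx.pos_n
  obtain ⟨Λ, hcard, hΛ⟩ := hx.exists_inner_eigenvalues hk hnk
  have hinj : Function.Injective ((↑) : ℝ → 𝕜) := RCLike.ofReal_injective
  set S : Finset 𝕜 := Λ.image ((↑) : ℝ → 𝕜) with hS
  have h1S : (1 : 𝕜) ∉ S := by
    intro h
    obtain ⟨r, hr, hr1⟩ := Finset.mem_image.1 h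
    have : r = 1 := hinj (by simpa using hr1)
    exact (hΛ r hr).2.1.ne this
  have hSne : ∀ μ ∈ S, μ ≠ 1 := fun μ hμ h => h1S (h ▸ hμ)
  -- The known multiplicities `2` and `n + k - 2` times `1` add up to the full dimension `n + k`.
  obtain ⟨hA, hB⟩ := spectrum_of_sum_finrank (collocation 𝕜 hk hx) (insert 1 S)
    (fun μ => if μ = 1 then 2 else 1)
    (by
      intro μ hμ
      rcases Finset.mem_insert.1 hμ with rfl | hμ
      · simpa using two_le_finrank_eigenspace_collocation hk hx
      · simp only [if_neg (hSne μ hμ)]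
        obtain ⟨r, hr, rfl⟩ := Finset.mem_image.1 hμ
        obtain ⟨-, -, c, hc, hs, he⟩ := hΛ r hr
        exact one_le_finrank_eigenspace_collocation hk hx hc hs he hnk)
    (by
      rw [Finset.sum_insert h1S, Finset.sum_congr rfl fun μ hμ => if_neg (hSne μ hμ),
        Finset.sum_const, hS, Finset.card_image_of_injective _ hinj, hcard]
      simp
      omega)
  have hfin : ∀ μ : 𝕜, μ ≠ 0 → ∀ m : ℕ∞,
      finrank 𝕜 ((schoenbergOperator 𝕜 hk hx).genEigenspace μ m) =
        finrank 𝕜 ((collocation 𝕜 hk hx).genEigenspace μ m) := fun μ hμ m =>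
    finrank_genEigenspace_comp (splineMap 𝕜 hk hx) (grevilleEval 𝕜 hk hx) hμ m
  have hΛS : ∀ r ∈ Λ, ((r : ℝ) : 𝕜) ∈ S := fun r hr => Finset.mem_image_of_mem _ hr
  have h1 := hA 1 (Finset.mem_insert_self _ _)
  rw [if_pos rfl] at h1
  have hr : ∀ r ∈ Λ, finrank 𝕜 ((collocation 𝕜 hk hx).eigenspace ((r : ℝ) : 𝕜)) = 1 ∧
      finrank 𝕜 ((collocation 𝕜 hk hx).maxGenEigenspace ((r : ℝ) : 𝕜)) = 1 := fun r hr => by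
    have := hA _ (Finset.mem_insert_of_mem (hΛS r hr))
    rwa [if_neg (hSne _ (hΛS r hr))] at this
  have hr0 : ∀ r ∈ Λ, ((r : ℝ) : 𝕜) ≠ 0 := fun r hr => by
    simpa using (hΛ r hr).1.ne'
  have hne : ∀ μ : 𝕜, 0 < finrank 𝕜 ((schoenbergOperator 𝕜 hk hx).eigenspace μ) →
      (schoenbergOperator 𝕜 hk hx).HasEigenvalue μ := fun μ h hb => by
    unfold eigenspace at h
    rw [hb] at h
    simp at h
  have f1 : finrank 𝕜 ((schoenbergOperator 𝕜 hk hx).eigenspace (1 : 𝕜)) = 2 :=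
    (hfin 1 one_ne_zero 1).trans h1.1
  have fr : ∀ r ∈ Λ, finrank 𝕜 ((schoenbergOperator 𝕜 hk hx).eigenspace ((r : ℝ) : 𝕜)) = 1 :=
    fun r h => (hfin _ (hr0 r h) 1).trans (hr r h).1
  refine ⟨Λ, hcard, fun r hr => ⟨(hΛ r hr).1, (hΛ r hr).2.1⟩, fun μ => ⟨fun h => ?_, ?_⟩,
    fun r h => ⟨fr r h, (hfin _ (hr0 r h) ⊤).trans (hr r h).2⟩, f1,
    (hfin 1 one_ne_zero ⊤).trans h1.2⟩
  · refine or_iff_not_imp_left.2 fun hμ => ?_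
    have h2 := hB μ (hasEigenvalue_comp (grevilleEval 𝕜 hk hx) (splineMap 𝕜 hk hx) hμ h)
    rcases Finset.mem_insert.1 h2 with h3 | h3
    · exact Or.inl h3
    · obtain ⟨r, hr, rfl⟩ := Finset.mem_image.1 h3
      exact Or.inr ⟨r, hr, rfl⟩
  · rintro (rfl | rfl | ⟨r, hr, rfl⟩)
    · exact hasEigenvalue_zero_schoenbergOperator hk hx
    · exact hne _ (by rw [f1]; norm_num)
    · exact hne _ (by rw [fr r hr]; norm_num)

end SchoenbergOperator

/-! ### Ordering the eigenvalues and conclusion -/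

/-- A finite set of reals in `(0, 1)`, listed in decreasing order after `1, 1` and before `0`. -/
theorem exists_decreasing_enumeration {N : ℕ} {Λ : Finset ℝ} (hcard : Λ.card = N)
    (hΛ : ∀ r ∈ Λ, 0 < r ∧ r < 1) :
    ∃ l : ℕ → ℝ, l 0 = 1 ∧ l 1 = 1 ∧ (∀ i, 1 ≤ i → i < N + 2 → l (i + 1) < l i) ∧ l (N + 2) = 0 ∧
      (∀ i, 2 ≤ i → i < N + 2 → l i ∈ Λ) ∧ ∀ r ∈ Λ, ∃ i < N + 2, l i = r := by
  set e := Λ.orderEmbOfFin hcard with he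
  -- The embedding `e` is increasing, so index `i` is reflected: `i = 2` gives the largest element
  -- and `i = N + 1` the smallest.
  set l : ℕ → ℝ := fun i => if h' : i ≤ 1 then 1 else if h : i < N + 2 then e ⟨N + 1 - i, by omega⟩ else 0
    with hl
  have hmem : ∀ i, 2 ≤ i → i < N + 2 → l i ∈ Λ := fun i h1 h2 => by
    simp only [hl, dif_neg (not_le.2 (Nat.lt_of_succ_le h1)), dif_pos h2]
    exact Λ.orderEmbOfFin_mem hcard _
  have hlast : l (N + 2) = 0 := by simp [hl]
  have hone : l 1 = 1 := by simp [hl]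
  refine ⟨l, by simp [hl], hone, fun i h1 h2 => ?_, hlast, hmem, fun r hr => ?_⟩
  · rcases eq_or_lt_of_le (show i + 1 ≤ N + 2 by omega) with h | h
    · rw [h, hlast]
      rcases eq_or_lt_of_le h1 with rfl | h3
      · rw [hone]; exact one_pos
      · exact (hΛ _ (hmem i h3 h2)).1
    · rcases eq_or_lt_of_le h1 with rfl | h3
      · rw [hone]; exact (hΛ _ (hmem _ le_rfl h)).2
      · simp only [hl, dif_neg (not_le.2 h3), dif_pos h2, dif_neg (show ¬ i + 1 ≤ 1 by omega), dif_pos h]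
        exact e.strictMono (Fin.mk_lt_mk.2 (by omega))
  · have : r ∈ Set.range e := by rw [he, Finset.range_orderEmbOfFin]; exact hr
    obtain ⟨s, rfl⟩ := this
    refine ⟨N + 1 - s, by omega, ?_⟩
    have h1 : ¬ (N + 1 - (s : ℕ) ≤ 1) := by omega
    have h2 : N + 1 - (s : ℕ) < N + 2 := by omega
    simp only [hl, dif_neg h1, dif_pos h2]
    congr 1
    exact Fin.ext (by simp only; omega)

theorem mainTheorem4 {𝕜 : Type*} [RCLike 𝕜] (n k : ℕ) (hn : 1 ≤ n) (hk : 1 ≤ k)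
    (hnk : 2 ≤ k ∨ n = 1) (x : ℤ → ℝ) (hx : IsExtendedKnotSequence n k x) :
    (∃ l : ℕ → ℝ,
      -- the chain of eigenvalues
      l 0 = 1 ∧ l 1 = 1 ∧ (∀ i, 1 ≤ i → i < n + k → l (i + 1) < l i) ∧ l (n + k) = 0 ∧
      -- these are exactly the eigenvalues
      {μ : 𝕜 | (schoenbergOperator 𝕜 hk hx).HasEigenvalue μ} =
        {μ : 𝕜 | ∃ i ≤ n + k, μ = ((l i : ℝ) : 𝕜)} ∧
      -- the remaining positive eigenvalues have (geometric and algebraic) multiplicity one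
      (∀ i, 2 ≤ i → i < n + k →
        Module.finrank 𝕜 ((schoenbergOperator 𝕜 hk hx).eigenspace ((l i : ℝ) : 𝕜)) = 1 ∧
        Module.finrank 𝕜
          ((schoenbergOperator 𝕜 hk hx).maxGenEigenspace ((l i : ℝ) : 𝕜)) = 1)) ∧
    -- the eigenvalue one has (geometric and algebraic) multiplicity two
    Module.finrank 𝕜 ((schoenbergOperator 𝕜 hk hx).eigenspace (1 : 𝕜)) = 2 ∧
    Module.finrank 𝕜 ((schoenbergOperator 𝕜 hk hx).maxGenEigenspace (1 : 𝕜)) = 2 ∧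
    -- all nonzero eigenvalues are positive real numbers, and their number
    (∀ μ : 𝕜, (schoenbergOperator 𝕜 hk hx).HasEigenvalue μ → μ ≠ 0 →
      ∃ r : ℝ, 0 < r ∧ μ = (r : 𝕜)) ∧
    {μ : 𝕜 | (schoenbergOperator 𝕜 hk hx).HasEigenvalue μ ∧ μ ≠ 0}.ncard = n + k - 1 ∧
    {μ : 𝕜 | (schoenbergOperator 𝕜 hk hx).HasEigenvalue μ ∧ μ ≠ 0 ∧ μ ≠ 1}.ncard = n + k - 2 := by
  obtain ⟨Λ, hcard, hΛ, hspec, hsimple, h1, h2⟩ := exists_spectrum_schoenbergOperator 𝕜 hk hnk hx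
  have hinj : Function.Injective ((↑) : ℝ → 𝕜) := RCLike.ofReal_injective
  have hr0 : ∀ r ∈ Λ, ((r : ℝ) : 𝕜) ≠ 0 := fun r hr => by simpa using (hΛ r hr).1.ne'
  have hr1 : ∀ r ∈ Λ, ((r : ℝ) : 𝕜) ≠ 1 := fun r hr h => by
    have : r = 1 := hinj (by simpa using h)
    exact (hΛ r hr).2.ne this
  have hset : {μ : 𝕜 | (schoenbergOperator 𝕜 hk hx).HasEigenvalue μ ∧ μ ≠ 0 ∧ μ ≠ 1} =
      ((↑) : ℝ → 𝕜) '' (Λ : Set ℝ) := by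
    ext μ
    simp only [mem_ofPred_eq, hspec, mem_image, Finset.mem_coe]
    constructor
    · rintro ⟨h | h | ⟨r, hr, rfl⟩, h3, h4⟩
      · exact absurd h h3
      · exact absurd h h4
      · exact ⟨r, hr, rfl⟩
    · rintro ⟨r, hr, rfl⟩
      exact ⟨Or.inr (Or.inr ⟨r, hr, rfl⟩), hr0 r hr, hr1 r hr⟩
  have hncard : {μ : 𝕜 | (schoenbergOperator 𝕜 hk hx).HasEigenvalue μ ∧ μ ≠ 0 ∧ μ ≠ 1}.ncard =
      n + k - 2 := by
    rw [hset, ncard_image_of_injective _ hinj, ncard_coe_finset, hcard]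
  refine ⟨?_, h1, h2, fun μ hμ h0 => ?_, ?_, hncard⟩
  · obtain ⟨l, l0, l1, hlt, hlast, hmem, hsurj⟩ := exists_decreasing_enumeration hcard hΛ
    rw [show n + k - 2 + 2 = n + k by omega] at hlt hlast hmem hsurj
    refine ⟨l, l0, l1, hlt, hlast, ?_, fun i hi hi' => hsimple _ (hmem i hi hi')⟩
    ext μ
    simp only [mem_ofPred_eq, hspec]
    constructor
    · rintro (rfl | rfl | ⟨r, hr, rfl⟩)
      · exact ⟨n + k, le_rfl, by simp [hlast]⟩
      · exact ⟨0, by omega, by simp [l0]⟩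
      · obtain ⟨i, hi, rfl⟩ := hsurj r hr
        exact ⟨i, hi.le, rfl⟩
    · rintro ⟨i, hi, rfl⟩
      rcases eq_or_lt_of_le hi with rfl | hi
      · exact Or.inl (by simp [hlast])
      · rcases lt_or_ge i 2 with h | h
        · refine Or.inr (Or.inl ?_)
          have : i = 0 ∨ i = 1 := by omega
          rcases this with rfl | rfl
          · simp [l0]
          · simp [l1]
        · exact Or.inr (Or.inr ⟨l i, hmem i h hi, rfl⟩)
  · rcases (hspec μ).1 hμ with h | rfl | ⟨r, hr, rfl⟩
    · exact absurd h h0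
    · exact ⟨1, one_pos, by simp⟩
    · exact ⟨r, (hΛ r hr).1, rfl⟩
  · have hins : {μ : 𝕜 | (schoenbergOperator 𝕜 hk hx).HasEigenvalue μ ∧ μ ≠ 0} =
        insert 1 {μ : 𝕜 | (schoenbergOperator 𝕜 hk hx).HasEigenvalue μ ∧ μ ≠ 0 ∧ μ ≠ 1} := by
      ext μ
      simp only [mem_ofPred_eq, mem_insert_iff]
      constructor
      · rintro ⟨h, h0⟩
        by_cases hμ : μ = 1
        · exact Or.inl hμ
        · exact Or.inr ⟨h, h0, hμ⟩
      · rintro (rfl | ⟨h, h0, -⟩)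
        · exact ⟨(hspec 1).2 (Or.inr (Or.inl rfl)), one_ne_zero⟩
        · exact ⟨h, h0⟩
    rw [hins, ncard_insert_of_notMem (fun h => h.2.2 rfl)
      (by rw [hset]; exact Λ.finite_toSet.image _), hncard]
    omega
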